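/- Let $p,q$ be linearly independent complex polynomials of degree at most $d$ such that $|p|=|q|$ on the unit circle $\mathbf S^1$, so that the rational function $f=p/q$ maps $\mathbf S^1$ to $\mathbf S^1$, and suppose that all $2d-2$ zeros (counted with multiplicity) of the Wronskian $W(p,q)=p'q-q'p$ lie on $\mathbf S^1$. The net of $f$ is $\Gamma=f^{-1}(\mathbf S^1)\subset\overline{\mathbb C}$; its vertices are the zeros of $W(p,q)$, its edges are the connected components of $\Gamma$ minus the vertices, its chords are the edges inside the open unit disc, and the degree of a vertex is the number of edge ends at it. Let $r\ne s$ be points of $\mathbf S^1$, let $[r,s]$ and $(r,s)$ be the closed and open positively oriented arcs from $r$ to $s$, and let $L([r,s])$ be the argument increment of $f$ on $[r,s]$. Let $y\in(r,s)$ be a double zero of $W(p,q)$ which is a vertex of $\Gamma$ of degree $6$ such that both chords of $\Gamma$ with an end at $y$ have their other ends outside $(r,s)$. Suppose that all other vertices in $(r,s)$ are simple zeros of $W(p,q)$, and that $f$ is orientation preserving on the open arc from $r$ to the first vertex in $(r,s)$. Label the vertices in $(r,s)$, in the order of the arc, by $1,\dots,n$, where $y$ receives two consecutive labels; thus $n$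 is the number of vertices in $(r,s)$ with $y$ counted twice. The second row of the Young tableau $Y_\Gamma(r,s)$ consists of the labels of those vertices in $(r,s)$ which are joined by a chord of $\Gamma$ to an earlier vertex in $(r,s)$ (in particular, neither label of $y$ is in the second row). Let $O$ and $E$ be the numbers of odd and even entries in the second row, and let $\epsilon\in\{0,1\}$ be the residue of $n+1$ modulo $2$. Then $$L([r,s])\in\big((\epsilon-n+4O-1)\pi,\ (\epsilon+n-4E-1)\pi\big)$$ if the number of vertices strictly between $r$ and $y$ is odd, and $$L([r,s])\in\big((\epsilon-n+4O+1)\pi,\ (\epsilon+n-4E+1)\pi\big)$$ if it is even. -/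

import Mathlib

open Polynomial

noncomputable section

namespace CircleNet

/-- The Wronskian `W(p, q) = p' q - q' p`. -/
def wr (p q : ℂ[X]) : ℂ[X] := derivative p * q - derivative q * p

/-- `(p, q)` is a basis of a pencil of polynomials of degree at most `d` such that `f = p / q` maps
the unit circle to itself and all the `2 d - 2` zeros of `W(p, q)`, counted with multiplicity, lie
on the unit circle.  (As `W(p, q)` has the maximal degree `2 d - 2`, it has no zero at infinity.)
The polynomials `p` and `q` may have common zeros. -/
structure IsPencil (d : ℕ) (p q : ℂ[X]) : Prop where
  natDegree_num_le : p.natDegree ≤ d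
  natDegree_den_le : q.natDegree ≤ d
  linearIndependent : LinearIndependent ℂ ![p, q]
  norm_eq : ∀ z : ℂ, ‖z‖ = 1 → ‖p.eval z‖ = ‖q.eval z‖
  natDegree_wr : (wr p q).natDegree = 2 * d - 2
  norm_root : ∀ z : ℂ, (wr p q).IsRoot z → ‖z‖ = 1

/-- The rational function `p / q`. -/
def ratio (p q : ℂ[X]) : RatFunc ℂ := algebraMap ℂ[X] (RatFunc ℂ) p / algebraMap ℂ[X] (RatFunc ℂ) q

/-- A rational function, in lowest terms, as a map of the Riemann sphere to itself. -/
def ratMap (f : RatFunc ℂ) (x : OnePoint ℂ) : OnePoint ℂ :=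
  x.elim
    (if f.denom.coeff (max f.num.natDegree f.denom.natDegree) = 0 then OnePoint.infty
      else ((f.num.coeff (max f.num.natDegree f.denom.natDegree) /
        f.denom.coeff (max f.num.natDegree f.denom.natDegree) : ℂ) : OnePoint ℂ))
    (fun z => if f.denom.eval z = 0 then OnePoint.infty
      else ((f.num.eval z / f.denom.eval z : ℂ) : OnePoint ℂ))

/-- The net of `f = p / q`: the preimage of the unit circle under `f`, in the Riemann sphere. -/
def net (p q : ℂ[X]) : Set (OnePoint ℂ) :=
  ratMap (ratio p q) ⁻¹' ((fun z : ℂ => (z : OnePoint ℂ)) '' Metric.sphere 0 1)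

/-- The vertices of the net: the zeros of the Wronskian. -/
def vertices (p q : ℂ[X]) : Set (OnePoint ℂ) :=
  (fun z : ℂ => (z : OnePoint ℂ)) '' {z | (wr p q).IsRoot z}

/-- The edges of the net: the connected components of the net with the vertices removed. -/
def IsEdge (p q : ℂ[X]) (e : Set (OnePoint ℂ)) : Prop :=
  ∃ x ∈ net p q \ vertices p q, e = connectedComponentIn (net p q \ vertices p q) x

/-- The chords of the net: the edges inside the open unit disc. -/
def IsChord (p q : ℂ[X]) (c : Set (OnePoint ℂ)) : Prop :=
  IsEdge p q c ∧ c ⊆ (fun z : ℂ => (z : OnePoint ℂ)) '' Metric.ball 0 1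

/-- The degree of a vertex `v`: the number of edges ending at `v`, where an edge both of whose ends
are at `v` is counted twice. -/
def vertexDegree (p q : ℂ[X]) (v : OnePoint ℂ) : ℕ :=
  {e | IsEdge p q e ∧ v ∈ closure e}.ncard + {e | IsEdge p q e ∧ closure e = insert v e}.ncard

/-- The point `exp (i θ)` of the unit circle. -/
def pt (θ : ℝ) : ℂ := Complex.exp (θ * Complex.I)

/-- The (arguments in `(α, β)` of the) vertices of the net inside the open, positively oriented arc
of the unit circle from `exp (i α)` to `exp (i β)`; it is used for `β < α + 2 π`. -/
def arcVertices (p q : ℂ[X]) (α β : ℝ) : Set ℝ :=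
  {θ | θ ∈ Set.Ioo α β ∧ (wr p q).IsRoot (pt θ)}

/-- The multiplicity of the vertex `exp (i θ)` as a zero of the Wronskian. -/
def mult (p q : ℂ[X]) (θ : ℝ) : ℕ := (wr p q).rootMultiplicity (pt θ)

/-- The number of vertices in the open arc, counted with multiplicity. -/
def arcCount (p q : ℂ[X]) (α β : ℝ) : ℕ := ∑ᶠ θ ∈ arcVertices p q α β, mult p q θ

/-- The number of chords that join the vertex `exp (i θ)` to a vertex in the open arc from
`exp (i α)` to `exp (i θ)`. -/
def lowerChords (p q : ℂ[X]) (α θ : ℝ) : ℕ :=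
  {c | IsChord p q c ∧ (pt θ : OnePoint ℂ) ∈ closure c ∧
    ∃ t ∈ arcVertices p q α θ, (pt t : OnePoint ℂ) ∈ closure c}.ncard

/-- The second row of the Young tableau of the net on the arc from `exp (i α)` to `exp (i β)`, for a
net with only simple and double vertices in the arc.

The vertices in the arc are labelled `1, …, n` in their order on the arc, where a double vertex gets
two consecutive labels; so the labels of the vertex `exp (i θ)` start at `arcCount p q α θ + 1`.
The label `i` of a simple vertex is in the second row if and only if a chord joins this vertex to an
earlier vertex in the arc.  A double vertex is read as the pair of simple vertices into which it
splits in a nearby nondegenerate net.  If it is a common zero of `p` and `q` (a vertex of degree 2),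
then the two are joined by a chord, which puts the second label in the second row.
Otherwise (a vertex of degree 6) the two share its two chords without a crossing, so that the chords
to earlier vertices in the arc belong to the first of the two labels. -/
def secondRow (p q : ℂ[X]) (α β : ℝ) : Set ℕ :=
  {i | ∃ θ ∈ arcVertices p q α β,
    (∃ j, 1 ≤ j ∧ j ≤ lowerChords p q α θ ∧ i = arcCount p q α θ + j) ∨
    (p.IsRoot (pt θ) ∧ q.IsRoot (pt θ) ∧ i = arcCount p q α θ + 2)}

/-- The number of odd entries in the second row. -/
def oddCount (p q : ℂ[X]) (α β : ℝ) : ℕ := {i | i ∈ secondRow p q α β ∧ Odd i}.ncard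

/-- The number of even entries in the second row. -/
def evenCount (p q : ℂ[X]) (α β : ℝ) : ℕ := {i | i ∈ secondRow p q α β ∧ Even i}.ncard

/-- `φ` is a continuous choice of the argument of `f (exp (i θ))` for `θ ∈ S`. -/
def IsArgLift (f : RatFunc ℂ) (S : Set ℝ) (φ : ℝ → ℝ) : Prop :=
  ContinuousOn φ S ∧ ∀ θ ∈ S, ratMap f (pt θ : OnePoint ℂ) = (pt (φ θ) : OnePoint ℂ)

/-- `ℓ` is the argument increment of `f` on the closed, positively oriented arc from `exp (i α)` to
`exp (i β)`. -/
def IsArgIncrement (f : RatFunc ℂ) (α β ℓ : ℝ) : Prop :=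
  ∃ φ : ℝ → ℝ, IsArgLift f (Set.Icc α β) φ ∧ ℓ = φ β - φ α

/-- `f` maps the open arc from `exp (i α)` to `exp (i β)` to the unit circle and preserves
orientation there. -/
def OrientationPreservingOn (f : RatFunc ℂ) (α β : ℝ) : Prop :=
  ∃ φ : ℝ → ℝ, IsArgLift f (Set.Ioo α β) φ ∧ StrictMonoOn φ (Set.Ioo α β)

end CircleNet

end

/-! # The argument increment of a rational function on an arc of the circle

The quotient of a coprime pair maps the part of each face of the net in the unit disc bijectively onto
the disc, so that the boundary of a face is passed through once.  The chords do not cross, and they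
match the vertices of an arc; following the boundary of a face along the arc and its chords gives the
argument increment between unmatched vertices up to one turn, and summing over the unmatched vertices
gives the bounds. -/

noncomputable section

namespace CircleNet

open Set Filter Topology

/-! Write the quotient in lowest terms as `A / B`. All its critical points lie on the unit circle,
so on the part of the open disc with `|A| < |B|` it is a proper local homeomorphism onto the disc,
hence a covering (`CirclePair.isCoveringMap`). The disc is simply connected, so the quotient is
injective on each component of this part, a face, and takes each value of the circle at most once at
the regular boundary points of a face (`CirclePair.injOn_boundary`). A piece of the boundary of one
face, parametrized by the argument of the quotient (a `Track`), therefore has length at most `2π`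
(`Track.sub_le`). Exchanging `A` and `B` gives the same for the faces over the exterior of the disc.

Chords do not cross (`not_crossing`, `CirclePair.chord_noncrossing`), so the chords with both ends
in an arc match vertices like brackets. For an arc whose vertices are all matched, the boundary of
the face along its start follows the arc but replaces the part under each outermost chord by this
chord. On the other side of such a chord, the arc under it (shortened in the same way) and the chord
traversed backwards close up to the boundary of a face of the reciprocal quotient, whose length is a
positive multiple of `2π` and at most `2π`, hence one turn. So each matched pair changes the
increment by exactly one turn, with the sign of the orientation before its later end
(`CirclePair.track_of_matching`). The corrected increment of a matched arc lies strictly between `0`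
and one turn, provided that an end of the arc is a vertex (`CirclePair.turning_of_matching`).

Unmatched vertices cut an arc into matched pieces, and the orientation alternates from piece to
piece; adding up gives `CirclePair.turning_bounds`. The chords of the double vertex leave the arc,
so no chord of the arc passes over it (`IsDoubleArc.not_joined_across`), and the orientation is the
same on both of its sides. The two halves of the arc are therefore estimated separately and added in
`IsDoubleArc.increment_mem`. The sign before a vertex is determined by the parity of the number of
earlier vertices, that is, of its label; so the signed number of matched pairs is `O - E` while
their number is `O + E`. The condition on the degree excludes that the double vertex is a common
zero of `p` and `q` (`IsPencil.vertexDegree_le`, `IsPencil.exists_factor`). -/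

/-- The logarithmic derivative of `A / B` along the unit circle. -/
def rho (A B : ℂ[X]) (θ : ℝ) : ℝ :=
  (pt θ * (wr A B).eval (pt θ) / (A.eval (pt θ) * B.eval (pt θ))).re

/-- A pair of coprime polynomials whose quotient maps the unit circle to itself and has no critical
points in the open unit disc, with a lift `φ` of the argument of the quotient. -/
structure CirclePair (A B : ℂ[X]) (φ : ℝ → ℝ) : Prop where
  coprime : IsCoprime A B
  norm_eq : ∀ z : ℂ, ‖z‖ = 1 → ‖A.eval z‖ = ‖B.eval z‖
  wr_ne : ∀ z : ℂ, ‖z‖ < 1 → (wr A B).eval z ≠ 0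
  hasDerivAt : ∀ θ, HasDerivAt φ (rho A B θ) θ
  lift : ∀ θ, A.eval (pt θ) = B.eval (pt θ) * pt (φ θ)

/-- The quotient of two polynomials as a function. -/
def quo (A B : ℂ[X]) (z : ℂ) : ℂ := A.eval z / B.eval z

/-- The part of the open unit disc which the quotient maps to the open unit disc. -/
def inside (A B : ℂ[X]) : Set ℂ := {z | ‖z‖ < 1 ∧ ‖A.eval z‖ < ‖B.eval z‖}

/-- The part of the net in the open unit disc. -/
def discNet (A B : ℂ[X]) : Set ℂ := {z | ‖z‖ < 1 ∧ ‖A.eval z‖ = ‖B.eval z‖}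

/-- The faces of the net in the open unit disc which are mapped to the open unit disc. -/
def IsFace (A B : ℂ[X]) (Y : Set ℂ) : Prop :=
  ∃ x ∈ inside A B, Y = connectedComponentIn (inside A B) x

/-- A boundary point of the faces, near which there is just one face and this face covers the part
inside the unit disc of a neighbourhood of the image point. -/
def RegPt (A B : ℂ[X]) (x : ℂ) : Prop :=
  ‖quo A B x‖ = 1 ∧ ∀ U ∈ 𝓝 x, ∃ S ⊆ U, IsPreconnected S ∧ S ⊆ inside A B ∧
    S ∈ 𝓝[inside A B] x ∧ quo A B '' S ∈ 𝓝[Metric.ball 0 1] (quo A B x)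

/-! ### Points of the unit circle, and faces as connected components. -/

lemma norm_pt (θ : ℝ) : ‖pt θ‖ = 1 := Complex.norm_exp_ofReal_mul_I θ

lemma pt_ne_zero (θ : ℝ) : pt θ ≠ 0 := Complex.exp_ne_zero _

lemma pt_add (a b : ℝ) : pt (a + b) = pt a * pt b := by
  simp [pt, add_mul, Complex.exp_add]

lemma pt_neg (a : ℝ) : pt (-a) = (pt a)⁻¹ := by
  simp [pt, Complex.exp_neg]

lemma pt_eq_iff {a b : ℝ} : pt a = pt b ↔ ∃ n : ℤ, a = b + n * (2 * Real.pi) := by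
  unfold pt
  rw [Complex.exp_eq_exp_iff_exists_int]
  refine exists_congr fun n => ?_
  rw [show (b * Complex.I + n * (2 * Real.pi * Complex.I) : ℂ)
    = ((b + n * (2 * Real.pi) : ℝ) : ℂ) * Complex.I by push_cast; ring,
    mul_left_inj' Complex.I_ne_zero, Complex.ofReal_inj]

lemma pt_injOn {a b : ℝ} (h : |a - b| < 2 * Real.pi) (hab : pt a = pt b) : a = b := by
  obtain ⟨n, hn⟩ := pt_eq_iff.1 hab
  have h1 : |(n : ℝ)| * (2 * Real.pi) < 1 * (2 * Real.pi) := by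
    rw [← abs_of_pos Real.two_pi_pos, ← abs_mul, abs_of_pos Real.two_pi_pos, one_mul]
    rwa [show (n : ℝ) * (2 * Real.pi) = a - b by rw [hn]; ring]
  have h2 : |(n : ℝ)| < 1 := lt_of_mul_lt_mul_right h1 Real.two_pi_pos.le
  have h3 : n = 0 := by
    rw [← Int.cast_abs] at h2
    exact Int.abs_lt_one_iff.1 (by exact_mod_cast h2)
  simpa [h3] using hn

lemma pt_add_int (a : ℝ) (n : ℤ) : pt (a + n * (2 * Real.pi)) = pt a :=
  pt_eq_iff.2 ⟨n, rfl⟩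

lemma continuous_pt : Continuous pt := by unfold pt; fun_prop

lemma exists_pt_eq {z : ℂ} (hz : ‖z‖ = 1) : ∃ θ, pt θ = z := by
  refine ⟨z.arg, ?_⟩
  have := Complex.norm_mul_exp_arg_mul_I z
  rwa [hz, Complex.ofReal_one, one_mul] at this

lemma wr_swap (A B : ℂ[X]) : wr B A = -wr A B := by unfold wr; ring

lemma discNet_swap (A B : ℂ[X]) : discNet B A = discNet A B := by
  ext z; simp [discNet, eq_comm]

lemma IsFace.isPreconnected {A B : ℂ[X]} {Y : Set ℂ} (h : IsFace A B Y) : IsPreconnected Y := by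
  obtain ⟨x, -, rfl⟩ := h; exact isPreconnected_connectedComponentIn

lemma IsFace.subset {A B : ℂ[X]} {Y : Set ℂ} (h : IsFace A B Y) : Y ⊆ inside A B := by
  obtain ⟨x, -, rfl⟩ := h; exact connectedComponentIn_subset _ _

lemma IsFace.subset_of_inter {A B : ℂ[X]} {Y S : Set ℂ} (h : IsFace A B Y) (hS : IsPreconnected S)
    (hSi : S ⊆ inside A B) (hne : (S ∩ Y).Nonempty) : S ⊆ Y := by
  obtain ⟨x, -, rfl⟩ := h
  obtain ⟨y, hy, hyx⟩ := hne
  rw [connectedComponentIn_eq hyx]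
  exact hS.subset_connectedComponentIn hy hSi

lemma IsFace.eq_of_inter {A B : ℂ[X]} {Y Y' : Set ℂ} (h : IsFace A B Y) (h' : IsFace A B Y')
    (hne : (Y ∩ Y').Nonempty) : Y = Y' :=
  (h'.subset_of_inter h.isPreconnected h.subset hne).antisymm
    (h.subset_of_inter h'.isPreconnected h'.subset (by rwa [inter_comm]))

lemma exists_isFace {A B : ℂ[X]} {S : Set ℂ} (hS : IsPreconnected S)
    (hSi : S ⊆ inside A B) (hne : S.Nonempty) : ∃ Y, IsFace A B Y ∧ S ⊆ Y := by
  obtain ⟨x, hx⟩ := hne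
  exact ⟨_, ⟨x, hSi hx, rfl⟩, hS.subset_connectedComponentIn hx hSi⟩

/-! ### Injectivity of the quotient on faces and on their regular boundary points. -/

section Pair

variable {A B : ℂ[X]} {φ : ℝ → ℝ}

lemma den_ne_zero_of_lt {z : ℂ} (h : ‖A.eval z‖ < ‖B.eval z‖) : B.eval z ≠ 0 := by
  intro h0; rw [h0, norm_zero] at h; exact absurd h (norm_nonneg _).not_gt

lemma not_both_zero (hc : IsCoprime A B) {z : ℂ} (ha : A.eval z = 0) (hb : B.eval z = 0) :
    False := by
  obtain ⟨u, v, h⟩ := hc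
  have := congrArg (Polynomial.eval z) h
  simp [ha, hb] at this

lemma den_ne_zero (hc : IsCoprime A B) {z : ℂ} (h : ‖A.eval z‖ ≤ ‖B.eval z‖) :
    B.eval z ≠ 0 := by
  intro h0
  refine not_both_zero hc ?_ h0
  rw [h0, norm_zero] at h
  exact norm_le_zero_iff.1 h

lemma quo_hasStrictDerivAt {z : ℂ} (hB : B.eval z ≠ 0) :
    HasStrictDerivAt (quo A B) ((wr A B).eval z / B.eval z ^ 2) z := by
  convert! (A.hasStrictDerivAt z).div (B.hasStrictDerivAt z) hB using 2
  simp [wr]; ring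

lemma quo_continuousAt {z : ℂ} (hB : B.eval z ≠ 0) : ContinuousAt (quo A B) z :=
  (quo_hasStrictDerivAt hB).hasDerivAt.continuousAt

lemma norm_quo_lt_iff {z : ℂ} (hB : B.eval z ≠ 0) :
    ‖quo A B z‖ < 1 ↔ ‖A.eval z‖ < ‖B.eval z‖ := by
  rw [quo, norm_div, div_lt_one (norm_pos_iff.2 hB)]

lemma norm_quo_eq_iff {z : ℂ} (hB : B.eval z ≠ 0) :
    ‖quo A B z‖ = 1 ↔ ‖A.eval z‖ = ‖B.eval z‖ := by
  rw [quo, norm_div, div_eq_one_iff_eq (norm_ne_zero_iff.2 hB)]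

lemma isOpen_inside : IsOpen (inside A B) :=
  (isOpen_lt continuous_norm continuous_const).inter
    (isOpen_lt A.continuous.norm B.continuous.norm)

namespace CirclePair

variable (hp : CirclePair A B φ)
include hp

/-- The reciprocal quotient reverses the orientation on the circle and exchanges the faces over the
disc with those over its exterior. By this symmetry only orientation preserving arcs and faces over
the disc have to be studied. -/
lemma swap : CirclePair B A (fun θ => -φ θ) where
  coprime := hp.coprime.symm
  norm_eq z hz := (hp.norm_eq z hz).symm
  wr_ne z hz := by rw [wr_swap]; simpa using hp.wr_ne z hz
  hasDerivAt θ := by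
    have : rho B A θ = -rho A B θ := by
      unfold rho; rw [wr_swap, ← Complex.neg_re]; congr 1; simp; ring
    rw [this]; exact (hp.hasDerivAt θ).neg
  lift θ := by
    rw [pt_neg, hp.lift θ, mul_assoc, mul_inv_cancel₀ (pt_ne_zero _), mul_one]

omit hp in
lemma exists_local (z : ℂ) (hB : B.eval z ≠ 0) (hw : (wr A B).eval z ≠ 0) :
    ∃ e : OpenPartialHomeomorph ℂ ℂ, z ∈ e.source ∧ (e : ℂ → ℂ) = quo A B := by
  have h := (quo_hasStrictDerivAt (A := A) hB).hasStrictFDerivAt_equiv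
    (div_ne_zero hw (pow_ne_zero 2 hB))
  exact ⟨h.toOpenPartialHomeomorph _, h.mem_toOpenPartialHomeomorph_source, rfl⟩

/-- The quotient is a covering of the unit disc by the preimage of the unit disc in the disc. -/
lemma isCoveringMap : IsCoveringMap (fun z : inside A B =>
    (⟨quo A B z, by
      simpa using (norm_quo_lt_iff (den_ne_zero_of_lt z.2.2)).2 z.2.2⟩ :
      Metric.ball (0 : ℂ) 1)) := by
  set F : inside A B → Metric.ball (0 : ℂ) 1 := fun z => ⟨quo A B z, _⟩ with hF
  have hcq : Continuous fun z : inside A B => quo A B z := continuous_iff_continuousAt.2 fun z =>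
    (quo_continuousAt (den_ne_zero_of_lt z.2.2)).comp continuousAt_subtype_val
  have hcont : Continuous F := hcq.subtype_mk _
  have hloc : IsLocalHomeomorph F := by
    refine IsLocalHomeomorph.of_comp (g := Subtype.val) ?_
      Metric.isOpen_ball.isOpenEmbedding_subtypeVal.isLocalHomeomorph hcont
    intro z
    obtain ⟨e, hz, he⟩ := exists_local z (den_ne_zero_of_lt z.2.2) (hp.wr_ne z z.2.1)
    have : Nonempty (inside A B) := ⟨z⟩
    refine ⟨(isOpen_inside.isOpenEmbedding_subtypeVal.toOpenPartialHomeomorph _).trans e, ?_, ?_⟩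
    · simp [hz]
    · ext y; simp [he, hF]
  -- The map is proper because `|A| = |B|` on the unit circle: the preimage of a compact subset of
  -- the open disc stays away from the circle. A closed local homeomorphism with finite fibres is a
  -- covering here.
  have hclosed : IsClosedMap F := by
    refine (isProperMap_iff_isCompact_preimage.2 ⟨hcont, fun {K} hK => ?_⟩).isClosedMap
    rw [Subtype.isCompact_iff]
    -- the image in `ℂ` is a closed subset of the closed disc
    have hK' : IsCompact (Subtype.val '' K : Set ℂ) := hK.image continuous_subtype_val
    have hset : (Subtype.val '' (F ⁻¹' K) : Set ℂ) =
        {z | z ∈ Metric.closedBall (0 : ℂ) 1 ∧ ‖A.eval z‖ ≤ ‖B.eval z‖} ∩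
          quo A B ⁻¹' (Subtype.val '' K) := by
      ext z
      constructor
      · rintro ⟨w, hw, rfl⟩
        exact ⟨⟨by simpa using w.2.1.le, w.2.2.le⟩, ⟨F w, hw, rfl⟩⟩
      · rintro ⟨⟨h1, h2⟩, ⟨w, hw, hwz⟩⟩
        have hB := den_ne_zero hp.coprime h2
        have hlt : ‖A.eval z‖ < ‖B.eval z‖ := by
          rw [← norm_quo_lt_iff hB, ← hwz]; exact mem_ball_zero_iff.1 w.2
        have hz1 : ‖z‖ < 1 := by
          rcases (show ‖z‖ ≤ 1 by simpa using h1).lt_or_eq with h | h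
          · exact h
          · exact absurd (hp.norm_eq z h) hlt.ne
        refine ⟨⟨z, hz1, hlt⟩, ?_, rfl⟩
        have : F ⟨z, hz1, hlt⟩ = w := Subtype.ext hwz.symm
        rw [mem_preimage, this]; exact hw
    rw [hset]
    have hc : IsCompact {z : ℂ | z ∈ Metric.closedBall (0 : ℂ) 1 ∧ ‖A.eval z‖ ≤ ‖B.eval z‖} := by
      refine (isCompact_closedBall (0 : ℂ) 1).inter_right (t := {z | ‖A.eval z‖ ≤ ‖B.eval z‖}) ?_
      exact isClosed_le (by fun_prop) (by fun_prop)
    refine hc.of_isClosed_subset ?_ inter_subset_left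
    exact ContinuousOn.preimage_isClosed_of_isClosed
      (fun z hz => (quo_continuousAt (den_ne_zero hp.coprime hz.2)).continuousWithinAt)
      hc.isClosed hK'.isClosed
  rw [isCoveringMap_iff_isCoveringMapOn_univ]
  refine hclosed.isCoveringMapOn_of_isLocalHomeomorphOn (fun x _ => ?_) hloc.isLocalHomeomorphOn
  -- the fibres are finite
  have hfin : {z : ℂ | (A - C (x : ℂ) * B).IsRoot z}.Finite := by
    refine Polynomial.finite_setOfPred_isRoot fun h0 => ?_
    have hAx : A = C (x : ℂ) * B := sub_eq_zero.1 h0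
    have hw : wr A B = 0 := by rw [hAx]; simp [wr]; ring
    exact hp.wr_ne 0 (by simp) (by simp [hw])
  refine Set.Finite.of_finite_image (f := Subtype.val) (hfin.subset ?_) Subtype.val_injective.injOn
  rintro _ ⟨z, hz, rfl⟩
  have hB := den_ne_zero_of_lt z.2.2
  have h1 : quo A B z = x := congrArg Subtype.val hz
  rw [quo, div_eq_iff hB] at h1
  simp [h1]

/-- Over the simply connected disc the covering has a section through any given point of the face.
Section after quotient and the identity are two lifts of the same map which agree at this point,
hence on the whole connected face. -/
lemma injOn_face {Y : Set ℂ} (hY : IsFace A B Y) : InjOn (quo A B) Y := by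
  intro y₁ h₁ y₂ h₂ h
  have : LocallyPathConnectedSpace (Metric.ball (0 : ℂ) 1) :=
    Metric.isOpen_ball.locallyPathConnectedSpace
  have : ContractibleSpace (Metric.ball (0 : ℂ) 1) := Metric.contractibleSpace_ball one_pos
  have hcov := hp.isCoveringMap
  set F : inside A B → Metric.ball (0 : ℂ) 1 := fun z => ⟨quo A B z, _⟩ with hF
  obtain ⟨g, ⟨hg1, hg2⟩, -⟩ := hcov.existsUnique_continuousMap_lifts (ContinuousMap.id _)
    (F ⟨y₁, hY.subset h₁⟩) ⟨y₁, hY.subset h₁⟩ rfl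
  have hpre : IsPreconnected (Subtype.val ⁻¹' Y : Set (inside A B)) := by
    rw [← Topology.IsInducing.subtypeVal.isPreconnected_image, Subtype.image_preimage_coe,
      inter_eq_right.2 hY.subset]
    exact hY.isPreconnected
  have key := hcov.eqOn_of_comp_eqOn hpre (g₁ := fun z => g (F z)) (g₂ := id)
    (g.continuous.comp hcov.continuous).continuousOn continuousOn_id
    (fun z _ => congrFun hg2 (F z)) (a := ⟨y₁, hY.subset h₁⟩) h₁ hg1
  have e2 : g (F ⟨y₂, hY.subset h₂⟩) = ⟨y₂, hY.subset h₂⟩ := key h₂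
  have e3 : F ⟨y₁, hY.subset h₁⟩ = F ⟨y₂, hY.subset h₂⟩ := Subtype.ext h
  rw [← e3, hg1] at e2
  exact congrArg Subtype.val e2

end CirclePair

lemma RegPt.neBot {x : ℂ} (hx : ‖quo A B x‖ = 1) :
    (𝓝[Metric.ball 0 1] (quo A B x)).NeBot := by
  rw [← mem_closure_iff_nhdsWithin_neBot, closure_ball _ one_ne_zero]
  simp [hx]

/-- A regular boundary point of two faces has just one face. -/
lemma RegPt.face_eq {x : ℂ} (hx : RegPt A B x) {Y Y' : Set ℂ} (hY : IsFace A B Y)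
    (hY' : IsFace A B Y') (h : x ∈ closure Y) (h' : x ∈ closure Y') : Y = Y' := by
  obtain ⟨S, -, hS, hSi, hSn, -⟩ := hx.2 univ univ_mem
  obtain ⟨O, hO, hOS⟩ := mem_nhdsWithin_iff_exists_mem_nhds_inter.1 hSn
  have aux : ∀ Z, IsFace A B Z → x ∈ closure Z → S ⊆ Z := fun Z hZ hxZ => by
    obtain ⟨y, hyO, hyZ⟩ := mem_closure_iff_nhds.1 hxZ O hO
    exact hZ.subset_of_inter hS hSi ⟨y, hOS ⟨hyO, hZ.subset hyZ⟩, hyZ⟩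
  have := RegPt.neBot hx.1
  obtain ⟨S', hS', -, -, -, hS'i⟩ := hx.2 univ univ_mem
  obtain ⟨y, hyO, hyZ⟩ := mem_closure_iff_nhds.1 h O hO
  exact hY.eq_of_inter hY' ⟨y, hyZ, aux Y' hY' h' (hOS ⟨hyO, hY.subset hyZ⟩)⟩

/-- The values of the quotient at the regular boundary points of a face are distinct. -/
lemma CirclePair.injOn_boundary (hp : CirclePair A B φ) {Y : Set ℂ} (hY : IsFace A B Y) {x x' : ℂ}
    (hx : RegPt A B x) (hx' : RegPt A B x') (h : x ∈ closure Y) (h' : x' ∈ closure Y)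
    (hq : quo A B x = quo A B x') : x = x' := by
  by_contra hne
  obtain ⟨U, U', hU, hU', hxU, hxU', hd⟩ := t2_separation hne
  have aux : ∀ z V, RegPt A B z → IsOpen V → z ∈ V → z ∈ closure Y →
      ∃ S ⊆ V, S ⊆ Y ∧ quo A B '' S ∈ 𝓝[Metric.ball 0 1] (quo A B z) := by
    intro z V hz hV hzV hzY
    obtain ⟨S, hSV, hS, hSi, hSn, hSq⟩ := hz.2 V (hV.mem_nhds hzV)
    obtain ⟨O, hO, hOS⟩ := mem_nhdsWithin_iff_exists_mem_nhds_inter.1 hSn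
    obtain ⟨y, hyO, hyY⟩ := mem_closure_iff_nhds.1 hzY O hO
    exact ⟨S, hSV, hY.subset_of_inter hS hSi ⟨y, hOS ⟨hyO, hY.subset hyY⟩, hyY⟩, hSq⟩
  obtain ⟨S, hSU, hSY, hS⟩ := aux x U hx hU hxU h
  obtain ⟨S', hSU', hSY', hS'⟩ := aux x' U' hx' hU' hxU' h'
  rw [← hq] at hS'
  have := RegPt.neBot hx.1
  -- Near each of the two points the face covers the inner part of a neighbourhood of the common
  -- value. These two inner parts meet, since the value lies on the unit circle; so the face would
  -- contain two different points with the same value.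
  obtain ⟨w, ⟨s, hs, hsw⟩, ⟨s', hs', hsw'⟩⟩ := Filter.nonempty_of_mem (inter_mem hS hS')
  have : s = s' := hp.injOn_face hY (hSY hs) (hSY' hs') (hsw.trans hsw'.symm)
  exact Set.disjoint_left.1 hd (hSU hs) (this ▸ hSU' hs')

lemma RegPt.mem_closure_inside {x : ℂ} (hx : RegPt A B x) : x ∈ closure (inside A B) := by
  have := RegPt.neBot hx.1
  refine mem_closure_iff_nhds.2 fun U hU => ?_
  obtain ⟨S, hSU, -, hSi, -, hSq⟩ := hx.2 U hU
  obtain ⟨w, ⟨s, hs, -⟩⟩ := Filter.nonempty_of_mem hSq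
  exact ⟨s, hSU hs, hSi hs⟩

/-- Near a regular boundary point of a face, all boundary points belong to the same face. -/
lemma RegPt.eventually_closure {x : ℂ} (hx : RegPt A B x) {Y : Set ℂ} (hY : IsFace A B Y)
    (h : x ∈ closure Y) : ∀ᶠ y in 𝓝 x, RegPt A B y → y ∈ closure Y := by
  obtain ⟨S, -, hS, hSi, hSn, -⟩ := hx.2 univ univ_mem
  obtain ⟨O, hO, hOS⟩ := mem_nhdsWithin_iff_exists_mem_nhds_inter.1 hSn
  obtain ⟨y, hyO, hyY⟩ := mem_closure_iff_nhds.1 h O hO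
  have hSY : S ⊆ Y := hY.subset_of_inter hS hSi ⟨y, hOS ⟨hyO, hY.subset hyY⟩, hyY⟩
  filter_upwards [eventually_mem_nhds_iff.2 hO] with z hz hzr
  refine mem_closure_iff_nhds.2 fun U hU => ?_
  obtain ⟨s, ⟨hs1, hs2⟩, hs3⟩ := mem_closure_iff_nhds.1 hzr.mem_closure_inside (U ∩ O)
    (inter_mem hU hz)
  exact ⟨s, hs1, hSY (hOS ⟨hs2, hs3⟩)⟩

lemma RegPt.exists_face {x : ℂ} (hx : RegPt A B x) : ∃ Y, IsFace A B Y ∧ x ∈ closure Y := by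
  obtain ⟨S, -, hS, hSi, hSn, -⟩ := hx.2 univ univ_mem
  obtain ⟨O, hO, hOS⟩ := mem_nhdsWithin_iff_exists_mem_nhds_inter.1 hSn
  have hxS : x ∈ closure S := mem_closure_iff_nhds.2 fun U hU => by
    obtain ⟨s, ⟨hs1, hs2⟩, hs3⟩ := mem_closure_iff_nhds.1 hx.mem_closure_inside (U ∩ O)
      (inter_mem hU hO)
    exact ⟨s, hs1, hOS ⟨hs2, hs3⟩⟩
  obtain ⟨Y, hY, hSY⟩ := exists_isFace hS hSi (closure_nonempty_iff.1 ⟨x, hxS⟩)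
  exact ⟨Y, hY, closure_mono hSY hxS⟩

/-- A connected set of regular boundary points meeting the closure of a face is contained in it. -/
lemma subset_closure_face {Y T : Set ℂ} (hY : IsFace A B Y) (hT : IsPreconnected T)
    (hreg : ∀ x ∈ T, RegPt A B x) (hne : (T ∩ closure Y).Nonempty) : T ⊆ closure Y := by
  obtain ⟨x, hxT, hxY⟩ := hne
  intro y hy
  -- Membership in the closure of the face is locally constant along `T`: it spreads by
  -- `RegPt.eventually_closure`, and its complement is open.
  refine (hT.induction₂ (fun x y => x ∈ closure Y ↔ y ∈ closure Y) (fun x hx => ?_)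
    (fun _ _ _ _ _ _ h h' => h.trans h') (fun _ _ _ _ h => h.symm) hxT hy).1 hxY
  by_cases h : x ∈ closure Y
  · filter_upwards [nhdsWithin_le_nhds ((hreg x hx).eventually_closure hY h),
      self_mem_nhdsWithin] with z hz hzT
    exact ⟨fun _ => hz (hreg z hzT), fun _ => h⟩
  · filter_upwards [nhdsWithin_le_nhds (isClosed_closure.isOpen_compl.mem_nhds h)] with z hz
    exact ⟨fun h' => absurd h' h, fun h' => absurd h' hz⟩

end Pair

end CircleNet

/-! ### Normal form of the quotient near a point of the circle. -/

namespace CircleNet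

open Set Filter Topology

/-- A function with positive derivative which is real on the real line near `0` preserves the upper
and the lower half-planes near `0`. -/
lemma eventually_im_pos_iff {ζ : ℂ → ℂ} {c : ℝ} (hc : 0 < c) (hd : HasStrictDerivAt ζ (c : ℂ) 0)
    (hr : ∀ᶠ x : ℝ in 𝓝 0, (ζ x).im = 0) :
    ∀ᶠ T in 𝓝 (0 : ℂ), (0 < (ζ T).im ↔ 0 < T.im) ∧ ((ζ T).im = 0 ↔ T.im = 0) := by
  have h1 := hd.hasStrictFDerivAt.isLittleO.def (half_pos hc)
  have h2 : Tendsto (fun T : ℂ => (T, (T.re : ℂ))) (𝓝 0) (𝓝 (0, 0)) := by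
    have : Continuous fun T : ℂ => (T, (T.re : ℂ)) := by fun_prop
    simpa using this.tendsto 0
  have h3 : Tendsto (fun T : ℂ => T.re) (𝓝 0) (𝓝 0) := by
    simpa using Complex.continuous_re.tendsto 0
  filter_upwards [h2.eventually h1, h3.eventually hr] with T hT hT'
  have h4 : T - (T.re : ℂ) = (T.im : ℂ) * Complex.I := by
    apply Complex.ext <;> simp
  -- Strict differentiability is applied to `T` and its real part, where the value is real. The
  -- error is at most half of the main term `c * T.im`, so it cannot change the sign.
  have h5 : |(ζ T).im - c * T.im| ≤ c / 2 * |T.im| := by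
    have h7 : ‖ζ T - ζ T.re - (T - T.re) • (c : ℂ)‖ ≤ c / 2 * ‖T - T.re‖ := hT
    have h6 := (Complex.abs_im_le_norm _).trans h7
    rw [h4, norm_mul, Complex.norm_real, Complex.norm_I, mul_one, Real.norm_eq_abs] at h6
    have h8 : (ζ T - ζ T.re - (T.im * Complex.I) • (c : ℂ)).im = (ζ T).im - c * T.im := by
      simp [hT', mul_comm]
    rwa [h8] at h6
  rw [abs_le] at h5
  rcases lt_trichotomy T.im 0 with h | h | h
  · rw [abs_of_neg h] at h5
    have : (ζ T).im < 0 := by nlinarith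
    exact ⟨⟨fun h' => absurd h' this.not_gt, fun h' => absurd h' h.not_gt⟩,
      ⟨fun h' => absurd h' this.ne, fun h' => absurd h' h.ne⟩⟩
  · rw [h] at h5 ⊢
    have : (ζ T).im = 0 := by simp at h5; linarith
    simp [this]
  · rw [abs_of_pos h] at h5
    have : 0 < (ζ T).im := by nlinarith
    exact ⟨⟨fun _ => h, fun _ => this⟩, ⟨fun h' => absurd h' this.ne', fun h' => absurd h' h.ne'⟩⟩

/-- A real analytic function with a zero of order `k` is `± ζ ^ k` in a suitable real coordinate. -/
lemma exists_real_root_coordinate {L : ℂ → ℂ} {k : ℕ} (hk : k ≠ 0) (hL : AnalyticAt ℂ L 0)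
    (hord : analyticOrderAt L 0 = k) (hr : ∀ᶠ x : ℝ in 𝓝 0, (L x).im = 0) :
    ∃ (ζ : ℂ → ℂ) (a c : ℝ), (a = 1 ∨ a = -1) ∧ 0 < c ∧ ζ 0 = 0 ∧ HasStrictDerivAt ζ (c : ℂ) 0 ∧
      (∀ᶠ T in 𝓝 0, L T = a * ζ T ^ k) ∧
      (∀ᶠ x : ℝ in 𝓝 0, (ζ x).im = 0 ∧ (0 < (ζ x).re ↔ 0 < x) ∧ ((ζ x).re < 0 ↔ x < 0)) := by
  obtain ⟨g, hg, hg0, hLg⟩ := (AnalyticAt.analyticOrderAt_eq_natCast hL).1 hord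
  have hof : Tendsto (fun x : ℝ => (x : ℂ)) (𝓝 0) (𝓝 0) := by
    simpa using Complex.continuous_ofReal.tendsto 0
  have hgr' : ∀ᶠ x : ℝ in 𝓝[≠] 0, (g x).im = 0 := by
    filter_upwards [nhdsWithin_le_nhds (hof.eventually hLg), nhdsWithin_le_nhds hr,
      self_mem_nhdsWithin] with x h1 h2 h3
    have h4 : L x = ((x ^ k : ℝ) : ℂ) * g x := by simpa using h1
    rw [h4, Complex.im_ofReal_mul] at h2
    exact (mul_eq_zero.1 h2).resolve_left (pow_ne_zero k h3)
  have hgc : Tendsto (fun x : ℝ => (g x).im) (𝓝 0) (𝓝 (g 0).im) :=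
    (Complex.continuous_im.tendsto _).comp (hg.continuousAt.tendsto.comp hof)
  have hg0r : (g 0).im = 0 := by
    refine tendsto_nhds_unique (hgc.mono_left nhdsWithin_le_nhds)
      (tendsto_const_nhds.congr' ?_) (l := 𝓝[≠] (0 : ℝ))
    filter_upwards [hgr'] with x hx using hx.symm
  have hgr : ∀ᶠ x : ℝ in 𝓝 0, (g x).im = 0 := by
    rw [eventually_nhdsWithin_iff] at hgr'
    filter_upwards [hgr'] with x hx
    by_cases h : x = 0
    · simpa [h] using hg0r
    · exact hx h
  have hre : (g 0).re ≠ 0 := fun h => hg0 (Complex.ext h hg0r)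
  obtain ⟨a, ha, hapos⟩ : ∃ a : ℝ, (a = 1 ∨ a = -1) ∧ 0 < a * (g 0).re := by
    rcases lt_or_gt_of_ne hre with h | h
    · exact ⟨-1, Or.inr rfl, by linarith⟩
    · exact ⟨1, Or.inl rfl, by linarith⟩
  have ha2 : (a : ℂ) * a = 1 := by rcases ha with rfl | rfl <;> simp
  have hag0 : (a : ℂ) * g 0 = ((a * (g 0).re : ℝ) : ℂ) := by
    apply Complex.ext <;> simp [hg0r]
  -- The sign `a` makes `a * g 0` positive, so the principal `k`-th root is analytic near `0` and
  -- positive at real points; then `ζ T = T * c T`.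
  set c : ℂ → ℂ := fun T => (a * g T) ^ ((k : ℂ)⁻¹) with hcdef
  have hcan : AnalyticAt ℂ c 0 := by
    refine (analyticAt_const.mul hg).cpow analyticAt_const ?_
    show (a : ℂ) * g 0 ∈ Complex.slitPlane
    rw [hag0]; exact Complex.ofReal_mem_slitPlane.2 hapos
  have hcreal : ∀ᶠ x : ℝ in 𝓝 0, ∃ r : ℝ, 0 < r ∧ c x = r := by
    have hpos : ∀ᶠ x : ℝ in 𝓝 0, 0 < a * (g x).re := by
      have : Tendsto (fun x : ℝ => a * (g x).re) (𝓝 0) (𝓝 (a * (g 0).re)) :=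
        ((Complex.continuous_re.tendsto _).comp (hg.continuousAt.tendsto.comp hof)).const_mul a
      exact this.eventually (lt_mem_nhds hapos)
    filter_upwards [hpos, hgr] with x h1 h2
    refine ⟨(a * (g x).re) ^ ((k : ℝ)⁻¹), Real.rpow_pos_of_pos h1 _, ?_⟩
    rw [hcdef, Complex.ofReal_cpow h1.le]
    have : (a : ℂ) * g x = ((a * (g x).re : ℝ) : ℂ) := by
      apply Complex.ext <;> simp [h2]
    simp [this]
  obtain ⟨c0, hc0, hcc⟩ := hcreal.self_of_nhds
  simp only [Complex.ofReal_zero] at hcc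
  refine ⟨fun T => T * c T, a, c0, ha, hc0, by simp, ?_, ?_, ?_⟩
  · have := (hasStrictDerivAt_id (0 : ℂ)).mul hcan.hasStrictDerivAt
    rw [hcc] at this
    simp only [id, one_mul, zero_mul, add_zero] at this
    exact this
  · filter_upwards [hLg] with T hT
    rw [hT, mul_pow, hcdef]
    simp only [Complex.cpow_nat_inv_pow _ hk]
    rw [sub_zero, smul_eq_mul]
    linear_combination (-(T ^ k * g T)) * ha2
  · filter_upwards [hcreal] with x ⟨r, hr, hcr⟩
    rw [hcr, ← Complex.ofReal_mul, Complex.ofReal_im, Complex.ofReal_re]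
    exact ⟨rfl, mul_pos_iff_of_pos_right hr, ⟨fun h => by nlinarith, fun h => by nlinarith⟩⟩

section Pair

variable {A B : ℂ[X]} {φ : ℝ → ℝ}

namespace CirclePair

variable (hp : CirclePair A B φ)
include hp

lemma num_pt_ne (θ : ℝ) : A.eval (pt θ) ≠ 0 := by
  intro h
  have h1 := hp.norm_eq _ (norm_pt θ)
  rw [h, norm_zero] at h1
  exact not_both_zero hp.coprime h (norm_eq_zero.1 h1.symm)

lemma den_pt_ne (θ : ℝ) : B.eval (pt θ) ≠ 0 := hp.swap.num_pt_ne θ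

lemma quo_pt (θ : ℝ) : quo A B (pt θ) = pt (φ θ) := by
  rw [quo, hp.lift θ, mul_div_cancel_left₀ _ (hp.den_pt_ne θ)]

lemma wr_ne_zero : wr A B ≠ 0 := fun h => hp.wr_ne 0 (by simp) (by simp [h])

lemma continuous_lift : Continuous φ :=
  continuous_iff_continuousAt.2 fun θ => (hp.hasDerivAt θ).continuousAt

/-- Near a point of the circle, the quotient is `exp (± i ζ ^ k)` up to a constant in a suitable
coordinate `ζ` which maps the unit disc to the upper half-plane. -/
theorem exists_chart (t : ℝ) {k : ℕ} (hk : (wr A B).rootMultiplicity (pt t) + 1 = k) :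
    ∃ (e : OpenPartialHomeomorph ℂ ℂ) (a : ℝ), (a = 1 ∨ a = -1) ∧ pt t ∈ e.source ∧
      e (pt t) = 0 ∧
      (∀ z ∈ e.source, B.eval z ≠ 0 ∧
        quo A B z = pt (φ t) * Complex.exp (Complex.I * (a * e z ^ k)) ∧
        (‖z‖ < 1 ↔ 0 < (e z).im) ∧ (‖z‖ = 1 ↔ (e z).im = 0)) ∧
      ∀ᶠ θ in 𝓝 t, pt θ ∈ e.source ∧ (e (pt θ)).im = 0 ∧
        (0 < (e (pt θ)).re ↔ t < θ) ∧ ((e (pt θ)).re < 0 ↔ θ < t) ∧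
        φ θ = φ t + a * (e (pt θ)).re ^ k := by
  set u := pt t with hu
  have hu0 : u ≠ 0 := pt_ne_zero t
  have hBu : B.eval u ≠ 0 := hp.den_pt_ne t
  have hAu : A.eval u ≠ 0 := hp.num_pt_ne t
  set w := pt (φ t) with hw
  have hw0 : w ≠ 0 := pt_ne_zero _
  -- The coordinate `T` unrolls the circle onto the real line; since `|Z T| = exp (-Im T)`, the
  -- inside of the disc corresponds to the upper half-plane.
  set Z : ℂ → ℂ := fun T => u * Complex.exp (T * Complex.I) with hZ
  have hZ0 : Z 0 = u := by simp [hZ]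
  have hZd : ∀ T, HasDerivAt Z (Z T * Complex.I) T := fun T => by
    have := (((hasDerivAt_id T).mul_const Complex.I).cexp).const_mul u
    simpa [hZ, mul_assoc] using this
  have hZan : AnalyticAt ℂ Z 0 := by
    refine (Differentiable.analyticAt (fun T => (hZd T).differentiableAt)) 0
  have hZc : Tendsto Z (𝓝 0) (𝓝 u) := by simpa [hZ0] using hZan.continuousAt.tendsto
  have hZx : ∀ x : ℝ, Z x = pt (t + x) := fun x => by rw [pt_add]; simp [hZ, hu, pt]
  have hev : ∀ P : ℂ[X], AnalyticAt ℂ (fun T => P.eval (Z T)) 0 := fun P =>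
    (Differentiable.analyticAt (fun T => (P.differentiable.differentiableAt).comp T
      (hZd T).differentiableAt)) 0
  have hBne : ∀ᶠ T in 𝓝 (0 : ℂ), B.eval (Z T) ≠ 0 :=
    (hev B).continuousAt.eventually_ne (by simpa [hZ0] using hBu)
  have hAne : ∀ᶠ T in 𝓝 (0 : ℂ), A.eval (Z T) ≠ 0 :=
    (hev A).continuousAt.eventually_ne (by simpa [hZ0] using hAu)
  set H : ℂ → ℂ := fun T => A.eval (Z T) / B.eval (Z T) / w with hH
  have hHan : AnalyticAt ℂ H 0 := ((hev A).div (hev B) (by simpa [hZ0] using hBu)).div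
    analyticAt_const hw0
  have hH0 : H 0 = 1 := by
    have := hp.quo_pt t
    rw [quo] at this
    simp only [hH, hZ0]; rw [hu, this, ← hw, div_self hw0]
  have hHs : ∀ᶠ T in 𝓝 (0 : ℂ), H T ∈ Complex.slitPlane := by
    refine hHan.continuousAt.eventually_mem (Complex.isOpen_slitPlane.mem_nhds ?_)
    rw [hH0]; exact Complex.one_mem_slitPlane
  -- This is the complex argument of the quotient relative to its value at `u`; on the real line it
  -- equals `φ (t + x) - φ t`.
  set L : ℂ → ℂ := fun T => -Complex.I * Complex.log (H T) with hLdef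
  have hLan : AnalyticAt ℂ L 0 := analyticAt_const.mul (hHan.clog hHs.self_of_nhds)
  have hL0 : L 0 = 0 := by simp [hLdef, hH0]
  have hHL : ∀ᶠ T in 𝓝 (0 : ℂ), H T = Complex.exp (Complex.I * L T) := by
    filter_upwards [hHs] with T hT
    rw [hLdef, ← mul_assoc]
    simp [Complex.exp_log (Complex.slitPlane_ne_zero hT)]
  have hderiv : ∀ᶠ T in 𝓝 (0 : ℂ), deriv L T =
      Z T * (wr A B).eval (Z T) / (A.eval (Z T) * B.eval (Z T)) := by
    filter_upwards [hHs, hBne, hAne] with T h1 h2 h3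
    have d1 := (((A.hasDerivAt (Z T)).comp T (hZd T)).div ((B.hasDerivAt (Z T)).comp T (hZd T))
      h2).div_const w
    have d2 := (d1.clog h1).const_mul (-Complex.I)
    refine (HasDerivAt.deriv (f := L) d2).trans ?_
    simp only [Function.comp, wr, eval_sub, eval_mul, Pi.div_apply]
    field_simp
    linear_combination (Z T * (-(eval (Z T) B * eval (Z T) (derivative A))
      + eval (Z T) A * eval (Z T) (derivative B))) * Complex.I_sq
  -- The derivative of `L` is the Wronskian up to nonvanishing factors, so it vanishes to order `m`,
  -- and `L` itself to order `m + 1 = k`.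
  obtain ⟨S, hS⟩ := Polynomial.pow_rootMultiplicity_dvd (wr A B) u
  set m := (wr A B).rootMultiplicity u with hm
  have hSu : S.eval u ≠ 0 := by
    intro h
    obtain ⟨S', hS'⟩ := Polynomial.dvd_iff_isRoot.2 h
    have : (X - C u) ^ (m + 1) ∣ wr A B := ⟨S', by rw [hS, hS', pow_succ]; ring⟩
    exact absurd ((Polynomial.le_rootMultiplicity_iff hp.wr_ne_zero).2 this) (by omega)
  have hordZ : analyticOrderAt (fun T => Z T - u) 0 = 1 := by
    have := hZan.analyticOrderAt_sub_eq_one_of_deriv_ne_zero (by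
      rw [(hZd 0).deriv, hZ0]; exact mul_ne_zero hu0 Complex.I_ne_zero)
    simpa [hZ0] using this
  have hordd : analyticOrderAt (deriv L) 0 = m := by
    have hZu : AnalyticAt ℂ (fun T => Z T - u) 0 := hZan.sub analyticAt_const
    have hQ : AnalyticAt ℂ (fun T => Z T * S.eval (Z T) / (A.eval (Z T) * B.eval (Z T))) 0 :=
      (hZan.mul (hev S)).div ((hev A).mul (hev B)) (by
        simp only [hZ0]; exact mul_ne_zero hAu hBu)
    have e1 : deriv L =ᶠ[𝓝 0] (fun T => Z T - u) ^ m *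
        fun T => Z T * S.eval (Z T) / (A.eval (Z T) * B.eval (Z T)) := by
      filter_upwards [hderiv] with T hT
      rw [hT, hS]; simp; ring
    rw [analyticOrderAt_congr e1, analyticOrderAt_mul (hZu.pow m) hQ, analyticOrderAt_pow hZu,
      hordZ, hQ.analyticOrderAt_eq_zero.2]
    · simp
    · simp only [hZ0]; exact div_ne_zero (mul_ne_zero hu0 hSu) (mul_ne_zero hAu hBu)
  have hord : analyticOrderAt L 0 = k := by
    have := hLan.analyticOrderAt_deriv_add_one
    rw [hordd, hL0] at this
    simpa [← hk] using this.symm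
  have hLreal : ∀ᶠ x : ℝ in 𝓝 0, L x = ((φ (t + x) - φ t : ℝ) : ℂ) := by
    have hc : Tendsto (fun x : ℝ => φ (t + x) - φ t) (𝓝 0) (𝓝 0) := by
      have : Continuous fun x : ℝ => φ (t + x) - φ t :=
        (hp.continuous_lift.comp (continuous_const.add continuous_id)).sub continuous_const
      simpa using this.tendsto 0
    have : ∀ᶠ x : ℝ in 𝓝 0, φ (t + x) - φ t ∈ Ioo (-Real.pi) Real.pi :=
      hc.eventually (Ioo_mem_nhds (by linarith [Real.pi_pos]) Real.pi_pos)
    filter_upwards [this] with x hx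
    have h1 : H x = Complex.exp (((φ (t + x) - φ t : ℝ) : ℂ) * Complex.I) := by
      have h2 := hp.quo_pt (t + x)
      rw [quo] at h2
      simp only [hH, hZx]
      rw [h2, div_eq_iff hw0, hw]
      show pt _ = pt (φ (t + x) - φ t) * pt _
      rw [← pt_add]; congr 1; ring
    rw [hLdef]
    simp only
    rw [h1, Complex.log_exp]
    · linear_combination (-((φ (t + x) - φ t : ℝ) : ℂ)) * Complex.I_mul_I
    · simpa using hx.1
    · simpa using hx.2.le
  obtain ⟨ζ, a, c, ha, hc, hζ0, hζd, hLζ, hζr⟩ := exists_real_root_coordinate (by omega) hLan hord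
    (hLreal.mono fun x hx => by rw [hx, Complex.ofReal_im])
  have him := eventually_im_pos_iff hc hζd (hζr.mono fun x hx => hx.1)
  -- From here on `T` is the local inverse of `Z`, with imaginary part `-log |z|`; the chart is `ζ ∘
  -- T`.
  set T : ℂ → ℂ := fun z => -Complex.I * Complex.log (z / u) with hTdef
  have hTu : T u = 0 := by simp [hTdef, hu0]
  have hTd : HasStrictDerivAt T (-Complex.I * (u⁻¹)) u := by
    have h1 : HasStrictDerivAt (fun z : ℂ => z / u) (1 / u) u :=
      (hasStrictDerivAt_id u).div_const u
    have h2 := (h1.clog (by simp [hu0])).const_mul (-Complex.I)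
    rwa [div_self hu0, div_one, one_div] at h2
  have hTc : Tendsto T (𝓝 u) (𝓝 0) := by simpa [hTu] using hTd.hasDerivAt.continuousAt.tendsto
  have hZT : ∀ z, z ≠ 0 → Z (T z) = z := fun z hz => by
    have : T z * Complex.I = Complex.log (z / u) := by
      rw [hTdef]; linear_combination (-Complex.log (z / u)) * Complex.I_mul_I
    rw [hZ]; simp only [this]
    rw [Complex.exp_log (div_ne_zero hz hu0), mul_div_cancel₀ _ hu0]
  have hTim : ∀ z, (T z).im = -Real.log ‖z‖ := fun z => by
    simp [hTdef, Complex.log_re, hu, norm_pt]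
  have hTx : ∀ᶠ θ : ℝ in 𝓝 t, T (pt θ) = ((θ - t : ℝ) : ℂ) := by
    have hc : Tendsto (fun θ : ℝ => θ - t) (𝓝 t) (𝓝 0) := by
      have : Continuous fun θ : ℝ => θ - t := by fun_prop
      simpa using this.tendsto t
    filter_upwards [hc.eventually (Ioo_mem_nhds (show -Real.pi < 0 by linarith [Real.pi_pos])
      Real.pi_pos)] with θ hθ
    have h1 : pt θ / u = Complex.exp (((θ - t : ℝ) : ℂ) * Complex.I) := by
      rw [div_eq_iff hu0, hu]
      show pt _ = pt (θ - t) * pt _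
      rw [← pt_add]; congr 1; ring
    rw [hTdef]
    simp only
    rw [h1, Complex.log_exp]
    · linear_combination (-((θ - t : ℝ) : ℂ)) * Complex.I_mul_I
    · simpa using hθ.1
    · simpa using hθ.2.le
  have hE : HasStrictDerivAt (ζ ∘ T) (c * (-Complex.I * u⁻¹)) u := by
    refine HasStrictDerivAt.comp u ?_ hTd
    rw [hTu]; exact hζd
  have hEf := hE.hasStrictFDerivAt_equiv (mul_ne_zero (Complex.ofReal_ne_zero.2 hc.ne')
    (mul_ne_zero (neg_ne_zero.2 Complex.I_ne_zero) (inv_ne_zero hu0)))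
  have hgood : ∀ᶠ z in 𝓝 u, z ≠ 0 ∧ B.eval z ≠ 0 ∧ H (T z) = Complex.exp (Complex.I * L (T z)) ∧
      L (T z) = a * ζ (T z) ^ k ∧
      ((0 < (ζ (T z)).im ↔ 0 < (T z).im) ∧ ((ζ (T z)).im = 0 ↔ (T z).im = 0)) := by
    filter_upwards [eventually_ne_nhds hu0, B.continuous.continuousAt.eventually_ne hBu,
      hTc.eventually hHL, hTc.eventually hLζ, hTc.eventually him] with z h1 h2 h3 h4 h5
    exact ⟨h1, h2, h3, h4, h5⟩
  obtain ⟨O, hO, hOo, huO⟩ := eventually_nhds_iff.1 hgood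
  set e := (hEf.toOpenPartialHomeomorph _).restrOpen O hOo with he
  have hes : u ∈ e.source := by
    rw [he, OpenPartialHomeomorph.restrOpen_source]
    exact ⟨hEf.mem_toOpenPartialHomeomorph_source, huO⟩
  have hez : ∀ z, e z = ζ (T z) := fun z => rfl
  refine ⟨e, a, ha, hes, by rw [hez, hTu, hζ0], fun z hz => ?_, ?_⟩
  · have hzO : z ∈ O := by
      rw [he, OpenPartialHomeomorph.restrOpen_source] at hz; exact hz.2
    obtain ⟨h1, h2, h3, h4, h5, h6⟩ := hO z hzO
    have hlog : ‖z‖ > 0 := norm_pos_iff.2 h1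
    refine ⟨h2, ?_, ?_, ?_⟩
    · rw [h4] at h3
      simp only [hH, hZT z h1] at h3
      rw [div_eq_iff hw0] at h3
      rw [quo, h3, hez]; ring
    · rw [hez, h5, hTim, neg_pos]
      exact (Real.log_neg_iff hlog).symm
    · rw [hez, h6, hTim, neg_eq_zero, Real.log_eq_zero]
      constructor
      · intro h; simp [h]
      · rintro (h | h | h) <;> linarith
  · have hpt : Tendsto pt (𝓝 t) (𝓝 u) := continuous_pt.tendsto t
    have hc : Tendsto (fun θ : ℝ => θ - t) (𝓝 t) (𝓝 0) := by
      have : Continuous fun θ : ℝ => θ - t := by fun_prop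
      simpa using this.tendsto t
    filter_upwards [hTx, hpt.eventually (e.open_source.mem_nhds hes), hc.eventually hζr,
      hc.eventually hLreal, hpt.eventually hgood] with θ h1 h2 h3 h4 h5
    rw [hez, h1]
    refine ⟨h2, h3.1, by rw [h3.2.1, sub_pos], by rw [h3.2.2, sub_neg], ?_⟩
    have h6 := h5.2.2.2.1
    rw [h1, h4] at h6
    have h7 : ζ ((θ - t : ℝ) : ℂ) = ((ζ ((θ - t : ℝ) : ℂ)).re : ℂ) := by
      exact Complex.ext rfl h3.1
    rw [h7] at h6
    have h8 : φ (t + (θ - t)) - φ t = a * (ζ ((θ - t : ℝ) : ℂ)).re ^ k := by exact_mod_cast h6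
    rw [show t + (θ - t) = θ by ring] at h8
    linarith

end CirclePair

end Pair

end CircleNet

/-! ### Sectors of faces at a vertex, between the circle and the adjacent chord. -/

namespace CircleNet

open Set Filter Topology

/-- A path `γ` in the net which starts at the vertex `pt t` of the unit circle, and a face `Y` whose
boundary contains both this path and the arc of the circle at `pt t` on the side given by the
sign `σ`. -/
structure IsSector (A B : ℂ[X]) (φ : ℝ → ℝ) (t σ : ℝ) (Y : Set ℂ) (γ : ℝ → ℂ) (ε : ℝ) : Prop where
  pos : 0 < ε
  le_one : ε ≤ 1
  face : IsFace A B Y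
  cont : ContinuousOn γ (Ioo 0 ε)
  tendsto : Tendsto γ (𝓝[>] 0) (𝓝 (pt t))
  mem : ∀ s ∈ Ioo 0 ε, γ s ∈ discNet A B
  quo_eq : ∀ s ∈ Ioo 0 ε, quo A B (γ s) = pt (φ t - σ * s)
  mem_closure : ∀ s ∈ Ioo 0 ε, γ s ∈ closure Y
  side : ∀ᶠ θ in 𝓝 t, 0 < σ * (θ - t) → pt θ ∈ closure Y

section Pair

variable {A B : ℂ[X]} {φ : ℝ → ℝ}

/-- A local inverse of the quotient carries the convex intersection of a small ball with the unit
disc onto the part of `inside A B` near the point. The last hypothesis keeps this image in the unit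
disc. -/
lemma regPt_of_eventually {x : ℂ} (hB : B.eval x ≠ 0) (hw : (wr A B).eval x ≠ 0)
    (hq : ‖quo A B x‖ = 1) (hin : ∀ᶠ z in 𝓝 x, ‖quo A B z‖ < 1 → ‖z‖ < 1) : RegPt A B x := by
  refine ⟨hq, fun U hU => ?_⟩
  obtain ⟨e, hx, he⟩ := CirclePair.exists_local x hB hw
  have hev : ∀ᶠ z in 𝓝 x, z ∈ U ∧ z ∈ e.source ∧ B.eval z ≠ 0 ∧ (‖quo A B z‖ < 1 → ‖z‖ < 1) := by
    filter_upwards [hU, e.open_source.mem_nhds hx,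
      B.continuous.continuousAt.eventually_ne hB, hin] with z h1 h2 h3 h4
    exact ⟨h1, h2, h3, h4⟩
  have hsymm : ∀ᶠ w in 𝓝 (e x), e.symm w ∈ U ∧ e.symm w ∈ e.source ∧ B.eval (e.symm w) ≠ 0 ∧
      (‖quo A B (e.symm w)‖ < 1 → ‖e.symm w‖ < 1) :=
    (e.tendsto_symm hx).eventually hev
  obtain ⟨r, hr, hball⟩ := Metric.mem_nhds_iff.1
    (inter_mem hsymm (e.open_target.mem_nhds (e.map_source hx)))
  set V := Metric.ball (e x) r ∩ Metric.ball 0 1 with hV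
  have hVt : ∀ w ∈ V, w ∈ e.target ∧ quo A B (e.symm w) = w := fun w hw =>
    ⟨(hball hw.1).2, by rw [← he]; exact e.right_inv (hball hw.1).2⟩
  refine ⟨e.symm '' V, ?_, ?_, ?_, ?_, ?_⟩
  · rintro _ ⟨w, hw, rfl⟩; exact (hball hw.1).1.1
  · exact ((convex_ball _ _).inter (convex_ball _ _)).isPreconnected.image _
      (e.continuousOn_symm.mono fun w hw => (hVt w hw).1)
  · rintro _ ⟨w, hw, rfl⟩
    obtain ⟨-, -, h3, h4⟩ := (hball hw.1).1
    have h5 : ‖quo A B (e.symm w)‖ < 1 := by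
      rw [(hVt w hw).2]; exact mem_ball_zero_iff.1 hw.2
    exact ⟨h4 h5, (norm_quo_lt_iff h3).1 h5⟩
  · have hO : e.source ∩ e ⁻¹' Metric.ball (e x) r ∈ 𝓝 x :=
      inter_mem (e.open_source.mem_nhds hx)
        ((e.continuousAt hx).preimage_mem_nhds (Metric.ball_mem_nhds _ hr))
    refine mem_nhdsWithin_iff_exists_mem_nhds_inter.2 ⟨_, hO, ?_⟩
    rintro z ⟨⟨hz1, hz2⟩, hz3⟩
    refine ⟨e z, ⟨hz2, ?_⟩, e.left_inv hz1⟩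
    rw [he, mem_ball_zero_iff]
    exact (norm_quo_lt_iff (den_ne_zero_of_lt hz3.2)).2 hz3.2
  · have : quo A B '' (e.symm '' V) = V := by
      rw [image_image]
      exact (image_congr fun w hw => (hVt w hw).2).trans (image_id' V)
    rw [this, ← he]
    exact inter_mem (mem_nhdsWithin_of_mem_nhds (Metric.ball_mem_nhds _ hr)) self_mem_nhdsWithin

lemma exists_gt_of_eventually {P : ℝ → Prop} {t : ℝ} (h : ∀ᶠ θ in 𝓝[>] t, P θ) :
    ∃ b > t, ∀ θ ∈ Ioo t b, P θ := by
  obtain ⟨b, hb, h'⟩ := mem_nhdsGT_iff_exists_Ioo_subset.1 h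
  exact ⟨b, hb, fun θ hθ => h' hθ⟩

lemma exists_lt_of_eventually {P : ℝ → Prop} {t : ℝ} (h : ∀ᶠ θ in 𝓝[<] t, P θ) :
    ∃ b < t, ∀ θ ∈ Ioo b t, P θ := by
  obtain ⟨b, hb, h'⟩ := mem_nhdsLT_iff_exists_Ioo_subset.1 h
  exact ⟨b, hb, fun θ hθ => h' hθ⟩

namespace CirclePair

variable (hp : CirclePair A B φ)
include hp

lemma regPt_of_mem_discNet {x : ℂ} (hx : x ∈ discNet A B) : RegPt A B x := by
  have hB := den_ne_zero hp.coprime hx.2.le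
  refine regPt_of_eventually hB (hp.wr_ne x hx.1) ((norm_quo_eq_iff hB).2 hx.2) ?_
  filter_upwards [continuous_norm.continuousAt.eventually (gt_mem_nhds hx.1)] with z hz _ using hz

lemma strictMonoOn_of_rho_pos {a b : ℝ} (h : ∀ θ ∈ Ioo a b, 0 < rho A B θ) :
    StrictMonoOn φ (Icc a b) := by
  refine strictMonoOn_of_deriv_pos (convex_Icc a b) hp.continuous_lift.continuousOn fun θ hθ => ?_
  rw [interior_Icc] at hθ
  rw [(hp.hasDerivAt θ).deriv]; exact h θ hθ

lemma eventually_lt_right {t : ℝ} (h : ∀ᶠ θ in 𝓝[>] t, 0 < rho A B θ) :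
    ∀ᶠ θ in 𝓝[>] t, φ t < φ θ := by
  obtain ⟨b, hb, hpos⟩ := exists_gt_of_eventually h
  have := hp.strictMonoOn_of_rho_pos hpos
  filter_upwards [Ioo_mem_nhdsGT hb] with θ hθ
  exact this (left_mem_Icc.2 (le_of_lt hb)) (Ioo_subset_Icc_self hθ) hθ.1

lemma eventually_lt_left {t : ℝ} (h : ∀ᶠ θ in 𝓝[<] t, 0 < rho A B θ) :
    ∀ᶠ θ in 𝓝[<] t, φ θ < φ t := by
  obtain ⟨b, hb, hpos⟩ := exists_lt_of_eventually h
  have := hp.strictMonoOn_of_rho_pos hpos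
  filter_upwards [Ioo_mem_nhdsLT hb] with θ hθ
  exact this (Ioo_subset_Icc_self hθ) (right_mem_Icc.2 (le_of_lt hb)) hθ.2

lemma continuous_rho : Continuous (rho A B) := by
  refine Complex.continuous_re.comp (Continuous.div ?_ ?_ fun θ => ?_)
  · exact continuous_pt.mul ((wr A B).continuous.comp continuous_pt)
  · exact (A.continuous.comp continuous_pt).mul (B.continuous.comp continuous_pt)
  · exact mul_ne_zero (hp.num_pt_ne θ) (hp.den_pt_ne θ)

omit hp in
lemma rootMultiplicity_eq_zero {t : ℝ} (h : rho A B t ≠ 0) :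
    (wr A B).rootMultiplicity (pt t) = 0 := by
  refine Polynomial.rootMultiplicity_eq_zero fun h0 => h ?_
  rw [rho, h0.eq_zero]; simp

/-- Where the quotient preserves the orientation of the circle it maps the inner side of the circle
to the inner side: the chart has `k = 1`, and the growth of `φ` forces `a = 1`. -/
lemma regPt_pt {t : ℝ} (h : 0 < rho A B t) : RegPt A B (pt t) := by
  have hw : (wr A B).eval (pt t) ≠ 0 := fun h0 => h.ne' (by rw [rho, h0]; simp)
  obtain ⟨e, a, ha, hes, he0, hez, hreal⟩ := hp.exists_chart t (k := 1)
    (by rw [rootMultiplicity_eq_zero h.ne'])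
  have hpos : ∀ᶠ θ in 𝓝 t, 0 < rho A B θ := hp.continuous_rho.continuousAt.eventually (lt_mem_nhds h)
  have ha1 : a = 1 := by
    obtain ⟨θ, ⟨h1, -, -, h3, -, h4⟩, h2⟩ := (((hp.eventually_lt_right
      (nhdsWithin_le_nhds hpos)).and (nhdsWithin_le_nhds hreal)).and self_mem_nhdsWithin).exists
    have h5 : 0 < (e (pt θ)).re := h3.2 h2
    rcases ha with rfl | rfl
    · rfl
    · rw [h4, pow_one] at h1; linarith
  refine regPt_of_eventually (hp.den_pt_ne t) hw (by rw [hp.quo_pt, norm_pt]) ?_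
  filter_upwards [e.open_source.mem_nhds hes] with z hz hlt
  obtain ⟨-, h2, h3, -⟩ := hez z hz
  rw [h3]
  rw [h2, norm_mul, norm_pt, one_mul, Complex.norm_exp, Real.exp_lt_one_iff] at hlt
  simpa [ha1] using hlt

/-- At the points of the circle which are not vertices there are no chords. -/
lemma eventually_notMem_discNet {t : ℝ} (h : (wr A B).eval (pt t) ≠ 0) :
    ∀ᶠ z in 𝓝 (pt t), z ∉ discNet A B := by
  obtain ⟨e, a, ha, hes, he0, hez, -⟩ := hp.exists_chart t (k := 1)
    (by rw [Polynomial.rootMultiplicity_eq_zero h])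
  filter_upwards [e.open_source.mem_nhds hes] with z hz hd
  obtain ⟨h1, h2, h3, -⟩ := hez z hz
  have h4 := h3.1 hd.1
  have h5 := (norm_quo_eq_iff h1).2 hd.2
  rw [h2, norm_mul, norm_pt, one_mul, Complex.norm_exp, Real.exp_eq_one_iff] at h5
  have h6 : a * (e z).im = 0 := by simpa using h5
  rcases ha with rfl | rfl <;> linarith

/-- In the chart the quotient is a constant times `exp (i a ζ ^ k)`, which lies in the disc where `a
ζ ^ k` has positive imaginary part. Here `d α` is the unit vector at angle `α` from the real
half-line of sign `σ`. By `hsign` the sector `0 < α < π / k` is mapped into the disc, and the ray `α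
= π / k` belongs to the net. The last clause says that for `k = 2`, at a simple vertex, this ray is
the whole net in the disc near the vertex. -/
lemma exists_sector_aux (t σ : ℝ) (hσ : σ = 1 ∨ σ = -1) {k : ℕ} (hk2 : 2 ≤ k)
    (hk : (wr A B).rootMultiplicity (pt t) + 1 = k) (d : ℝ → ℂ) (hdc : Continuous d)
    (hdn : ∀ α, ‖d α‖ = 1) (hd0 : d 0 = σ)
    (hdi : ∀ α, 0 < α → α ≤ Real.pi / k → 0 < (d α).im) (hdI : k = 2 → d (Real.pi / k) = Complex.I)
    (hsign : ∀ a : ℝ, (a = 1 ∨ a = -1) →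
      (∀ᶠ θ in 𝓝 t, 0 < σ * (θ - t) → ∃ x : ℝ, 0 < σ * x ∧ φ θ = φ t + a * x ^ k) →
      ∀ α : ℝ, a * d α ^ k = σ * Complex.exp ((σ * (k * α) : ℝ) * Complex.I)) :
    ∃ Y γ ε, IsSector A B φ t σ Y γ ε ∧
      (k = 2 → ∀ᶠ z in 𝓝 (pt t), z ∈ discNet A B → ∃ s ∈ Ioo 0 ε, γ s = z) := by
  obtain ⟨e, a, ha, hes, he0, hez, hreal⟩ := hp.exists_chart t hk
  have hkpos : (0 : ℝ) < k := by exact_mod_cast (by omega : 0 < k)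
  have hσ2 : σ * σ = 1 := by rcases hσ with rfl | rfl <;> norm_num
  have hre : ∀ θ, ((0 < (e (pt θ)).re ↔ t < θ) ∧ ((e (pt θ)).re < 0 ↔ θ < t)) →
      0 < σ * (θ - t) → 0 < σ * (e (pt θ)).re := by
    rintro θ ⟨h1, h2⟩ h3
    rcases hσ with rfl | rfl
    · rw [one_mul, h1]; linarith
    · rw [neg_one_mul, neg_pos, h2]; linarith
  have hd := hsign a ha (by
    filter_upwards [hreal] with θ hθ hθ'
    exact ⟨_, hre θ ⟨hθ.2.2.1, hθ.2.2.2.1⟩ hθ', hθ.2.2.2.2⟩)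
  obtain ⟨r, hr, hball⟩ := Metric.mem_nhds_iff.1
    (e.open_target.mem_nhds (e.map_source hes))
  rw [he0] at hball
  set r' := min r 1 with hr'
  have hr'0 : 0 < r' := lt_min hr one_pos
  have hmem : ∀ ρ : ℝ, 0 ≤ ρ → ρ < r' → ∀ α, (ρ * d α : ℂ) ∈ e.target := fun ρ h0 h1 α => by
    refine hball (mem_ball_zero_iff.2 ?_)
    rw [norm_mul, hdn, mul_one, Complex.norm_real, Real.norm_of_nonneg h0]
    exact h1.trans_le (min_le_left _ _)
  -- Polar coordinates of the sector, pulled back by the chart; the closed angles `0` and `π / k`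
  -- are the circle and the chord.
  set N : ℝ × ℝ → ℂ := fun x => e.symm (x.1 * d x.2) with hN
  have hNc : ContinuousOn N (Ico 0 r' ×ˢ univ) := by
    refine e.continuousOn_symm.comp (by fun_prop) ?_
    rintro ⟨ρ, α⟩ ⟨⟨h1, h2⟩, -⟩; exact hmem ρ h1 h2 α
  have hNe : ∀ ρ : ℝ, 0 ≤ ρ → ρ < r' → ∀ α, N (ρ, α) ∈ e.source ∧ e (N (ρ, α)) = ρ * d α :=
    fun ρ h0 h1 α => ⟨e.map_target (hmem ρ h0 h1 α), e.right_inv (hmem ρ h0 h1 α)⟩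
  have hNq : ∀ ρ : ℝ, 0 ≤ ρ → ρ < r' → ∀ α, quo A B (N (ρ, α)) = pt (φ t) *
      Complex.exp (Complex.I * (ρ ^ k * (σ * Complex.exp ((σ * (k * α) : ℝ) * Complex.I)))) := by
    intro ρ h0 h1 α
    obtain ⟨h2, h3⟩ := hNe ρ h0 h1 α
    rw [(hez _ h2).2.1, h3, ← hd α]
    congr 3; ring
  have hNlt : ∀ ρ : ℝ, 0 < ρ → ρ < r' → ∀ α, 0 < α → α ≤ Real.pi / k → ‖N (ρ, α)‖ < 1 := by
    intro ρ h0 h1 α h2 h3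
    obtain ⟨h4, h5⟩ := hNe ρ h0.le h1 α
    rw [(hez _ h4).2.2.1, h5, Complex.im_ofReal_mul]
    exact mul_pos h0 (hdi α h2 h3)
  set S := N '' (Ioo 0 r' ×ˢ Ioo 0 (Real.pi / k)) with hS
  have hSpre : IsPreconnected S := by
    refine (isPreconnected_Ioo.prod isPreconnected_Ioo).image N (hNc.mono ?_)
    exact prod_mono Ioo_subset_Ico_self (subset_univ _)
  have hpk : 0 < Real.pi / k := div_pos Real.pi_pos hkpos
  have hSin : S ⊆ inside A B := by
    rintro _ ⟨⟨ρ, α⟩, ⟨⟨h1, h2⟩, ⟨h3, h4⟩⟩, rfl⟩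
    simp only at h1 h2 h3 h4
    refine ⟨hNlt ρ h1 h2 α h3 h4.le, ?_⟩
    rw [← norm_quo_lt_iff (hez _ (hNe ρ h1.le h2 α).1).1, hNq ρ h1.le h2, norm_mul, norm_pt,
      one_mul, Complex.norm_exp, Real.exp_lt_one_iff]
    have h5 : 0 < Real.sin (k * α) :=
      Real.sin_pos_of_pos_of_lt_pi (mul_pos hkpos h3) (by rwa [lt_div_iff₀' hkpos] at h4)
    have h6 : (Complex.I * (ρ ^ k * (σ * Complex.exp ((σ * (k * α) : ℝ) * Complex.I)))).re =
        -(ρ ^ k * (σ * Real.sin (σ * (k * α)))) := by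
      rw [← Complex.ofReal_pow, Complex.I_mul_re, Complex.im_ofReal_mul, Complex.im_ofReal_mul,
        Complex.exp_ofReal_mul_I_im]
    rw [h6]
    have h7 : σ * Real.sin (σ * (k * α)) = Real.sin (k * α) := by
      rcases hσ with rfl | rfl <;> simp
    rw [h7, neg_lt_zero]
    positivity
  have hSne : S.Nonempty := ⟨_, ⟨(r' / 2, Real.pi / k / 2), ⟨⟨by simp; linarith, by simp; linarith⟩,
    ⟨by simp; positivity, by simpa using hpk⟩⟩, rfl⟩⟩
  obtain ⟨Y, hY, hSY⟩ := exists_isFace hSpre hSin hSne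
  have hcl : ∀ ρ α : ℝ, ρ ∈ Ioo 0 r' → α ∈ Icc 0 (Real.pi / k) → N (ρ, α) ∈ closure Y := by
    intro ρ α hρ hα
    refine closure_mono hSY ?_
    have hc : (ρ, α) ∈ closure (Ioo 0 r' ×ˢ Ioo 0 (Real.pi / k)) := by
      rw [closure_prod_eq, closure_Ioo hr'0.ne, closure_Ioo hpk.ne]
      exact ⟨Ioo_subset_Icc_self hρ, hα⟩
    exact ((hNc (ρ, α) ⟨Ioo_subset_Ico_self hρ, trivial⟩).mono
      (prod_mono Ioo_subset_Ico_self (subset_univ _))).mem_closure_image hc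
  -- The radius `s ^ (1 / k)` makes the argument of the quotient move with unit speed along the ray,
  -- as `quo_eq` demands; `r' ≤ 1` gives `le_one`.
  set δ : ℝ → ℝ := fun s => s ^ ((k : ℝ)⁻¹) with hδ
  have hδc : Continuous δ := Real.continuous_rpow_const (by positivity)
  have hk0 : k ≠ 0 := by omega
  have hδk : ∀ s, 0 ≤ s → δ s ^ k = s := fun s hs => Real.rpow_inv_natCast_pow hs hk0
  have hδp : ∀ s, 0 < s → 0 < δ s := fun s hs => Real.rpow_pos_of_pos hs _
  have hδlt : ∀ s ∈ Ioo 0 (r' ^ k), δ s < r' := fun s hs =>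
    lt_of_pow_lt_pow_left₀ k hr'0.le (by rw [hδk s hs.1.le]; exact hs.2)
  refine ⟨Y, fun s => N (δ s, Real.pi / k), r' ^ k, ⟨by positivity,
    pow_le_one₀ hr'0.le (min_le_right _ _), hY, ?_, ?_, ?_, ?_, ?_, ?_⟩, ?_⟩
  · refine hNc.comp (by fun_prop) fun s hs => ⟨⟨(hδp s hs.1).le, hδlt s hs⟩, trivial⟩
  · have h1 : Tendsto (fun s => (δ s : ℂ) * d (Real.pi / k)) (𝓝[>] 0) (𝓝 0) := by
      have : Continuous fun s => (δ s : ℂ) * d (Real.pi / k) := by fun_prop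
      have h0 : δ 0 = 0 := Real.zero_rpow (inv_ne_zero hkpos.ne')
      have h2 := this.tendsto 0
      simp only [h0, Complex.ofReal_zero, zero_mul] at h2
      exact h2.mono_left nhdsWithin_le_nhds
    have h2 := (e.tendsto_symm hes)
    rw [he0] at h2
    exact h2.comp h1
  · intro s hs
    have h1 := hδp s hs.1
    have h2 := hδlt s hs
    refine ⟨hNlt _ h1 h2 _ hpk le_rfl, ?_⟩
    rw [← norm_quo_eq_iff (hez _ (hNe _ h1.le h2 _).1).1, hNq _ h1.le h2, norm_mul, norm_pt,
      one_mul, Complex.norm_exp, Real.exp_eq_one_iff, ← Complex.ofReal_pow, Complex.I_mul_re,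
      Complex.im_ofReal_mul, Complex.im_ofReal_mul, Complex.exp_ofReal_mul_I_im,
      mul_div_cancel₀ _ hkpos.ne']
    rcases hσ with rfl | rfl <;> simp
  · intro s hs
    rw [hNq _ (hδp s hs.1).le (hδlt s hs), ← Complex.ofReal_pow, hδk s hs.1.le,
      mul_div_cancel₀ _ hkpos.ne', sub_eq_add_neg, pt_add]
    congr 1
    have h1 : Complex.exp ((σ * Real.pi : ℝ) * Complex.I) = -1 := by
      rcases hσ with rfl | rfl <;> simp [Complex.exp_neg, Complex.exp_pi_mul_I]
    rw [h1, pt]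
    congr 1; push_cast; ring
  · intro s hs
    exact hcl _ _ ⟨hδp s hs.1, hδlt s hs⟩ ⟨hpk.le, le_rfl⟩
  · have hsmall : ∀ᶠ θ in 𝓝 t, e (pt θ) ∈ Metric.ball (0 : ℂ) r' := by
      have h1 : Tendsto (fun θ => e (pt θ)) (𝓝 t) (𝓝 0) := by
        have := (e.continuousAt hes).tendsto.comp (continuous_pt.tendsto t)
        rwa [he0] at this
      exact h1.eventually (Metric.ball_mem_nhds _ hr'0)
    filter_upwards [hreal, hsmall] with θ ⟨h1, h2, h3, h4, _⟩ h5 h6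
    have h7 := hre θ ⟨h3, h4⟩ h6
    have h8 : e (pt θ) = ((σ * (e (pt θ)).re : ℝ) : ℂ) * d 0 := by
      rw [hd0, ← Complex.ofReal_mul]
      refine Complex.ext ?_ ?_
      · rw [Complex.ofReal_re]; linear_combination (-(e (pt θ)).re) * hσ2
      · rw [Complex.ofReal_im, h2]
    have h9 : pt θ = N (σ * (e (pt θ)).re, 0) := by
      rw [hN]; simp only; rw [← h8, e.left_inv h1]
    rw [h9]
    refine hcl _ _ ⟨h7, ?_⟩ ⟨le_rfl, hpk.le⟩
    rw [mem_ball_zero_iff] at h5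
    refine lt_of_le_of_lt ?_ h5
    refine le_trans (le_abs_self _) ?_
    rw [abs_mul]
    have : |σ| = 1 := by rcases hσ with rfl | rfl <;> simp
    rw [this, one_mul]
    exact Complex.abs_re_le_norm _
  -- For `k = 2` the net in the chart is `Re ζ * Im ζ = 0`; its part in the upper half-plane is the
  -- imaginary axis, which is the ray `α = π / 2`.
  · intro hk2'
    have hsmall : ∀ᶠ z in 𝓝 (pt t), e z ∈ Metric.ball (0 : ℂ) r' := by
      have h1 := (e.continuousAt hes).tendsto
      rw [he0] at h1
      exact h1.eventually (Metric.ball_mem_nhds _ hr'0)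
    filter_upwards [e.open_source.mem_nhds hes, hsmall] with z hz h5 hdz
    obtain ⟨h1, h2, h3, -⟩ := hez z hz
    have h4 := h3.1 hdz.1
    have h6 := (norm_quo_eq_iff h1).2 hdz.2
    rw [h2, norm_mul, norm_pt, one_mul, Complex.norm_exp, Real.exp_eq_one_iff, hk2',
      Complex.I_mul_re, Complex.im_ofReal_mul, pow_two, Complex.mul_im] at h6
    have hre0 : (e z).re = 0 := by
      have ha0 : a ≠ 0 := by rcases ha with rfl | rfl <;> norm_num
      have h7 : (e z).re * (e z).im = 0 := by
        have : a * (2 * ((e z).re * (e z).im)) = 0 := by linarith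
        simpa [ha0] using this
      exact (mul_eq_zero.1 h7).resolve_right h4.ne'
    have him : (e z).im < r' :=
      ((le_abs_self _).trans (Complex.abs_im_le_norm _)).trans_lt (mem_ball_zero_iff.1 h5)
    have hδi : δ ((e z).im ^ k) = (e z).im := Real.pow_rpow_inv_natCast h4.le hk0
    refine ⟨(e z).im ^ k, ⟨pow_pos h4 k, pow_lt_pow_left₀ him h4.le hk0⟩, ?_⟩
    simp only [hδi, hN, hdI hk2']
    have h8 : ((e z).im : ℂ) * Complex.I = e z := by
      apply Complex.ext <;> simp [hre0]
    rw [h8, e.left_inv hz]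

/-- The sector at a vertex between the circle after the vertex and the next chord. -/
lemma exists_sector_right {t : ℝ} {k : ℕ} (hk2 : 2 ≤ k)
    (hk : (wr A B).rootMultiplicity (pt t) + 1 = k)
    (hpos : ∀ᶠ θ in 𝓝[>] t, 0 < rho A B θ) :
    ∃ Y γ ε, IsSector A B φ t 1 Y γ ε ∧
      (k = 2 → ∀ᶠ z in 𝓝 (pt t), z ∈ discNet A B → ∃ s ∈ Ioo 0 ε, γ s = z) := by
  have hkpos : (2 : ℝ) ≤ k := by exact_mod_cast hk2
  refine hp.exists_sector_aux t 1 (Or.inl rfl) hk2 hk (fun α => Complex.exp (α * Complex.I))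
    (by fun_prop) (fun α => Complex.norm_exp_ofReal_mul_I α) (by simp) (fun α h1 h2 => ?_)
    (fun h => ?_) (fun a ha h α => ?_)
  · rw [Complex.exp_ofReal_mul_I_im]
    refine Real.sin_pos_of_pos_of_lt_pi h1 (h2.trans_lt ?_)
    rw [div_lt_iff₀ (by linarith)]; nlinarith [Real.pi_pos]
  · subst h
    simp
  · have ha1 : a = 1 := by
      obtain ⟨θ, ⟨h1, h2⟩, h3⟩ := (((hp.eventually_lt_right hpos).and
        (nhdsWithin_le_nhds h)).and self_mem_nhdsWithin).exists
      obtain ⟨x, hx, hx'⟩ := h2 (by simpa using h3)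
      rcases ha with rfl | rfl
      · rfl
      · rw [one_mul] at hx
        have := pow_pos hx k
        linarith
    rw [ha1, ← Complex.exp_nat_mul]
    push_cast
    rw [one_mul, one_mul, one_mul, mul_assoc]

/-- The sector at a vertex between the circle before the vertex and the next chord. -/
lemma exists_sector_left {t : ℝ} {k : ℕ} (hk2 : 2 ≤ k)
    (hk : (wr A B).rootMultiplicity (pt t) + 1 = k)
    (hpos : ∀ᶠ θ in 𝓝[<] t, 0 < rho A B θ) :
    ∃ Y γ ε, IsSector A B φ t (-1) Y γ ε ∧
      (k = 2 → ∀ᶠ z in 𝓝 (pt t), z ∈ discNet A B → ∃ s ∈ Ioo 0 ε, γ s = z) := by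
  have hkpos : (2 : ℝ) ≤ k := by exact_mod_cast hk2
  refine hp.exists_sector_aux t (-1) (Or.inr rfl) hk2 hk
    (fun α => Complex.exp ((Real.pi - α : ℝ) * Complex.I))
    (by fun_prop) (fun α => Complex.norm_exp_ofReal_mul_I _) (by simp [Complex.exp_pi_mul_I])
    (fun α h1 h2 => ?_) (fun h => ?_) (fun a ha h α => ?_)
  · rw [Complex.exp_ofReal_mul_I_im, Real.sin_pi_sub]
    refine Real.sin_pos_of_pos_of_lt_pi h1 (h2.trans_lt ?_)
    rw [div_lt_iff₀ (by linarith)]; nlinarith [Real.pi_pos]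
  · subst h
    have : Real.pi - Real.pi / (2 : ℕ) = Real.pi / 2 := by push_cast; ring
    rw [this]
    simp
  -- To the left of `t` the coordinate is negative and `φ` is below `φ t`, which fixes the sign of
  -- `a * x ^ k`.
  · have ha1 : a * (-1) ^ k = -1 := by
      obtain ⟨θ, ⟨h1, h2⟩, h3⟩ := (((hp.eventually_lt_left hpos).and
        (nhdsWithin_le_nhds h)).and self_mem_nhdsWithin).exists
      have h3' : θ < t := h3
      obtain ⟨x, hx, hx'⟩ := h2 (by linarith)
      have hxk : x ^ k = (-1) ^ k * (-x) ^ k := by rw [← mul_pow]; ring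
      have := pow_pos (show 0 < -x by linarith) k
      rcases neg_one_pow_eq_or ℝ k with h4 | h4 <;> rw [h4] at hxk ⊢ <;>
        rcases ha with rfl | rfl <;> first | (exfalso; linarith) | norm_num
    have ha1' : (a : ℂ) * (-1) ^ k = -1 := by exact_mod_cast ha1
    rw [← Complex.exp_nat_mul]
    have h1 : (k : ℂ) * ((Real.pi - α : ℝ) * Complex.I) =
        k * (Real.pi * Complex.I) + ((-1 * (k * α) : ℝ) : ℂ) * Complex.I := by push_cast; ring
    rw [h1, Complex.exp_add, Complex.exp_nat_mul, Complex.exp_pi_mul_I, ← mul_assoc, ha1']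
    push_cast; rfl

end CirclePair

end Pair

end CircleNet

/-! ### Chords are arcs parametrized by the argument of the quotient. -/

namespace CircleNet

open Set Filter Topology

/-- A bounded continuous path with finitely many possible limit points has a limit. -/
lemma exists_tendsto_of_mapClusterPt_finite {f : ℝ → ℂ} {a b : ℝ} (hab : a < b)
    (hf : ContinuousOn f (Ioo a b)) {K : Set ℂ} (hK : IsCompact K)
    (hfK : ∀ s ∈ Ioo a b, f s ∈ K) {F : Set ℂ} (hF : F.Finite)
    (hcl : ∀ v, MapClusterPt v (𝓝[<] b) f → v ∈ F) :
    ∃ v ∈ F, Tendsto f (𝓝[<] b) (𝓝 v) := by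
  have hIoo : Ioo a b ∈ 𝓝[<] b := Ioo_mem_nhdsLT hab
  obtain ⟨v, -, hv⟩ := hK.exists_mapClusterPt_of_frequently (f := f) (l := 𝓝[<] b)
    (Filter.Eventually.frequently (mem_of_superset hIoo hfK))
  obtain ⟨ε, hε, hdist⟩ : ∃ ε > 0, ∀ w ∈ F, w ≠ v → ε ≤ dist w v := by
    have h1 : (F \ {v})ᶜ ∈ 𝓝 v :=
      (hF.subset sdiff_subset).isClosed.isOpen_compl.mem_nhds (by simp)
    obtain ⟨ε, hε, hb⟩ := Metric.mem_nhds_iff.1 h1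
    refine ⟨ε, hε, fun w hw hwv => not_lt.1 fun h => ?_⟩
    exact hb (Metric.mem_ball.2 h) ⟨hw, hwv⟩
  refine ⟨v, hcl v hv, Metric.tendsto_nhds.2 fun δ' hδ' => ?_⟩
  set δ := min δ' ε with hδ
  have hδ0 : 0 < δ := lt_min hδ' hε
  by_contra hnot
  have hfreq : ∃ᶠ s in 𝓝[<] b, δ ≤ dist (f s) v := by
    refine (not_eventually.1 hnot).mono fun s hs => ?_
    exact (min_le_left _ _).trans (not_lt.1 hs)
  have hfreq' : ∃ᶠ s in 𝓝[<] b, dist (f s) v < δ / 2 :=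
    hv.frequently (Metric.ball_mem_nhds v (half_pos hδ0))
  -- A path which comes within `δ / 2` of `v` and leaves the `δ`-ball again and again crosses the
  -- intermediate sphere frequently. A limit point on this sphere would be a point of `F` other than
  -- `v` at distance less than `ε`.
  have hmid : ∃ᶠ s in 𝓝[<] b, f s ∈ Metric.sphere v (3 * δ / 4) ∩ K := by
    rw [frequently_iff]
    intro U hU
    obtain ⟨l, hl, hlU⟩ := mem_nhdsLT_iff_exists_Ioo_subset.1 (inter_mem hU hIoo)
    obtain ⟨s₁, hs₁, h₁⟩ := (hfreq.and_eventually (Ioo_mem_nhdsLT hl)).exists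
    obtain ⟨s₂, hs₂, h₂⟩ := (hfreq'.and_eventually (Ioo_mem_nhdsLT hl)).exists
    have hpre : IsPreconnected ((fun s => dist (f s) v) '' Ioo l b) := by
      refine isPreconnected_Ioo.image _ ?_
      exact continuous_id.dist continuous_const |>.comp_continuousOn
        (hf.mono fun s hs => (hlU hs).2)
    have := hpre.ordConnected.out (mem_image_of_mem _ h₂) (mem_image_of_mem _ h₁)
      (show 3 * δ / 4 ∈ Icc _ _ from ⟨by linarith, by linarith⟩)
    obtain ⟨s, hs, hs'⟩ := this
    exact ⟨s, (hlU hs).1, hs', hfK s (hlU hs).2⟩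
  obtain ⟨w, ⟨hw1, -⟩, hw⟩ :=
    ((isCompact_sphere v (3 * δ / 4)).inter hK).exists_mapClusterPt_of_frequently hmid
  have hw2 : dist w v = 3 * δ / 4 := hw1
  have hne : w ≠ v := by rintro rfl; rw [dist_self] at hw2; linarith
  have := hdist w (hcl w hw) hne
  have : δ ≤ ε := min_le_right _ _
  linarith

/-- The chords: the components of the net in the open unit disc. -/
def IsDiscChord (A B : ℂ[X]) (c : Set ℂ) : Prop :=
  ∃ x ∈ discNet A B, c = connectedComponentIn (discNet A B) x

/-- A parametrization of the closure of a chord by the argument of the quotient. -/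
structure IsChordParam (A B : ℂ[X]) (c : Set ℂ) (ψ₀ ψ₁ : ℝ) (χ : ℝ → ℂ) : Prop where
  lt : ψ₀ < ψ₁
  le : ψ₁ ≤ ψ₀ + 2 * Real.pi
  cont : ContinuousOn χ (Icc ψ₀ ψ₁)
  image_Ioo : χ '' Ioo ψ₀ ψ₁ = c
  quo_eq : ∀ s ∈ Icc ψ₀ ψ₁, quo A B (χ s) = pt s
  norm_left : ‖χ ψ₀‖ = 1
  norm_right : ‖χ ψ₁‖ = 1

section Pair

variable {A B : ℂ[X]} {φ : ℝ → ℝ} {c : Set ℂ}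

lemma IsDiscChord.swap (h : IsDiscChord A B c) : IsDiscChord B A c := by
  obtain ⟨x, hx, rfl⟩ := h
  rw [← discNet_swap A B] at hx ⊢
  exact ⟨x, hx, rfl⟩

namespace IsDiscChord

variable (hc : IsDiscChord A B c)
include hc

lemma isPreconnected : IsPreconnected c := by
  obtain ⟨x, -, rfl⟩ := hc; exact isPreconnected_connectedComponentIn

lemma subset : c ⊆ discNet A B := by
  obtain ⟨x, -, rfl⟩ := hc; exact connectedComponentIn_subset _ _

lemma nonempty : c.Nonempty := by
  obtain ⟨x, hx, rfl⟩ := hc; exact ⟨x, mem_connectedComponentIn hx⟩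

lemma subset_of_inter {S : Set ℂ} (hS : IsPreconnected S) (hSi : S ⊆ discNet A B)
    (hne : (S ∩ c).Nonempty) : S ⊆ c := by
  obtain ⟨x, -, rfl⟩ := hc
  obtain ⟨y, hy, hyx⟩ := hne
  rw [connectedComponentIn_eq hyx]
  exact hS.subset_connectedComponentIn hy hSi

lemma eq_of_inter {c' : Set ℂ} (hc' : IsDiscChord A B c') (hne : (c ∩ c').Nonempty) : c = c' :=
  (hc'.subset_of_inter hc.isPreconnected hc.subset hne).antisymm
    (hc.subset_of_inter hc'.isPreconnected hc'.subset (by rwa [inter_comm]))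

lemma mem_of_mem_closure {v : ℂ} (hv : v ∈ closure c) (hvd : v ∈ discNet A B) : v ∈ c := by
  obtain ⟨x, hx⟩ := hc.nonempty
  have h1 : IsPreconnected (insert v c) :=
    hc.isPreconnected.subset_closure (subset_insert v c)
      (insert_subset hv subset_closure)
  exact hc.subset_of_inter h1 (insert_subset hvd hc.subset)
    ⟨x, mem_insert_of_mem _ hx, hx⟩ (mem_insert _ _)

lemma closure_subset : closure c ⊆ {z | ‖z‖ ≤ 1 ∧ ‖A.eval z‖ = ‖B.eval z‖} := by
  refine closure_minimal (fun z hz => ⟨(hc.subset hz).1.le, (hc.subset hz).2⟩) ?_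
  exact (isClosed_le continuous_norm continuous_const).inter
    (isClosed_eq A.continuous.norm B.continuous.norm)

end IsDiscChord

lemma exists_isDiscChord {S : Set ℂ} (hS : IsPreconnected S)
    (hSi : S ⊆ discNet A B) (hne : S.Nonempty) : ∃ c, IsDiscChord A B c ∧ S ⊆ c := by
  obtain ⟨x, hx⟩ := hne
  exact ⟨_, ⟨x, hSi hx, rfl⟩, hS.subset_connectedComponentIn hx hSi⟩

namespace CirclePair

variable (hp : CirclePair A B φ)
include hp

lemma subset_closure_face_of_chord (hc : IsDiscChord A B c) {Y : Set ℂ} (hY : IsFace A B Y)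
    (hne : (c ∩ closure Y).Nonempty) : c ⊆ closure Y :=
  subset_closure_face hY hc.isPreconnected (fun _ hx => hp.regPt_of_mem_discNet (hc.subset hx)) hne

/-- A chord is connected and consists of regular points, so it lies in the boundary of one face,
where values are not repeated. -/
lemma injOn_chord (hc : IsDiscChord A B c) : InjOn (quo A B) c := by
  obtain ⟨x, hx⟩ := hc.nonempty
  obtain ⟨Y, hY, hxY⟩ := (hp.regPt_of_mem_discNet (hc.subset hx)).exists_face
  have := hp.subset_closure_face_of_chord hc hY ⟨x, hx, hxY⟩
  intro y hy y' hy' h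
  exact hp.injOn_boundary hY (hp.regPt_of_mem_discNet (hc.subset hy))
    (hp.regPt_of_mem_discNet (hc.subset hy')) (this hy) (this hy') h

/-- A local parametrization of a chord. -/
lemma exists_local_chord (hc : IsDiscChord A B c) {x : ℂ} (hx : x ∈ c) :
    ∃ g : ℂ → ℂ, ContinuousAt g (quo A B x) ∧ g (quo A B x) = x ∧
      ∀ᶠ w in 𝓝 (quo A B x), ContinuousAt g w ∧ (‖w‖ = 1 → g w ∈ c ∧ quo A B (g w) = w) := by
  have hxd := hc.subset hx
  have hB := den_ne_zero hp.coprime hxd.2.le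
  obtain ⟨e, hxe, he⟩ := exists_local x hB (hp.wr_ne x hxd.1)
  have hw0 : ‖quo A B x‖ = 1 := (norm_quo_eq_iff hB).2 hxd.2
  have hex : e x = quo A B x := by rw [he]
  refine ⟨e.symm, ?_, ?_, ?_⟩
  · rw [← hex]; exact e.continuousAt_symm (e.map_source hxe)
  · rw [← hex]; exact e.left_inv hxe
  obtain ⟨s₀, hs₀⟩ := exists_pt_eq hw0
  have hev : ∀ᶠ w in 𝓝 (quo A B x), w ∈ e.target ∧ ‖e.symm w‖ < 1 ∧ B.eval (e.symm w) ≠ 0 := by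
    have h1 := (e.continuousAt_symm (e.map_source hxe)).tendsto
    rw [e.left_inv hxe, hex] at h1
    filter_upwards [e.open_target.mem_nhds (hex ▸ e.map_source hxe),
      h1.eventually (continuous_norm.continuousAt.eventually (gt_mem_nhds hxd.1)),
      h1.eventually (B.continuous.continuousAt.eventually_ne hB)] with w h2 h3 h4
    exact ⟨h2, h3, h4⟩
  have hpt : ∀ᶠ s in 𝓝 s₀, pt s ∈ e.target ∧ ‖e.symm (pt s)‖ < 1 ∧
      B.eval (e.symm (pt s)) ≠ 0 := by
    have := continuous_pt.tendsto s₀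
    rw [hs₀] at this
    exact this.eventually hev
  obtain ⟨δ, hδ, hball⟩ := Metric.mem_nhds_iff.1 hpt
  have hpre : IsPreconnected ((fun s => e.symm (pt s)) '' Metric.ball s₀ δ) := by
    refine (convex_ball s₀ δ).isPreconnected.image _ ?_
    exact e.continuousOn_symm.comp continuous_pt.continuousOn fun s hs => (hball hs).1
  have hquo : ∀ w ∈ e.target, quo A B (e.symm w) = w := fun w hw => by
    rw [← he]; exact e.right_inv hw
  have hsub : (fun s => e.symm (pt s)) '' Metric.ball s₀ δ ⊆ c := by
    refine hc.subset_of_inter hpre ?_ ⟨x, ⟨s₀, Metric.mem_ball_self hδ, ?_⟩, hx⟩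
    · rintro _ ⟨s, hs, rfl⟩
      obtain ⟨h1, h2, h3⟩ := hball hs
      exact ⟨h2, (norm_quo_eq_iff h3).1 (by rw [hquo _ h1, norm_pt])⟩
    · simp only; rw [hs₀, ← hex]; exact e.left_inv hxe
  have harg : Tendsto (fun w => Complex.arg (w / quo A B x)) (𝓝 (quo A B x)) (𝓝 0) := by
    have hne : quo A B x ≠ 0 := by rw [← hs₀]; exact pt_ne_zero _
    have h1 : ContinuousAt (fun w => w / quo A B x) (quo A B x) :=
      continuousAt_id.div_const _
    have h2 : ContinuousAt Complex.arg (quo A B x / quo A B x) := by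
      rw [div_self hne]; exact Complex.continuousAt_arg Complex.one_mem_slitPlane
    have h3 := (h2.comp (f := fun w => w / quo A B x) h1).tendsto
    simpa [Function.comp_def, div_self hne] using h3
  filter_upwards [hev, harg.eventually (Metric.ball_mem_nhds 0 hδ)] with w ⟨h1, h2, h3⟩ h4
  refine ⟨e.continuousAt_symm h1, fun hw => ⟨?_, hquo w h1⟩⟩
  have hwpt : pt (s₀ + Complex.arg (w / quo A B x)) = w := by
    have hne : quo A B x ≠ 0 := by rw [← hs₀]; exact pt_ne_zero _
    have h5 : ‖w / quo A B x‖ = 1 := by rw [norm_div, hw, hw0, div_one]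
    have h6 := Complex.norm_mul_exp_arg_mul_I (w / quo A B x)
    rw [h5, Complex.ofReal_one, one_mul] at h6
    rw [pt_add, hs₀]
    show quo A B x * Complex.exp _ = w
    rw [h6, mul_div_cancel₀ _ hne]
  refine hsub ⟨s₀ + Complex.arg (w / quo A B x), ?_, by simp only; rw [hwpt]⟩
  rw [Metric.mem_ball, dist_eq_norm, add_sub_cancel_left]
  simpa using h4

/-- The quotient separates the points of a chord from all points of its closure. -/
lemma eq_of_mem_closure_chord (hc : IsDiscChord A B c) {x v : ℂ} (hx : x ∈ c) (hv : v ∈ closure c)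
    (hq : quo A B v = quo A B x) : v = x := by
  obtain ⟨g, hg, hgx, hgc⟩ := hp.exists_local_chord hc hx
  have hB := den_ne_zero hp.coprime (hc.closure_subset hv).2.le
  have : (𝓝[c] v).NeBot := mem_closure_iff_nhdsWithin_neBot.1 hv
  have h1 : Tendsto (quo A B) (𝓝[c] v) (𝓝 (quo A B x)) := by
    rw [← hq]; exact (quo_continuousAt hB).tendsto.mono_left nhdsWithin_le_nhds
  -- If `y` on the chord tends to `v`, its value tends to that of `x`, so `g` of this value tends to
  -- `x`; but by injectivity on the chord it is `y` itself.
  have h2 : Tendsto (fun y => g (quo A B y)) (𝓝[c] v) (𝓝 x) := by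
    have := hg.tendsto; rw [hgx] at this; exact this.comp h1
  refine tendsto_nhds_unique (tendsto_nhdsWithin_of_tendsto_nhds tendsto_id :
    Tendsto id (𝓝[c] v) (𝓝 v)) (h2.congr' ?_)
  filter_upwards [h1.eventually hgc, self_mem_nhdsWithin] with y hy hyc
  have hyd := hc.subset hyc
  have h3 := hy.2 ((norm_quo_eq_iff (den_ne_zero hp.coprime hyd.2.le)).2 hyd.2)
  exact hp.injOn_chord hc h3.1 hyc h3.2

/-- A chord with an end point on the unit circle is an open arc, parametrized by the argument of the
quotient. -/
theorem exists_chordParam_Ioo (hc : IsDiscChord A B c) {v : ℂ} (hv : v ∈ closure c)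
    (hv1 : ‖v‖ = 1) : ∃ (ψ₀ ψ₁ : ℝ) (χ : ℝ → ℂ), ψ₀ < ψ₁ ∧ ψ₁ ≤ ψ₀ + 2 * Real.pi ∧
      ContinuousOn χ (Ioo ψ₀ ψ₁) ∧ χ '' Ioo ψ₀ ψ₁ = c ∧
      ∀ s ∈ Ioo ψ₀ ψ₁, quo A B (χ s) = pt s := by
  have hvB := den_ne_zero hp.coprime (hc.closure_subset hv).2.le
  obtain ⟨κ, hκ⟩ := exists_pt_eq ((norm_quo_eq_iff hvB).2 (hc.closure_subset hv).2)
  -- The value at the end `v` is omitted on the chord. This cuts the circle of values open and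
  -- allows a continuous argument `τ` with values in `(κ, κ + 2π)`, whence also the bound `2π` on
  -- the length.
  have hne : ∀ x ∈ c, quo A B x ≠ pt κ := fun x hx h => by
    have := hp.eq_of_mem_closure_chord hc hx hv (by rw [h, hκ])
    have h2 := (hc.subset hx).1
    rw [← this] at h2; linarith
  have hnorm : ∀ x ∈ c, ‖quo A B x‖ = 1 := fun x hx =>
    (norm_quo_eq_iff (den_ne_zero hp.coprime (hc.subset hx).2.le)).2 (hc.subset hx).2
  have hquoc : ContinuousOn (quo A B) c := fun x hx =>
    (quo_continuousAt (den_ne_zero hp.coprime (hc.subset hx).2.le)).continuousWithinAt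
  have hslit : ∀ x ∈ c, -quo A B x / pt κ ∈ Complex.slitPlane := fun x hx => by
    by_contra h
    rw [Complex.mem_slitPlane_iff_not_le_zero, not_not] at h
    have h1 : ‖-quo A B x / pt κ‖ = 1 := by rw [norm_div, norm_neg, hnorm x hx, norm_pt, div_one]
    have h2 : -quo A B x / pt κ = -1 := by
      rw [Complex.le_def] at h
      have h3 : -quo A B x / pt κ = ((-quo A B x / pt κ).re : ℂ) :=
        Complex.ext rfl (by simpa using h.2)
      rw [h3, Complex.norm_real, Real.norm_eq_abs, abs_of_nonpos (by simpa using h.1)] at h1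
      rw [h3, show (-quo A B x / pt κ).re = -1 by linarith]; simp
    rw [div_eq_iff (pt_ne_zero κ)] at h2
    exact hne x hx (by linear_combination -h2)
  set τ : ℂ → ℝ := fun x => κ + Real.pi + Complex.arg (-quo A B x / pt κ) with hτ
  have hτc : ContinuousOn τ c := by
    refine continuousOn_const.add fun x hx => ?_
    have h1 : ContinuousWithinAt (fun x => -quo A B x / pt κ) c x := (hquoc x hx).neg.div_const _
    exact ContinuousAt.comp_continuousWithinAt (f := fun x => -quo A B x / pt κ)
      (Complex.continuousAt_arg (hslit x hx)) h1
  have hτq : ∀ x ∈ c, quo A B x = pt (τ x) := fun x hx => by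
    have h1 : ‖-quo A B x / pt κ‖ = 1 := by rw [norm_div, norm_neg, hnorm x hx, norm_pt, div_one]
    have h6 := Complex.norm_mul_exp_arg_mul_I (-quo A B x / pt κ)
    rw [h1, Complex.ofReal_one, one_mul] at h6
    have h7 : pt Real.pi = -1 := Complex.exp_pi_mul_I
    rw [hτ]; simp only
    rw [pt_add, pt_add, h7]
    show _ = _ * _ * Complex.exp _
    rw [h6]
    field_simp [pt_ne_zero κ]
  have hτI : ∀ x ∈ c, τ x ∈ Ioo κ (κ + 2 * Real.pi) := fun x hx => by
    have h1 := Complex.neg_pi_lt_arg (-quo A B x / pt κ)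
    have h2 : Complex.arg (-quo A B x / pt κ) < Real.pi :=
      lt_of_le_of_ne (Complex.arg_le_pi _) (Complex.mem_slitPlane_iff_arg.1 (hslit x hx)).1
    simp only [hτ]
    constructor <;> linarith
  set J := τ '' c with hJ
  have hJpre : IsPreconnected J := hc.isPreconnected.image τ hτc
  have hJne : J.Nonempty := hc.nonempty.image τ
  -- local inverses
  have hloc : ∀ x ∈ c, ∃ χ : ℝ → ℂ, ContinuousAt χ (τ x) ∧
      ∀ᶠ s in 𝓝 (τ x), χ s ∈ c ∧ τ (χ s) = s := by
    intro x hx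
    obtain ⟨g, hg, hgx, hgc⟩ := hp.exists_local_chord hc hx
    have hpt := continuous_pt.tendsto (τ x)
    rw [← hτq x hx] at hpt
    refine ⟨fun s => g (pt s), ?_, ?_⟩
    · refine ContinuousAt.comp (g := g) ?_ continuous_pt.continuousAt
      rw [← hτq x hx]; exact hg
    · filter_upwards [hpt.eventually hgc, Ioo_mem_nhds (hτI x hx).1 (hτI x hx).2] with s hs hsI
      obtain ⟨h1, h2⟩ := hs.2 (norm_pt s)
      refine ⟨h1, pt_injOn ?_ (by rw [← hτq _ h1, h2])⟩
      have h3 := hτI _ h1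
      rw [abs_lt]; constructor <;> linarith [h3.1, h3.2, hsI.1, hsI.2]
  -- The set of arguments is open by the local inverses and connected as an image of the chord, so
  -- it is an open interval on which the inverse of `τ` is the parametrization.
  have hJo : IsOpen J := by
    rw [isOpen_iff_mem_nhds]
    rintro _ ⟨x, hx, rfl⟩
    obtain ⟨χ, -, hχ⟩ := hloc x hx
    filter_upwards [hχ] with s hs using ⟨χ s, hs.1, hs.2⟩
  have hJb : J ⊆ Icc κ (κ + 2 * Real.pi) := by
    rintro _ ⟨x, hx, rfl⟩; exact Ioo_subset_Icc_self (hτI x hx)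
  have hJbb : BddBelow J := ⟨κ, fun s hs => (hJb hs).1⟩
  have hJba : BddAbove J := ⟨κ + 2 * Real.pi, fun s hs => (hJb hs).2⟩
  have hJeq : J = Ioo (sInf J) (sSup J) := by
    refine Subset.antisymm ?_ (IsConnected.Ioo_csInf_csSup_subset ⟨hJne, hJpre⟩ hJbb hJba)
    rw [← interior_Icc]
    exact hJo.subset_interior_iff.2 (subset_Icc_csInf_csSup hJbb hJba)
  set ψ₀ := sInf J with hψ₀
  set ψ₁ := sSup J with hψ₁
  have hlt : ψ₀ < ψ₁ := by
    obtain ⟨s, hs⟩ := hJne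
    rw [hJeq] at hs; exact hs.1.trans hs.2
  have hle : ψ₁ ≤ ψ₀ + 2 * Real.pi := by
    have h1 : κ ≤ ψ₀ := le_csInf hJne fun s hs => (hJb hs).1
    have h2 : ψ₁ ≤ κ + 2 * Real.pi := csSup_le hJne fun s hs => (hJb hs).2
    linarith
  have hχex : ∀ s ∈ Ioo ψ₀ ψ₁, ∃ x ∈ c, τ x = s := fun s hs => by rw [← hJeq] at hs; exact hs
  choose! χ hχc hχτ using hχex
  have hτinj : ∀ x ∈ c, ∀ y ∈ c, τ x = τ y → x = y := fun x hx y hy h =>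
    hp.injOn_chord hc hx hy (by rw [hτq x hx, hτq y hy, h])
  have hτmem : ∀ x ∈ c, τ x ∈ Ioo ψ₀ ψ₁ := fun x hx => by
    rw [← hJeq]; exact mem_image_of_mem τ hx
  have hχcont : ContinuousOn χ (Ioo ψ₀ ψ₁) := by
    intro s hs
    obtain ⟨χ', hχ', hχ'c⟩ := hloc (χ s) (hχc s hs)
    rw [hχτ s hs] at hχ' hχ'c
    refine (hχ'.congr ?_).continuousWithinAt
    filter_upwards [hχ'c, Ioo_mem_nhds hs.1 hs.2] with r hr hrI
    exact hτinj _ hr.1 _ (hχc r hrI) (by rw [hr.2, hχτ r hrI])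
  have himage : χ '' Ioo ψ₀ ψ₁ = c := by
    refine Subset.antisymm (image_subset_iff.2 hχc) fun x hx => ⟨τ x, hτmem x hx, ?_⟩
    exact hτinj _ (hχc _ (hτmem x hx)) _ hx (hχτ _ (hτmem x hx))
  exact ⟨ψ₀, ψ₁, χ, hlt, hle, hχcont, himage, fun s hs => by rw [hτq _ (hχc s hs), hχτ s hs]⟩

/-- A chord with an end point on the unit circle is an arc with two end points on the circle,
parametrized by the argument of the quotient. -/
theorem exists_chordParam (hc : IsDiscChord A B c) {v : ℂ} (hv : v ∈ closure c) (hv1 : ‖v‖ = 1) :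
    ∃ ψ₀ ψ₁ χ, IsChordParam A B c ψ₀ ψ₁ χ := by
  obtain ⟨ψ₀, ψ₁, χ, hlt, hle, hχcont, himage, hχq⟩ := hp.exists_chordParam_Ioo hc hv hv1
  have hχc : ∀ s ∈ Ioo ψ₀ ψ₁, χ s ∈ c := fun s hs => by rw [← himage]; exact mem_image_of_mem χ hs
  set F : Set ℂ := {z | (wr A B).IsRoot z} ∩ {z | ‖z‖ = 1} with hF
  have hFfin : F.Finite := (Polynomial.finite_setOfPred_isRoot hp.wr_ne_zero).inter_of_left _
  have hK : IsCompact (Metric.closedBall (0 : ℂ) 1) := isCompact_closedBall 0 1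
  -- limit points of the ends of the chord are vertices
  have hcluster : ∀ (l : Filter ℝ) (ψ : ℝ), l ≤ 𝓝 ψ → Ioo ψ₀ ψ₁ ∈ l → (ψ = ψ₀ ∨ ψ = ψ₁) →
      ∀ w, MapClusterPt w l χ → w ∈ F := by
    intro l ψ hl hIl hψ w hw
    have hwc : w ∈ closure c := by
      refine mem_closure_iff_nhds.2 fun U hU => ?_
      obtain ⟨s, hs, hsI⟩ := ((hw.frequently hU).and_eventually hIl).exists
      exact ⟨χ s, hs, hχc s hsI⟩
    have hwB := den_ne_zero hp.coprime (hc.closure_subset hwc).2.le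
    have hwq : quo A B w = pt ψ := by
      have h1 : MapClusterPt (quo A B w) l (quo A B ∘ χ) := hw.continuousAt_comp (quo_continuousAt hwB)
      have h2 : Tendsto (quo A B ∘ χ) l (𝓝 (pt ψ)) := by
        refine ((continuous_pt.tendsto ψ).mono_left hl).congr' ?_
        filter_upwards [hIl] with s hs
        rw [Function.comp, hχq s hs]
      have h3 : ClusterPt (quo A B w) (𝓝 (pt ψ)) := ClusterPt.mono h1 h2
      exact eq_of_nhds_neBot h3
    -- A limit point in the open disc would belong to the chord and would have a parameter strictly
    -- between `ψ₀` and `ψ₁`; but its value is that of the end `ψ`, and the interval has length at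
    -- most `2π`.
    have hwn : ‖w‖ = 1 := by
      refine le_antisymm (hc.closure_subset hwc).1 (not_lt.1 fun hlt1 => ?_)
      have hwcc := hc.mem_of_mem_closure hwc ⟨hlt1, (hc.closure_subset hwc).2⟩
      rw [← himage] at hwcc
      obtain ⟨s, h1, rfl⟩ := hwcc
      have h2 : ψ = s := pt_injOn (by
        rw [abs_lt]
        rcases hψ with rfl | rfl <;> constructor <;> linarith [h1.1, h1.2])
        (by rw [← hwq, hχq s h1])
      rcases hψ with rfl | rfl
      · exact h1.1.ne h2
      · exact h1.2.ne h2.symm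
    -- At a point of the circle which is not a vertex no part of the net in the disc accumulates.
    -- Hence the limit points lie in the finite set `F` and the ends of the chord converge.
    refine ⟨?_, hwn⟩
    by_contra hroot
    obtain ⟨θ, rfl⟩ := exists_pt_eq hwn
    obtain ⟨s, hs, hsI⟩ := ((hw.frequently (hp.eventually_notMem_discNet hroot)).and_eventually
      hIl).exists
    exact hs (hc.subset (hχc s hsI))
  have hχK : ∀ s ∈ Ioo ψ₀ ψ₁, χ s ∈ Metric.closedBall (0 : ℂ) 1 := fun s hs => by
    simpa using (hc.subset (hχc s hs)).1.le
  obtain ⟨v₁, hv₁, hlim₁⟩ := exists_tendsto_of_mapClusterPt_finite hlt hχcont hK hχK hFfin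
    (hcluster _ ψ₁ nhdsWithin_le_nhds (Ioo_mem_nhdsLT hlt) (Or.inr rfl))
  obtain ⟨v₀, hv₀, hlim₀⟩ : ∃ v₀ ∈ F, Tendsto χ (𝓝[>] ψ₀) (𝓝 v₀) := by
    have hneg : MapsTo (fun s : ℝ => -s) (Ioo (-ψ₁) (-ψ₀)) (Ioo ψ₀ ψ₁) := fun s hs =>
      ⟨by linarith [hs.2], by linarith [hs.1]⟩
    have hmap : map (fun s : ℝ => -s) (𝓝[<] (-ψ₀)) = 𝓝[>] ψ₀ := by
      simp
    obtain ⟨v₀, hv₀, h0⟩ := exists_tendsto_of_mapClusterPt_finite (f := fun s => χ (-s))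
      (neg_lt_neg hlt) (hχcont.comp continuousOn_neg hneg) hK (fun s hs => hχK _ (hneg hs)) hFfin
      (fun w hw => hcluster (𝓝[>] ψ₀) ψ₀ nhdsWithin_le_nhds (Ioo_mem_nhdsGT hlt) (Or.inl rfl) w
        (by rw [← hmap]; exact hw))
    exact ⟨v₀, hv₀, by rw [← hmap]; exact tendsto_map'_iff.2 h0⟩
  have hext : ∀ s ∈ Ioo ψ₀ ψ₁, extendFrom (Ioo ψ₀ ψ₁) χ s = χ s := fun s hs =>
    extendFrom_extends hχcont s hs
  have hcont := continuousOn_Icc_extendFrom_Ioo hχcont hlim₀ hlim₁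
  have hcl : ∀ s ∈ Icc ψ₀ ψ₁, extendFrom (Ioo ψ₀ ψ₁) χ s ∈ closure c := by
    intro s hs
    rw [← closure_Ioo hlt.ne] at hs hcont
    have := (hcont s hs).mono subset_closure |>.mem_closure_image hs
    rwa [image_congr hext, himage] at this
  refine ⟨ψ₀, ψ₁, extendFrom (Ioo ψ₀ ψ₁) χ, hlt, hle, hcont, ?_, ?_, ?_, ?_⟩
  · rw [image_congr hext, himage]
  · have h1 : ContinuousOn (fun s => quo A B (extendFrom (Ioo ψ₀ ψ₁) χ s)) (Icc ψ₀ ψ₁) :=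
      fun s hs => (quo_continuousAt (den_ne_zero hp.coprime
        (hc.closure_subset (hcl s hs)).2.le)).comp_continuousWithinAt (hcont s hs)
    have h2 : EqOn (fun s => quo A B (extendFrom (Ioo ψ₀ ψ₁) χ s)) pt (Ioo ψ₀ ψ₁) := fun s hs => by
      simp only [hext s hs, hχq s hs]
    rw [← closure_Ioo hlt.ne] at h1 ⊢
    exact h2.of_subset_closure h1 continuous_pt.continuousOn subset_closure subset_rfl
  · rw [eq_lim_at_left_extendFrom_Ioo hlt hlim₀]; exact hv₀.2
  · rw [eq_lim_at_right_extendFrom_Ioo hlt hlim₁]; exact hv₁.2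

end CirclePair

namespace IsChordParam

variable {ψ₀ ψ₁ : ℝ} {χ : ℝ → ℂ}

lemma closure_eq (h : IsChordParam A B c ψ₀ ψ₁ χ) : closure c = χ '' Icc ψ₀ ψ₁ := by
  refine Subset.antisymm ?_ ?_
  · refine closure_minimal ?_ (isCompact_Icc.image_of_continuousOn h.cont).isClosed
    rw [← h.image_Ioo]; exact image_mono Ioo_subset_Icc_self
  · rw [← h.image_Ioo]
    have h1 := h.cont
    rw [← closure_Ioo h.lt.ne] at h1 ⊢
    exact h1.image_closure

lemma mem_chord (h : IsChordParam A B c ψ₀ ψ₁ χ) {s : ℝ} (hs : s ∈ Ioo ψ₀ ψ₁) : χ s ∈ c := by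
  rw [← h.image_Ioo]; exact mem_image_of_mem χ hs

lemma left_mem (h : IsChordParam A B c ψ₀ ψ₁ χ) : χ ψ₀ ∈ closure c := by
  rw [h.closure_eq]; exact mem_image_of_mem χ (left_mem_Icc.2 h.lt.le)

lemma right_mem (h : IsChordParam A B c ψ₀ ψ₁ χ) : χ ψ₁ ∈ closure c := by
  rw [h.closure_eq]; exact mem_image_of_mem χ (right_mem_Icc.2 h.lt.le)

lemma eq_end (h : IsChordParam A B c ψ₀ ψ₁ χ) (hc : IsDiscChord A B c) {v : ℂ}
    (hv : v ∈ closure c) (hv1 : ‖v‖ = 1) : v = χ ψ₀ ∨ v = χ ψ₁ := by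
  rw [h.closure_eq] at hv
  obtain ⟨s, hs, rfl⟩ := hv
  rcases eq_or_lt_of_le hs.1 with h1 | h1
  · exact Or.inl (by rw [h1])
  rcases eq_or_lt_of_le hs.2 with h2 | h2
  · exact Or.inr (by rw [h2])
  · exact absurd hv1 (hc.subset (h.mem_chord ⟨h1, h2⟩)).1.ne

lemma swap (h : IsChordParam A B c ψ₀ ψ₁ χ) :
    IsChordParam B A c (-ψ₁) (-ψ₀) (fun s => χ (-s)) where
  lt := neg_lt_neg h.lt
  le := by linarith [h.le]
  cont := h.cont.comp continuousOn_neg fun s hs => ⟨by linarith [hs.2], by linarith [hs.1]⟩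
  image_Ioo := by
    rw [← h.image_Ioo, ← image_image χ (fun s : ℝ => -s), image_neg_eq_neg, neg_Ioo]
    simp
  quo_eq s hs := by
    have := h.quo_eq (-s) ⟨by linarith [hs.2], by linarith [hs.1]⟩
    rw [quo] at this ⊢
    rw [← inv_div, this, pt_neg, inv_inv]
  norm_left := by simpa using h.norm_right
  norm_right := by simpa using h.norm_left

end IsChordParam

end Pair

end CircleNet

/-! ### A path in the disc between two points of the circle separates the two arcs. -/

namespace CircleNet

open Set Filter Topology

/-- Off a path from `a` to `b`, the function `(z - b) / (z - a)` has a continuous logarithm. -/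
lemma exists_log_off_path (γ : C(unitInterval, ℂ)) : ∃ G : ℂ → ℂ, ContinuousOn G (range γ)ᶜ ∧
    ∀ z ∈ (range γ)ᶜ, Complex.exp (G z) = (z - γ 1) / (z - γ 0) := by
  have hne : ∀ (x : unitInterval × ((range γ)ᶜ : Set ℂ)),
      ((x.2 : ℂ) - γ x.1) / ((x.2 : ℂ) - γ 0) ≠ 0 := fun x =>
    div_ne_zero (sub_ne_zero.2 fun h => x.2.2 ⟨x.1, h.symm⟩)
      (sub_ne_zero.2 fun h => x.2.2 ⟨0, h.symm⟩)
  have hcont : Continuous fun x : unitInterval × ((range γ)ᶜ : Set ℂ) =>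
      ((x.2 : ℂ) - γ x.1) / ((x.2 : ℂ) - γ 0) := by
    refine Continuous.div (by fun_prop) (by fun_prop) fun x => ?_
    exact sub_ne_zero.2 fun h => x.2.2 ⟨0, h.symm⟩
  -- Moving `γ s` from `γ 0` to `γ 1` is a homotopy from the constant `1` to the function in
  -- question, which never vanishes off the path; it is lifted through `exp`, starting from the
  -- logarithm `0`.
  set H : C(unitInterval × ((range γ)ᶜ : Set ℂ), {z : ℂ // z ≠ 0}) :=
    ⟨fun x => ⟨_, hne x⟩, hcont.subtype_mk _⟩ with hH
  have H0 : ∀ z, H (0, z) =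
      (⟨_, Complex.exp_ne_zero (ContinuousMap.const _ (0 : ℂ) z)⟩ : {z : ℂ // z ≠ 0}) := by
    intro z
    refine Subtype.ext ?_
    have : (z : ℂ) - γ 0 ≠ 0 := sub_ne_zero.2 fun h => z.2 ⟨0, h.symm⟩
    simp [hH, div_self this]
  set F := Complex.isCoveringMap_exp.liftHomotopy H (ContinuousMap.const _ 0) H0 with hF
  have hFl := Complex.isCoveringMap_exp.liftHomotopy_lifts H (ContinuousMap.const _ 0) H0
  classical
  refine ⟨fun z => if h : z ∈ (range γ)ᶜ then F (1, ⟨z, h⟩) else 0, ?_, fun z hz => ?_⟩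
  · rw [continuousOn_iff_continuous_domRestrict]
    have : Continuous fun z : ((range γ)ᶜ : Set ℂ) => F (1, z) := by fun_prop
    convert! this using 1
    ext z
    have := z.2
    simp only [Set.domRestrict_apply]
    rw [dif_pos this]
  · beta_reduce
    rw [dif_pos hz]
    exact congrArg Subtype.val (congrFun hFl (1, ⟨z, hz⟩))

/-- Two continuous logarithms of a function on a connected set differ by a constant. -/
lemma log_sub_eq {X : Type*} [TopologicalSpace X] {G H : X → ℂ} {S : Set X}
    (hS : IsPreconnected S) (hG : ContinuousOn G S) (hH : ContinuousOn H S)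
    (h : ∀ z ∈ S, Complex.exp (G z) = Complex.exp (H z)) {x y : X} (hx : x ∈ S) (hy : y ∈ S) : G x - H x = G y - H y := by
  have := Complex.isCoveringMap_exp.eqOn_of_comp_eqOn hS hG
    (g₂ := fun z => H z + (G x - H x)) (hH.add continuousOn_const)
    (fun z hz => Subtype.ext ?_) hx (by ring)
  · have h1 := this hy
    simp only at h1
    rw [h1]; ring
  · simp only [Function.comp]
    rw [Complex.exp_add, Complex.exp_sub, h x hx, div_self (Complex.exp_ne_zero _), mul_one, h z hz]

lemma isPreconnected_norm_gt_one : IsPreconnected {z : ℂ | 1 < ‖z‖} := by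
  have : {z : ℂ | 1 < ‖z‖} = (fun x : ℝ × ℝ => (x.1 : ℂ) * pt x.2) '' (Ioi 1 ×ˢ univ) := by
    ext z
    constructor
    · intro hz
      exact ⟨(‖z‖, z.arg), ⟨hz, trivial⟩, Complex.norm_mul_exp_arg_mul_I z⟩
    · rintro ⟨⟨r, θ⟩, ⟨hr, -⟩, rfl⟩
      have h1 : (1 : ℝ) < r := hr
      simpa [norm_pt] using h1.trans_le (le_abs_self r)
  rw [this]
  refine (isPreconnected_Ioi.prod isPreconnected_univ).image _ (Continuous.continuousOn ?_)
  exact (Complex.continuous_ofReal.comp continuous_fst).mul (continuous_pt.comp continuous_snd)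

/-- The Möbius map which sends the unit disc to the right half-plane, `pt t₂` to `0` and `pt t₁` to
infinity. -/
def halfPlaneMap (t₁ t₂ : ℝ) (z : ℂ) : ℂ :=
  -Complex.I * pt (-((t₂ - t₁) / 2)) * ((z - pt t₂) / (z - pt t₁))

/-- For `t₁ < t₂ < t₁ + 2π` the sine is positive, so the sign of the real part tells the inside of
the disc from the outside. -/
lemma halfPlaneMap_re (t₁ t₂ : ℝ) (z : ℂ) : (halfPlaneMap t₁ t₂ z).re =
    Real.sin ((t₂ - t₁) / 2) * (1 - ‖z‖ ^ 2) / ‖z - pt t₁‖ ^ 2 := by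
  obtain ⟨x, y⟩ := z
  have h1 : pt (-((t₂ - t₁) / 2)) = ⟨Real.cos ((t₂ - t₁) / 2), -Real.sin ((t₂ - t₁) / 2)⟩ := by
    rw [pt]
    apply Complex.ext
    · rw [Complex.exp_ofReal_mul_I_re, Real.cos_neg]
    · rw [Complex.exp_ofReal_mul_I_im, Real.sin_neg]
  -- In terms of half-angles all quantities are polynomials in sines and cosines, and the identity
  -- becomes algebraic.
  set a := t₁ / 2 with ha
  set b := t₂ / 2 with hb
  have h2 : (t₂ - t₁) / 2 = b - a := by rw [ha, hb]; ring
  have h3 : pt t₁ = ⟨2 * Real.cos a ^ 2 - 1, 2 * Real.sin a * Real.cos a⟩ := by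
    rw [pt]
    apply Complex.ext
    · rw [Complex.exp_ofReal_mul_I_re, ← Real.cos_two_mul]; congr 1; rw [ha]; ring
    · rw [Complex.exp_ofReal_mul_I_im, ← Real.sin_two_mul]; congr 1; rw [ha]; ring
  have h4 : pt t₂ = ⟨2 * Real.cos b ^ 2 - 1, 2 * Real.sin b * Real.cos b⟩ := by
    rw [pt]
    apply Complex.ext
    · rw [Complex.exp_ofReal_mul_I_re, ← Real.cos_two_mul]; congr 1; rw [hb]; ring
    · rw [Complex.exp_ofReal_mul_I_im, ← Real.sin_two_mul]; congr 1; rw [hb]; ring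
  rw [halfPlaneMap, h1, h2, div_eq_mul_inv (_ - pt t₂), Complex.inv_def, ← Complex.normSq_eq_norm_sq,
    ← Complex.normSq_eq_norm_sq, ← mul_assoc, ← mul_assoc, Complex.re_mul_ofReal, div_eq_mul_inv]
  congr 1
  rw [h3, h4, Real.sin_sub, Real.cos_sub, Complex.normSq_mk]
  simp only [Complex.mul_re, Complex.mul_im, Complex.sub_re, Complex.sub_im, Complex.neg_re,
    Complex.neg_im, Complex.I_re, Complex.I_im, Complex.conj_re, Complex.conj_im]
  have e1 : Real.sin a ^ 2 = 1 - Real.cos a ^ 2 := Real.sin_sq a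
  have e2 : Real.sin b ^ 2 = 1 - Real.cos b ^ 2 := Real.sin_sq b
  generalize Real.sin a = sa at *
  generalize Real.sin b = sb at *
  generalize Real.cos a = ca at *
  generalize Real.cos b = cb at *
  clear h1 h2 h3 h4 ha hb
  grind

/-- The circle goes to the imaginary axis, and the sign of the imaginary part distinguishes the two
arcs between `pt t₁` and `pt t₂`. -/
lemma halfPlaneMap_pt (t₁ t₂ θ : ℝ) (h : Real.sin ((θ - t₁) / 2) ≠ 0) : halfPlaneMap t₁ t₂ (pt θ) =
    ((-(Real.sin ((θ - t₂) / 2) / Real.sin ((θ - t₁) / 2)) : ℝ) : ℂ) * Complex.I := by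
  have key : ∀ s : ℝ, pt θ - pt s =
      pt ((θ + s) / 2) * (2 * Complex.I * (Real.sin ((θ - s) / 2) : ℂ)) := by
    intro s
    have h1 : pt θ = pt ((θ + s) / 2) * pt ((θ - s) / 2) := by rw [← pt_add]; congr 1; ring
    have h2 : pt s = pt ((θ + s) / 2) * pt (-((θ - s) / 2)) := by rw [← pt_add]; congr 1; ring
    rw [h1, h2, ← mul_sub]
    congr 1
    rw [Complex.ofReal_sin, Complex.sin, pt, pt]
    push_cast
    rw [neg_mul]
    linear_combination (-(Complex.exp (-((θ - s) / 2 * Complex.I))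
      - Complex.exp ((θ - s) / 2 * Complex.I))) * Complex.I_sq
  have h3 : pt (-((t₂ - t₁) / 2)) * pt ((θ + t₂) / 2) = pt ((θ + t₁) / 2) := by
    rw [← pt_add]; congr 1; ring
  rw [halfPlaneMap, key t₁, key t₂]
  have h5 : (Real.sin ((θ - t₁) / 2) : ℂ) ≠ 0 := Complex.ofReal_ne_zero.2 h
  have h6 := pt_ne_zero ((θ + t₁) / 2)
  have h7 := Complex.I_ne_zero
  push_cast at h5 ⊢
  rw [← h3] at h6 ⊢
  have h8 := left_ne_zero_of_mul h6
  have h9 := right_ne_zero_of_mul h6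
  field_simp

/-- A path in the closed disc which joins two points of the circle separates the two arcs of the
circle between these points. -/
theorem not_crossing {t₁ t₂ u u' : ℝ} (γ : C(unitInterval, ℂ)) (h0 : γ 0 = pt t₁)
    (h1 : γ 1 = pt t₂) (hγ : ∀ s, ‖γ s‖ ≤ 1)
    (hu1 : t₁ < u) (hu2 : u < t₂)
    (hu3 : t₂ < u') (hu4 : u' < t₁ + 2 * Real.pi) {E : Set ℂ} (hE : IsPreconnected E)
    (hE1 : ∀ z ∈ E, ‖z‖ ≤ 1) (hE2 : Disjoint E (range γ)) (hu : pt u ∈ E) (hu' : pt u' ∈ E) :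
    False := by
  -- Off the path the half-plane map has one continuous logarithm. Its increment from `pt u` to `pt
  -- u'` is computed inside the disc along `E`, where the map stays in the closed right half-plane,
  -- and then outside the disc, where it stays in the left one.
  obtain ⟨G, hGc, hG⟩ := exists_log_off_path γ
  set m := halfPlaneMap t₁ t₂ with hm
  set κ : ℂ := -Complex.I * pt (-((t₂ - t₁) / 2)) with hκ
  have hκ0 : κ ≠ 0 := mul_ne_zero (neg_ne_zero.2 Complex.I_ne_zero) (pt_ne_zero _)
  have hmem1 : pt t₁ ∈ range γ := ⟨0, h0⟩
  have hmem2 : pt t₂ ∈ range γ := ⟨1, h1⟩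
  have hne1 : ∀ z ∈ (range γ)ᶜ, z - pt t₁ ≠ 0 := fun z hz h =>
    hz (by rw [sub_eq_zero.1 h]; exact hmem1)
  have hne2 : ∀ z ∈ (range γ)ᶜ, z - pt t₂ ≠ 0 := fun z hz h =>
    hz (by rw [sub_eq_zero.1 h]; exact hmem2)
  have hm0 : ∀ z ∈ (range γ)ᶜ, m z ≠ 0 := fun z hz =>
    mul_ne_zero hκ0 (div_ne_zero (hne2 z hz) (hne1 z hz))
  have hmc : ContinuousOn m (range γ)ᶜ := by
    refine continuousOn_const.mul (ContinuousOn.div (by fun_prop) (by fun_prop) hne1)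
  have hsin : 0 < Real.sin ((t₂ - t₁) / 2) :=
    Real.sin_pos_of_pos_of_lt_pi (by linarith) (by linarith)
  set G' : ℂ → ℂ := fun z => Complex.log κ + G z with hG'
  have hG'e : ∀ z ∈ (range γ)ᶜ, Complex.exp (G' z) = m z := fun z hz => by
    simp only [hG']; rw [Complex.exp_add, Complex.exp_log hκ0, hG z hz, h0, h1]; rfl
  have hG'c : ContinuousOn G' (range γ)ᶜ := continuousOn_const.add hGc
  have hslit : ∀ w : ℂ, w ≠ 0 → 0 ≤ w.re → w ∈ Complex.slitPlane := fun w hw hre => by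
    rcases hre.lt_or_eq with h | h
    · exact Or.inl h
    · exact Or.inr fun him => hw (Complex.ext h.symm him)
  have hre1 : ∀ z, ‖z‖ ≤ 1 → 0 ≤ (m z).re := fun z hz => by
    rw [hm, halfPlaneMap_re]
    have : 0 ≤ 1 - ‖z‖ ^ 2 := by nlinarith [norm_nonneg z]
    positivity
  have hre2 : ∀ z, 1 ≤ ‖z‖ → 0 ≤ (-m z).re := fun z hz => by
    rw [Complex.neg_re, hm, halfPlaneMap_re, ← neg_div, ← mul_neg]
    have : 0 ≤ -(1 - ‖z‖ ^ 2) := by nlinarith [norm_nonneg z]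
    positivity
  have hEγ : E ⊆ (range γ)ᶜ := hE2.subset_compl_right
  -- inside the disc
  have e1 := log_sub_eq (G := G') (H := fun z => Complex.log (m z)) hE (hG'c.mono hEγ)
    ((hmc.mono hEγ).clog fun z hz => hslit _ (hm0 z (hEγ hz)) (hre1 z (hE1 z hz)))
    (fun z hz => by rw [hG'e z (hEγ hz), Complex.exp_log (hm0 z (hEγ hz))]) hu hu'
  -- outside the disc
  set X : Set ℂ := {z | 1 < ‖z‖} ∪ {pt u, pt u'} with hX
  have hXc : X ⊆ closure {z : ℂ | 1 < ‖z‖} := by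
    have : ∀ z : ℂ, ‖z‖ = 1 → z ∈ closure {z : ℂ | 1 < ‖z‖} := fun z hz => by
      have h1 : Tendsto (fun r : ℝ => (r : ℂ) * z) (𝓝[>] 1) (𝓝 z) := by
        have : Continuous fun r : ℝ => (r : ℂ) * z := by fun_prop
        have := this.tendsto 1
        rw [Complex.ofReal_one, one_mul] at this
        exact this.mono_left nhdsWithin_le_nhds
      refine mem_closure_of_tendsto h1 ?_
      filter_upwards [self_mem_nhdsWithin] with r hr
      have hr' : (1 : ℝ) < r := hr
      simpa [hz] using hr'.trans_le (le_abs_self r)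
    rintro z (hz | rfl | rfl)
    · exact subset_closure hz
    · exact this _ (norm_pt _)
    · exact this _ (norm_pt _)
  have hXpre : IsPreconnected X :=
    isPreconnected_norm_gt_one.subset_closure subset_union_left hXc
  have hXγ : X ⊆ (range γ)ᶜ := by
    rintro z (hz | rfl | rfl)
    · rintro ⟨s, rfl⟩; exact (hγ s).not_gt hz
    · exact hEγ hu
    · exact hEγ hu'
  have hX1 : ∀ z ∈ X, 1 ≤ ‖z‖ := by
    rintro z (hz | rfl | rfl)
    · exact le_of_lt hz
    · exact (norm_pt _).ge
    · exact (norm_pt _).ge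
  have e2 := log_sub_eq (G := G') (H := fun z => Complex.log (-m z) + Real.pi * Complex.I) hXpre
    (hG'c.mono hXγ)
    (((hmc.mono hXγ).neg.clog fun z hz => hslit _ (neg_ne_zero.2 (hm0 z (hXγ hz)))
      (hre2 z (hX1 z hz))).add continuousOn_const)
    (fun z hz => by
      rw [hG'e z (hXγ hz), Complex.exp_add, Complex.exp_log (neg_ne_zero.2 (hm0 z (hXγ hz))),
        Complex.exp_pi_mul_I]; ring)
    (Or.inr (Or.inl rfl) : pt u ∈ X) (Or.inr (Or.inr rfl) : pt u' ∈ X)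
  -- the difference of the two logarithms at the two points
  have hs1 : 0 < Real.sin ((u - t₁) / 2) := Real.sin_pos_of_pos_of_lt_pi (by linarith) (by linarith)
  have hs2 : Real.sin ((u - t₂) / 2) < 0 := Real.sin_neg_of_neg_of_neg_pi_lt (by linarith)
    (by linarith)
  have hs3 : 0 < Real.sin ((u' - t₁) / 2) :=
    Real.sin_pos_of_pos_of_lt_pi (by linarith) (by linarith)
  have hs4 : 0 < Real.sin ((u' - t₂) / 2) :=
    Real.sin_pos_of_pos_of_lt_pi (by linarith) (by linarith)
  have hlog : ∀ y : ℝ, 0 < y → Complex.log ((y : ℂ) * Complex.I) =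
      Real.log y + Real.pi / 2 * Complex.I := fun y hy => by
    rw [Complex.log_ofReal_mul hy Complex.I_ne_zero, Complex.log_I]
  have hlog' : ∀ y : ℝ, 0 < y → Complex.log (-((y : ℂ) * Complex.I)) =
      Real.log y - Real.pi / 2 * Complex.I := fun y hy => by
    rw [← mul_neg, Complex.log_ofReal_mul hy (neg_ne_zero.2 Complex.I_ne_zero), Complex.log_neg_I]
    ring
  have hmu : m (pt u) = _ := halfPlaneMap_pt t₁ t₂ u hs1.ne'
  have hmu' : m (pt u') = _ := halfPlaneMap_pt t₁ t₂ u' hs3.ne'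
  set y := -(Real.sin ((u - t₂) / 2) / Real.sin ((u - t₁) / 2)) with hy
  have hy0 : 0 < y := by rw [hy, neg_pos]; exact div_neg_of_neg_of_pos hs2 hs1
  set y' := Real.sin ((u' - t₂) / 2) / Real.sin ((u' - t₁) / 2) with hy'
  have hy'0 : 0 < y' := div_pos hs4 hs3
  rw [Complex.ofReal_neg, neg_mul] at hmu'
  simp only [hmu, hmu', neg_neg] at e1 e2
  rw [hlog y hy0, hlog' y' hy'0] at e1
  rw [hlog' y hy0, hlog y' hy'0] at e2
  -- The imaginary parts of the two increments are `-π` and `π`, which contradicts that they are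
  -- increments of one function.
  have e3 : (2 * Real.pi : ℂ) * Complex.I = 0 := by linear_combination e2 - e1
  simp [Complex.I_ne_zero, Real.pi_ne_zero] at e3

end CircleNet

/-! ### Non-crossing of chords, and pieces of the boundary of a face. -/

namespace CircleNet

open Set Filter Topology

variable {A B : ℂ[X]} {φ : ℝ → ℝ}

lemma pt_ne {a b : ℝ} (h : a < b) (h' : b < a + 2 * Real.pi) : pt a ≠ pt b := fun h0 =>
  h.ne (pt_injOn (by rw [abs_lt]; constructor <;> linarith) h0)

lemma IsDiscChord.isVertex (hp : CirclePair A B φ) {c : Set ℂ} (hc : IsDiscChord A B c) {t : ℝ}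
    (ht : pt t ∈ closure c) : (wr A B).eval (pt t) = 0 := by
  by_contra h
  have h1 := hp.eventually_notMem_discNet h
  obtain ⟨z, hz, hzc⟩ := mem_closure_iff_nhds.1 ht _ h1
  exact hz (hc.subset hzc)

/-- A chord has at most two ends. -/
lemma IsDiscChord.eq_or_eq (hp : CirclePair A B φ) {c : Set ℂ} (hc : IsDiscChord A B c)
    {x y v : ℂ} (hx : x ∈ closure c) (hx1 : ‖x‖ = 1) (hy : y ∈ closure c) (hy1 : ‖y‖ = 1)
    (hxy : x ≠ y) (hv : v ∈ closure c) (hv1 : ‖v‖ = 1) : v = x ∨ v = y := by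
  obtain ⟨ψ₀, ψ₁, χ, hχ⟩ := hp.exists_chordParam hc hx hx1
  rcases hχ.eq_end hc hx hx1 with h | h <;> rcases hχ.eq_end hc hy hy1 with h' | h' <;>
    rcases hχ.eq_end hc hv hv1 with h'' | h'' <;> simp_all

/-- Chords do not cross. -/
theorem CirclePair.chord_noncrossing (hp : CirclePair A B φ) {c d : Set ℂ} (hc : IsDiscChord A B c)
    (hd : IsDiscChord A B d) {t₁ t₂ u u' : ℝ} (h1 : pt t₁ ∈ closure c) (h2 : pt t₂ ∈ closure c)
    (h3 : pt u ∈ closure d) (h4 : pt u' ∈ closure d) (hu1 : t₁ < u) (hu2 : u < t₂) (hu3 : t₂ < u')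
    (hu4 : u' < t₁ + 2 * Real.pi) : False := by
  have n12 : pt t₁ ≠ pt t₂ := pt_ne (by linarith) (by linarith)
  have n34 : pt u ≠ pt u' := pt_ne (by linarith) (by linarith)
  have n13 : pt t₁ ≠ pt u := pt_ne (by linarith) (by linarith)
  have n14 : pt t₁ ≠ pt u' := pt_ne (by linarith) (by linarith)
  have n23 : pt t₂ ≠ pt u := (pt_ne (by linarith) (by linarith)).symm
  have n24 : pt t₂ ≠ pt u' := pt_ne (by linarith) (by linarith)
  -- A common point in the open disc would make the two chords equal, giving one chord too many
  -- ends; a common point on the circle would be an end of both, but the four ends are distinct.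
  have hcd : Disjoint (closure d) (closure c) := by
    rw [Set.disjoint_left]
    intro v hvd hvc
    obtain ⟨hv1, hv2⟩ := hc.closure_subset hvc
    rcases lt_or_eq_of_le hv1 with hv | hv
    · have := hc.eq_of_inter hd ⟨v, hc.mem_of_mem_closure hvc ⟨hv, hv2⟩,
        hd.mem_of_mem_closure hvd ⟨hv, hv2⟩⟩
      subst this
      rcases hc.eq_or_eq hp h1 (norm_pt _) h2 (norm_pt _) n12 h3 (norm_pt _) with h | h
      · exact n13 h.symm
      · exact n23 h.symm
    · rcases hc.eq_or_eq hp h1 (norm_pt _) h2 (norm_pt _) n12 hvc hv with h | h <;>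
      rcases hd.eq_or_eq hp h3 (norm_pt _) h4 (norm_pt _) n34 hvd hv with h' | h' <;>
      simp_all
  obtain ⟨ψ₀, ψ₁, χ, hχ⟩ := hp.exists_chordParam hc h1 (norm_pt _)
  have key : ∀ x ∈ Icc ψ₀ ψ₁, ∀ y ∈ Icc ψ₀ ψ₁, pt t₁ = χ x → pt t₂ = χ y → False := by
    intro x hx y hy hx1 hy1
    have hm : ∀ s : unitInterval, x + s * (y - x) ∈ Icc ψ₀ ψ₁ := fun s => by
      obtain ⟨s, hs⟩ := s
      have := (convex_Icc ψ₀ ψ₁) hx hy (a := 1 - s) (b := s) (by linarith [hs.2]) hs.1 (by ring)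
      simp only [smul_eq_mul] at this
      convert! this using 1
      ring
    set γ : C(unitInterval, ℂ) := ⟨fun s => χ (x + s * (y - x)),
      hχ.cont.comp_continuous (by fun_prop) hm⟩ with hγ
    have hγc : ∀ s, γ s ∈ closure c := fun s => by
      rw [hχ.closure_eq]; exact ⟨_, hm s, rfl⟩
    refine not_crossing γ (by simp [hγ, hx1]) (by simp [hγ, hy1])
      (fun s => (hc.closure_subset (hγc s)).1) hu1 hu2 hu3 hu4 hd.isPreconnected.closure
      (fun z hz => (hd.closure_subset hz).1) (hcd.mono_right ?_) h3 h4
    rintro _ ⟨s, rfl⟩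
    exact hγc s
  have l := left_mem_Icc.2 hχ.lt.le
  have r := right_mem_Icc.2 hχ.lt.le
  rcases hχ.eq_end hc h1 (norm_pt _) with h | h <;> rcases hχ.eq_end hc h2 (norm_pt _) with h' | h'
  · exact n12 (h.trans h'.symm)
  · exact key _ l _ r h h'
  · exact key _ r _ l h h'
  · exact n12 (h.trans h'.symm)

/-- A piece of the boundary of a face, parametrized by the argument of the quotient. -/
structure Track (A B : ℂ[X]) (Y T : Set ℂ) (ψ₀ ψ₁ : ℝ) : Prop where
  lt : ψ₀ < ψ₁
  exists_param : ∃ (γ : ℝ → ℂ) (F : Set ℝ), F.Finite ∧ InjOn γ (Ioo ψ₀ ψ₁ \ F) ∧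
    ∀ s ∈ Ioo ψ₀ ψ₁ \ F, γ s ∈ closure Y ∧ γ s ∈ T ∧ RegPt A B (γ s) ∧ quo A B (γ s) = pt s

namespace Track

variable {Y T T' : Set ℂ} {ψ₀ ψ₁ ψ₂ : ℝ}

lemma mono (h : Track A B Y T ψ₀ ψ₁) (hT : T ⊆ T') : Track A B Y T' ψ₀ ψ₁ := by
  obtain ⟨h1, γ, F, hF, hi, h⟩ := h
  exact ⟨h1, γ, F, hF, hi, fun s hs => ⟨(h s hs).1, hT (h s hs).2.1, (h s hs).2.2⟩⟩

/-- A longer piece would contain two parameters `s` and `s + 2π` outside the exceptional set, that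
is, two regular boundary points of one face with the same value. -/
lemma sub_le (h : Track A B Y T ψ₀ ψ₁) (hp : CirclePair A B φ) (hY : IsFace A B Y) :
    ψ₁ - ψ₀ ≤ 2 * Real.pi := by
  obtain ⟨h1, γ, F, hF, hi, h⟩ := h
  by_contra! hlt
  have hF' : ((fun s => s + 2 * Real.pi) ⁻¹' F).Finite :=
    hF.preimage (add_left_injective _).injOn
  obtain ⟨s, hs, hsF⟩ := ((Ioo_infinite (a := ψ₀) (b := ψ₁ - 2 * Real.pi)
    (by linarith)).sdiff (hF.union hF')).nonempty
  have hpi := Real.pi_pos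
  rw [mem_union, not_or] at hsF
  have m1 : s ∈ Ioo ψ₀ ψ₁ \ F := ⟨⟨hs.1, by linarith [hs.2]⟩, hsF.1⟩
  have m2 : s + 2 * Real.pi ∈ Ioo ψ₀ ψ₁ \ F :=
    ⟨⟨by linarith [hs.1], by linarith [hs.2]⟩, hsF.2⟩
  obtain ⟨a1, -, a3, a4⟩ := h _ m1
  obtain ⟨b1, -, b3, b4⟩ := h _ m2
  have := hi m1 m2 (hp.injOn_boundary hY a3 b3 a1 b1 ?_)
  · linarith
  · rw [a4, b4]
    simpa using (pt_add_int s 1).symm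

/-- The common end joins the exceptional set, since a vertex need not be a regular point;
disjointness of the supports keeps the parametrization injective. -/
lemma trans (h : Track A B Y T ψ₀ ψ₁) (h' : Track A B Y T' ψ₁ ψ₂) (hd : Disjoint T T') :
    Track A B Y (T ∪ T') ψ₀ ψ₂ := by
  obtain ⟨h1, γ, F, hF, hi, h⟩ := h
  obtain ⟨h1', γ', F', hF', hi', h'⟩ := h'
  classical
  have key : ∀ s ∈ Ioo ψ₀ ψ₂ \ (F ∪ F' ∪ {ψ₁}),
      (s ∈ Ioo ψ₀ ψ₁ \ F ∧ (if s < ψ₁ then γ s else γ' s) = γ s) ∨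
      (s ∈ Ioo ψ₁ ψ₂ \ F' ∧ (if s < ψ₁ then γ s else γ' s) = γ' s) := by
    rintro s ⟨⟨hs1, hs2⟩, hs3⟩
    simp only [mem_union, mem_singleton_iff, not_or] at hs3
    rcases lt_or_gt_of_ne hs3.2 with hlt | hlt
    · exact Or.inl ⟨⟨⟨hs1, hlt⟩, hs3.1.1⟩, if_pos hlt⟩
    · exact Or.inr ⟨⟨⟨hlt, hs2⟩, hs3.1.2⟩, if_neg hlt.not_gt⟩
  refine ⟨h1.trans h1', fun s => if s < ψ₁ then γ s else γ' s, F ∪ F' ∪ {ψ₁},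
    (hF.union hF').union (finite_singleton _), ?_, ?_⟩
  · intro s hs s' hs' heq
    beta_reduce at heq
    rcases key s hs with ⟨m, e⟩ | ⟨m, e⟩ <;> rcases key s' hs' with ⟨m', e'⟩ | ⟨m', e'⟩ <;>
      rw [e, e'] at heq
    · exact hi m m' heq
    · exact (Set.disjoint_left.1 hd (h _ m).2.1 (heq ▸ (h' _ m').2.1)).elim
    · exact (Set.disjoint_left.1 hd (h _ m').2.1 (heq ▸ (h' _ m).2.1)).elim
    · exact hi' m m' heq
  · intro s hs
    beta_reduce
    rcases key s hs with ⟨m, e⟩ | ⟨m, e⟩ <;> rw [e]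
    · exact ⟨(h s m).1, Or.inl (h s m).2.1, (h s m).2.2⟩
    · exact ⟨(h' s m).1, Or.inr (h' s m).2.1, (h' s m).2.2⟩

/-- The parameters of arcs and chords are determined modulo `2π` only; before they are concatenated
their branches have to be matched. -/
lemma shift (h : Track A B Y T ψ₀ ψ₁) (n : ℤ) :
    Track A B Y T (ψ₀ + n * (2 * Real.pi)) (ψ₁ + n * (2 * Real.pi)) := by
  obtain ⟨h1, γ, F, hF, hi, h⟩ := h
  have key : ∀ s ∈ Ioo (ψ₀ + n * (2 * Real.pi)) (ψ₁ + n * (2 * Real.pi)) \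
      ((fun s => s - n * (2 * Real.pi)) ⁻¹' F), s - n * (2 * Real.pi) ∈ Ioo ψ₀ ψ₁ \ F :=
    fun s hs => ⟨⟨by linarith [hs.1.1], by linarith [hs.1.2]⟩, hs.2⟩
  refine ⟨by linarith, fun s => γ (s - n * (2 * Real.pi)), (fun s => s - n * (2 * Real.pi)) ⁻¹' F,
    hF.preimage (sub_left_injective).injOn, ?_, fun s hs => ?_⟩
  · intro s hs s' hs' heq
    have := hi (key s hs) (key s' hs') heq
    linarith
  · obtain ⟨a1, a2, a3, a4⟩ := h _ (key s hs)
    refine ⟨a1, a2, a3, a4.trans ?_⟩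
    rw [pt_eq_iff]
    exact ⟨-n, by push_cast; ring⟩

end Track

lemma IsChordParam.track (hp : CirclePair A B φ) {c Y : Set ℂ} (hc : IsDiscChord A B c)
    {ψ₀ ψ₁ : ℝ} {χ : ℝ → ℂ} (h : IsChordParam A B c ψ₀ ψ₁ χ) (hcY : c ⊆ closure Y) :
    Track A B Y c ψ₀ ψ₁ := by
  refine ⟨h.lt, χ, ∅, finite_empty, ?_, fun s hs => ?_⟩
  · intro s hs s' hs' heq
    have h1 := h.quo_eq s ⟨hs.1.1.le, hs.1.2.le⟩
    rw [heq, h.quo_eq s' ⟨hs'.1.1.le, hs'.1.2.le⟩] at h1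
    refine pt_injOn ?_ h1.symm
    rw [abs_lt]
    constructor <;> linarith [h.le, hs.1.1, hs.1.2, hs'.1.1, hs'.1.2]
  · have := h.mem_chord hs.1
    exact ⟨hcY this, this, hp.regPt_of_mem_discNet (hc.subset this),
      h.quo_eq s ⟨hs.1.1.le, hs.1.2.le⟩⟩

lemma CirclePair.track_arc (hp : CirclePair A B φ) {Y : Set ℂ} {a b : ℝ} (hab : a < b)
    (hba : b - a < 2 * Real.pi) (hpos : ∀ θ ∈ Ioo a b, 0 < rho A B θ)
    (hY : ∀ θ ∈ Ioo a b, pt θ ∈ closure Y) : Track A B Y (pt '' Ioo a b) (φ a) (φ b) := by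
  have hm := hp.strictMonoOn_of_rho_pos hpos
  have himg : ∀ s, s ∈ Ioo (φ a) (φ b) → ∃ θ, θ ∈ Ioo a b ∧ φ θ = s := fun s hs =>
    intermediate_value_Ioo hab.le hp.continuous_lift.continuousOn hs
  choose! g hg hg' using himg
  refine ⟨hm (left_mem_Icc.2 hab.le) (right_mem_Icc.2 hab.le) hab, fun s => pt (g s), ∅,
    finite_empty, ?_, fun s hs => ?_⟩
  · intro s hs s' hs' heq
    have m := hg s hs.1
    have m' := hg s' hs'.1
    rw [← hg' s hs.1, ← hg' s' hs'.1]
    congr 1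
    refine pt_injOn ?_ heq
    rw [abs_lt]
    constructor <;> linarith [m.1, m.2, m'.1, m'.2]
  · have m := hg s hs.1
    refine ⟨hY _ m, ⟨_, m, rfl⟩, hp.regPt_pt (hpos _ m), ?_⟩
    rw [hp.quo_pt, hg' s hs.1]

end CircleNet

/-! ### Orientation of the quotient along the circle. -/

namespace CircleNet

open Set Filter Topology

variable {A B : ℂ[X]} {φ : ℝ → ℝ}

lemma rho_swap (A B : ℂ[X]) (θ : ℝ) : rho B A θ = -rho A B θ := by
  unfold rho; rw [wr_swap, ← Complex.neg_re]; congr 1; simp; ring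

lemma rootMultiplicity_wr_swap (A B : ℂ[X]) (x : ℂ) :
    (wr B A).rootMultiplicity x = (wr A B).rootMultiplicity x := by
  classical
  simp [rootMultiplicity_eq_multiplicity, wr_swap A B]

lemma eventually_eval_pt_ne {g : ℂ[X]} (hg : g ≠ 0) (t : ℝ) :
    ∀ᶠ θ in 𝓝[≠] t, g.eval (pt θ) ≠ 0 := by
  have h1 : ∀ᶠ θ in 𝓝[≠] t, pt θ ≠ pt t := by
    filter_upwards [self_mem_nhdsWithin, nhdsWithin_le_nhds (Ioo_mem_nhds
      (sub_lt_self t Real.two_pi_pos) (lt_add_of_pos_right t Real.two_pi_pos))] with θ h1 h2 h3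
    exact h1 (pt_injOn (by rw [abs_lt]; constructor <;> linarith [h2.1, h2.2]) h3)
  have h2 : ∀ᶠ z in 𝓝 (pt t), z ≠ pt t → g.eval z ≠ 0 := by
    have : (g.rootSet ℂ \ {pt t}).Finite := (g.rootSet_finite ℂ).sdiff
    filter_upwards [this.isClosed.isOpen_compl.mem_nhds fun h => h.2 rfl] with z hz hzt h0
    refine hz ⟨?_, hzt⟩
    rw [mem_rootSet]
    exact ⟨hg, by simpa using h0⟩
  filter_upwards [h1, nhdsWithin_le_nhds (continuous_pt.continuousAt.eventually h2)] with θ h3 h4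
  exact h4 h3

namespace CirclePair

variable (hp : CirclePair A B φ)
include hp

/-- The logarithmic derivative is real before its real part is taken, since the argument `φ` is
real; this comes from differentiating `A = B * exp (i φ)` along the circle. -/
lemma rho_coe (θ : ℝ) :
    (rho A B θ : ℂ) = pt θ * (wr A B).eval (pt θ) / (A.eval (pt θ) * B.eval (pt θ)) := by
  have hpt : ∀ {f : ℝ → ℝ} {f' : ℝ} (_ : HasDerivAt f f' θ),
      HasDerivAt (fun θ => pt (f θ)) (pt (f θ) * (f' * Complex.I)) θ := fun hf =>
    (hf.ofReal_comp.mul_const Complex.I).cexp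
  have h0 := hpt (hasDerivAt_id θ)
  simp only [id, Complex.ofReal_one, one_mul] at h0
  have hA : HasDerivAt (fun θ => A.eval (pt θ)) _ θ := (A.hasDerivAt (pt θ)).comp θ h0
  have hB : HasDerivAt (fun θ => B.eval (pt θ)) _ θ := (B.hasDerivAt (pt θ)).comp θ h0
  have h1 := hB.mul (hpt (hp.hasDerivAt θ))
  rw [show ((fun θ => B.eval (pt θ)) * fun θ => pt (φ θ)) = fun θ => A.eval (pt θ) from
    funext fun x => (hp.lift x).symm] at h1
  have h2 := hA.unique h1
  have h3 := hp.num_pt_ne θ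
  have h4 := hp.den_pt_ne θ
  rw [eq_div_iff (mul_ne_zero h3 h4)]
  have h5 := hp.lift θ
  simp only [wr, eval_sub, eval_mul]
  have h6 := Complex.I_ne_zero
  apply mul_right_cancel₀ h6
  linear_combination (-(B.eval (pt θ))) * h2 +
    (derivative B).eval (pt θ) * pt θ * Complex.I * h5
    + rho A B θ * Complex.I * B.eval (pt θ) * h5

lemma rho_eq_zero_iff {θ : ℝ} : rho A B θ = 0 ↔ (wr A B).eval (pt θ) = 0 := by
  rw [← Complex.ofReal_eq_zero, hp.rho_coe]
  simp [hp.num_pt_ne, hp.den_pt_ne, pt_ne_zero]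

lemma rho_pos_or_neg {a b : ℝ} (h : ∀ θ ∈ Ioo a b, (wr A B).eval (pt θ) ≠ 0) :
    (∀ θ ∈ Ioo a b, 0 < rho A B θ) ∨ ∀ θ ∈ Ioo a b, rho A B θ < 0 := by
  by_contra! hcon
  obtain ⟨⟨x, hx, hx'⟩, y, hy, hy'⟩ := hcon
  obtain ⟨z, hz, hz'⟩ := (isPreconnected_Ioo (a := a) (b := b)).intermediate_value hx hy
    hp.continuous_rho.continuousOn ⟨hx', hy'⟩
  exact h z hz (hp.rho_eq_zero_iff.1 hz')

lemma rho_pos_of_right {a b : ℝ} (hab : a < b) (h : ∀ θ ∈ Ioo a b, (wr A B).eval (pt θ) ≠ 0)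
    (h' : ∀ᶠ θ in 𝓝[>] a, 0 < rho A B θ) : ∀ θ ∈ Ioo a b, 0 < rho A B θ := by
  refine (hp.rho_pos_or_neg h).resolve_right fun hn => ?_
  obtain ⟨θ, h1, h2⟩ := (h'.and (Ioo_mem_nhdsGT hab)).exists
  exact lt_asymm h1 (hn θ h2)

lemma eventually_ne (t : ℝ) : ∀ᶠ θ in 𝓝[≠] t, (wr A B).eval (pt θ) ≠ 0 :=
  eventually_eval_pt_ne hp.wr_ne_zero t

lemma eventually_right (t : ℝ) :
    (∀ᶠ θ in 𝓝[>] t, 0 < rho A B θ) ∨ ∀ᶠ θ in 𝓝[>] t, rho A B θ < 0 := by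
  obtain ⟨b, hb, h⟩ := exists_gt_of_eventually
    ((hp.eventually_ne t).filter_mono (nhdsWithin_mono t fun x (hx : t < x) => hx.ne'))
  refine (hp.rho_pos_or_neg h).imp ?_ ?_ <;>
  exact fun h' => by filter_upwards [Ioo_mem_nhdsGT hb] with θ hθ using h' θ hθ

lemma eventually_left (t : ℝ) :
    (∀ᶠ θ in 𝓝[<] t, 0 < rho A B θ) ∨ ∀ᶠ θ in 𝓝[<] t, rho A B θ < 0 := by
  obtain ⟨b, hb, h⟩ := exists_lt_of_eventually
    ((hp.eventually_ne t).filter_mono (nhdsWithin_mono t fun x (hx : x < t) => hx.ne))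
  refine (hp.rho_pos_or_neg h).imp ?_ ?_ <;>
  exact fun h' => by filter_upwards [Ioo_mem_nhdsLT hb] with θ hθ using h' θ hθ

/-- In the chart `φ - φ t = a x ^ (m + 1)` with `m` the multiplicity. Growth on both sides of `t`
makes `m + 1` odd; in the next lemma a maximum at `t` makes it even. -/
lemma odd_of_left_right {t : ℝ} (h : ∀ᶠ θ in 𝓝[<] t, 0 < rho A B θ)
    (h' : ∀ᶠ θ in 𝓝[>] t, 0 < rho A B θ) : Even ((wr A B).rootMultiplicity (pt t)) := by
  obtain ⟨e, a, -, hes, he0, -, hreal⟩ := hp.exists_chart t rfl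
  obtain ⟨θ, ⟨h1, h2⟩, h3⟩ := (((hp.eventually_lt_right h').and
    (nhdsWithin_le_nhds hreal)).and self_mem_nhdsWithin).exists
  obtain ⟨θ', ⟨h1', h2'⟩, h3'⟩ := (((hp.eventually_lt_left h).and
    (nhdsWithin_le_nhds hreal)).and self_mem_nhdsWithin).exists
  have x1 := h2.2.2.1.2 h3
  have x2 := h2'.2.2.2.1.2 h3'
  by_contra hodd
  have hev := (Nat.not_even_iff_odd.1 hodd).add_one
  have y1 := pow_pos x1 ((wr A B).rootMultiplicity (pt t) + 1)
  have y2 := hev.pow_pos x2.ne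
  have z1 := h2.2.2.2.2
  have z2 := h2'.2.2.2.2
  have w1 : 0 < a := by
    by_contra! ha
    nlinarith
  nlinarith

lemma odd_of_left_right' {t : ℝ} (h : ∀ᶠ θ in 𝓝[<] t, 0 < rho A B θ)
    (h' : ∀ᶠ θ in 𝓝[>] t, rho A B θ < 0) : Odd ((wr A B).rootMultiplicity (pt t)) := by
  obtain ⟨e, a, -, hes, he0, -, hreal⟩ := hp.exists_chart t rfl
  have h'' : ∀ᶠ θ in 𝓝[>] t, 0 < rho B A θ := by simpa only [rho_swap A B, neg_pos] using h'
  obtain ⟨θ, ⟨h1, h2⟩, h3⟩ := (((hp.swap.eventually_lt_right h'').and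
    (nhdsWithin_le_nhds hreal)).and self_mem_nhdsWithin).exists
  obtain ⟨θ', ⟨h1', h2'⟩, h3'⟩ := (((hp.eventually_lt_left h).and
    (nhdsWithin_le_nhds hreal)).and self_mem_nhdsWithin).exists
  have x1 := h2.2.2.1.2 h3
  have x2 := h2'.2.2.2.1.2 h3'
  by_contra hodd
  have hev := (Nat.not_odd_iff_even.1 hodd).add_one
  have y1 := pow_pos x1 ((wr A B).rootMultiplicity (pt t) + 1)
  have y2 := hev.pow_neg x2
  have z1 := h2.2.2.2.2
  have z2 := h2'.2.2.2.2
  have w1 : a < 0 := by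
    by_contra! ha
    nlinarith
  nlinarith

/-- The orientation changes at the vertices of odd multiplicity only. -/
lemma eventually_right_of_left {t : ℝ} {ε : ℝ} (hε : ε = 1 ∨ ε = -1)
    (h : ∀ᶠ θ in 𝓝[<] t, 0 < ε * rho A B θ) :
    ∀ᶠ θ in 𝓝[>] t, 0 < ε * (-1) ^ (wr A B).rootMultiplicity (pt t) * rho A B θ := by
  have key : ∀ {A B : ℂ[X]} {φ : ℝ → ℝ} (_ : CirclePair A B φ), (∀ᶠ θ in 𝓝[<] t, 0 < rho A B θ) →
      ∀ᶠ θ in 𝓝[>] t, 0 < (-1) ^ (wr A B).rootMultiplicity (pt t) * rho A B θ := by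
    intro A B φ hp h
    rcases hp.eventually_right t with h' | h'
    · rw [(hp.odd_of_left_right h h').neg_one_pow]
      simpa using h'
    · rw [(hp.odd_of_left_right' h h').neg_one_pow]
      simpa using h'
  rcases hε with rfl | rfl
  · simpa using key hp (by simpa using h)
  · have := key hp.swap (by simpa only [rho_swap A B, neg_mul, one_mul] using h)
    rw [rootMultiplicity_wr_swap] at this
    filter_upwards [this] with θ hθ
    rw [rho_swap A B] at hθ
    linarith

end CirclePair
end CircleNet

/-! ### The chords at a vertex. -/

namespace CircleNet

open Set Filter Topology

variable {A B : ℂ[X]} {φ : ℝ → ℝ} {t σ ε : ℝ} {Y : Set ℂ} {γ : ℝ → ℂ}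

namespace IsSector

/-- In the direction of increasing argument the path of the sector ends at the vertex for `σ = 1`
and starts there for `σ = -1`. As `ε ≤ 1`, its arguments are determined by the values. -/
lemma track (h : IsSector A B φ t σ Y γ ε) (hp : CirclePair A B φ) {ψ₀ ψ₁ : ℝ} (hψ : ψ₀ < ψ₁)
    (hσ : σ * σ = 1) (hm : ∀ s ∈ Ioo ψ₀ ψ₁, σ * (φ t - s) ∈ Ioo 0 ε) :
    Track A B Y (γ '' Ioo 0 ε) ψ₀ ψ₁ := by
  have hq : ∀ s ∈ Ioo ψ₀ ψ₁, quo A B (γ (σ * (φ t - s))) = pt s := fun s hs => by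
    rw [h.quo_eq _ (hm s hs)]
    congr 1
    linear_combination (s - φ t) * hσ
  refine ⟨hψ, fun s => γ (σ * (φ t - s)), ∅, finite_empty, ?_, fun s hs => ⟨?_, ?_, ?_, hq s hs.1⟩⟩
  · intro s hs s' hs' heq
    have h1 := hq s hs.1
    beta_reduce at heq
    rw [heq, hq s' hs'.1] at h1
    refine (pt_injOn ?_ h1).symm
    have e1 := hm s hs.1
    have e2 := hm s' hs'.1
    have e3 : |σ| = 1 := by
      rcases mul_self_eq_one_iff.1 hσ with rfl | rfl <;> simp
    have e4 : |s' - s| = |σ * (φ t - s) - σ * (φ t - s')| := by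
      rw [← mul_sub, abs_mul, e3, one_mul]; congr 1; ring
    rw [e4, abs_lt]
    have := h.le_one
    have := Real.pi_gt_three
    constructor <;> linarith [e1.1, e1.2, e2.1, e2.2]
  · exact h.mem_closure _ (hm s hs.1)
  · exact ⟨_, hm s hs.1, rfl⟩
  · exact hp.regPt_of_mem_discNet (h.mem _ (hm s hs.1))

lemma track_right (h : IsSector A B φ t 1 Y γ ε) (hp : CirclePair A B φ) :
    Track A B Y (γ '' Ioo 0 ε) (φ t - ε) (φ t) :=
  h.track hp (by linarith [h.pos]) (by norm_num)
    fun s hs => ⟨by linarith [hs.2], by linarith [hs.1]⟩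

lemma track_left (h : IsSector A B φ t (-1) Y γ ε) (hp : CirclePair A B φ) :
    Track A B Y (γ '' Ioo 0 ε) (φ t) (φ t + ε) :=
  h.track hp (by linarith [h.pos]) (by norm_num)
    fun s hs => ⟨by linarith [hs.1], by linarith [hs.2]⟩

/-- The chord along the boundary of a sector. -/
lemma exists_chord (h : IsSector A B φ t σ Y γ ε) (hp : CirclePair A B φ) :
    ∃ c, IsDiscChord A B c ∧ γ '' Ioo 0 ε ⊆ c ∧ pt t ∈ closure c ∧ c ⊆ closure Y := by
  have hne : (Ioo 0 ε).Nonempty := nonempty_Ioo.2 h.pos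
  obtain ⟨c, hc, hγc⟩ := exists_isDiscChord (isPreconnected_Ioo.image _ h.cont)
    (image_subset_iff.2 h.mem) (hne.image _)
  obtain ⟨s, hs⟩ := hne
  refine ⟨c, hc, hγc, ?_, hp.subset_closure_face_of_chord hc h.face
    ⟨γ s, hγc ⟨s, hs, rfl⟩, h.mem_closure s hs⟩⟩
  refine mem_closure_of_tendsto h.tendsto ?_
  filter_upwards [Ioo_mem_nhdsGT h.pos] with s hs using hγc ⟨s, hs, rfl⟩

lemma side_right (h : IsSector A B φ t 1 Y γ ε) : ∀ᶠ θ in 𝓝[>] t, pt θ ∈ closure Y := by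
  filter_upwards [nhdsWithin_le_nhds h.side, self_mem_nhdsWithin] with θ h1 h2
  exact h1 (by rw [one_mul]; exact sub_pos.2 h2)

lemma side_left (h : IsSector A B φ t (-1) Y γ ε) : ∀ᶠ θ in 𝓝[<] t, pt θ ∈ closure Y := by
  filter_upwards [nhdsWithin_le_nhds h.side, self_mem_nhdsWithin] with θ h1 h2
  exact h1 (by have : θ < t := h2; linarith)

end IsSector

/-- If there is just one edge in the disc at `pt t`, and the quotient preserves the orientation
before `t`, then the quotient moves from its value at `pt t` in the positive direction along the
edge. -/
lemma IsChordParam.right_ne {c : Set ℂ} {ψ₀ ψ₁ : ℝ} {χ : ℝ → ℂ} (hχ : IsChordParam A B c ψ₀ ψ₁ χ)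
    (hp : CirclePair A B φ) (hc : IsDiscChord A B c) (h : IsSector A B φ t (-1) Y γ ε)
    (hγ : ∀ᶠ z in 𝓝 (pt t), z ∈ discNet A B → ∃ s ∈ Ioo 0 ε, γ s = z) : χ ψ₁ ≠ pt t := by
  intro heq
  have h1 : Tendsto χ (𝓝[<] ψ₁) (𝓝 (pt t)) := by
    rw [← heq]
    have := (hχ.cont ψ₁ (right_mem_Icc.2 hχ.lt.le)).mono_left
      (nhdsWithin_mono ψ₁ (Ioo_subset_Icc_self (a := ψ₀)))
    rwa [nhdsWithin_Ioo_eq_nhdsLT hχ.lt] at this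
  have h2 := hχ.quo_eq ψ₁ (right_mem_Icc.2 hχ.lt.le)
  rw [heq, hp.quo_pt] at h2
  obtain ⟨n, hn⟩ := pt_eq_iff.1 h2
  obtain ⟨x, ⟨h3, h4⟩, h5⟩ := ((h1.eventually hγ).and (Ioo_mem_nhdsLT (hχ.lt))).and
    (Ioo_mem_nhdsLT (sub_one_lt ψ₁)) |>.exists
  obtain ⟨s, hs, hsx⟩ := h3 (hc.subset (hχ.mem_chord h4))
  have h6 := h.quo_eq s hs
  rw [hsx, hχ.quo_eq x ⟨h4.1.le, h4.2.le⟩] at h6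
  obtain ⟨m, hm⟩ := pt_eq_iff.1 h6
  -- Near the end `ψ₁` the argument is slightly below that at the vertex, but along the only edge at
  -- the vertex it is slightly above; the two small differences cannot match modulo `2π`.
  have h7 : pt (φ t) = pt (φ t + (x - ψ₁ - s)) :=
    pt_eq_iff.2 ⟨-n - m, by push_cast; linear_combination -hm - hn⟩
  have h8 := pt_injOn (by
    have := h.le_one
    have := Real.pi_gt_three
    rw [abs_lt]; constructor <;> linarith [hs.1, hs.2, h5.1, h5.2]) h7
  linarith [hs.1, h5.2]

namespace CirclePair

variable (hp : CirclePair A B φ)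
include hp

/-- The chord at a simple vertex. -/
theorem exists_chord_of_simple_left {t : ℝ} (h1 : (wr A B).rootMultiplicity (pt t) = 1)
    (hpos : ∀ᶠ θ in 𝓝[<] t, 0 < rho A B θ) : ∃ c Y, IsDiscChord A B c ∧ pt t ∈ closure c ∧
      IsFace A B Y ∧ c ⊆ closure Y ∧ (∀ᶠ θ in 𝓝[<] t, pt θ ∈ closure Y) ∧
      (∀ c', IsDiscChord A B c' → pt t ∈ closure c' → c' = c) ∧
      ∀ ψ₀ ψ₁ χ, IsChordParam A B c ψ₀ ψ₁ χ → χ ψ₀ = pt t ∧ χ ψ₁ ≠ pt t := by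
  obtain ⟨Y, γ, ε, hS, hγ⟩ := hp.exists_sector_left le_rfl (by rw [h1]) hpos
  have hγ := hγ rfl
  obtain ⟨c, hc, hγc, htc, hcY⟩ := hS.exists_chord hp
  refine ⟨c, Y, hc, htc, hS.face, hcY, hS.side_left, fun c' hc' ht' => ?_, fun ψ₀ ψ₁ χ hχ => ?_⟩
  · obtain ⟨z, hz, hzc⟩ := mem_closure_iff_nhds.1 ht' _ hγ
    obtain ⟨s, hs, rfl⟩ := hz (hc'.subset hzc)
    exact hc'.eq_of_inter hc ⟨_, hzc, hγc ⟨s, hs, rfl⟩⟩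
  · have h2 := hχ.right_ne hp hc hS hγ
    exact ⟨((hχ.eq_end hc htc (norm_pt _)).resolve_right h2.symm).symm, h2⟩

/-- At a simple vertex there is just one chord, and its other end is another vertex. -/
theorem exists_chord_of_simple {t : ℝ} (h1 : (wr A B).rootMultiplicity (pt t) = 1) :
    ∃ c, IsDiscChord A B c ∧ pt t ∈ closure c ∧
      (∀ c', IsDiscChord A B c' → pt t ∈ closure c' → c' = c) ∧
      ∃ v ∈ closure c, ‖v‖ = 1 ∧ v ≠ pt t := by
  have key : ∀ {A B : ℂ[X]} {φ : ℝ → ℝ} (_ : CirclePair A B φ)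
      (_ : (wr A B).rootMultiplicity (pt t) = 1), (∀ᶠ θ in 𝓝[<] t, 0 < rho A B θ) →
      ∃ c, IsDiscChord A B c ∧ pt t ∈ closure c ∧
      (∀ c', IsDiscChord A B c' → pt t ∈ closure c' → c' = c) ∧
      ∃ v ∈ closure c, ‖v‖ = 1 ∧ v ≠ pt t := by
    intro A B φ hp h1 hpos
    obtain ⟨c, Y, hc, htc, -, -, -, hu, hχ⟩ := hp.exists_chord_of_simple_left h1 hpos
    obtain ⟨ψ₀, ψ₁, χ, h⟩ := hp.exists_chordParam hc htc (norm_pt _)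
    exact ⟨c, hc, htc, hu, χ ψ₁, h.right_mem, h.norm_right, (hχ _ _ _ h).2⟩
  rcases hp.eventually_left t with h | h
  · exact key hp h1 h
  · obtain ⟨c, hc, htc, hu, hv⟩ := key hp.swap ((rootMultiplicity_wr_swap _ _ _).trans h1)
      (by simpa only [rho_swap A B, neg_pos] using h)
    exact ⟨c, hc.swap, htc, fun c' hc' => hu c' hc'.swap, hv⟩

/-- At any vertex there is a chord which is not a loop. -/
theorem exists_chord_of_isVertex {t : ℝ} (h1 : (wr A B).eval (pt t) = 0) :
    ∃ c, IsDiscChord A B c ∧ pt t ∈ closure c ∧ ∃ v ∈ closure c, ‖v‖ = 1 ∧ v ≠ pt t := by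
  have key : ∀ {A B : ℂ[X]} {φ : ℝ → ℝ} (_ : CirclePair A B φ)
      (_ : (wr A B).eval (pt t) = 0), (∀ᶠ θ in 𝓝[>] t, 0 < rho A B θ) →
      ∃ c, IsDiscChord A B c ∧ pt t ∈ closure c ∧ ∃ v ∈ closure c, ‖v‖ = 1 ∧ v ≠ pt t := by
    intro A B φ hp h1 hpos
    have hm := (rootMultiplicity_pos hp.wr_ne_zero).2 h1
    obtain ⟨Y, γ, ε, hS, -⟩ := hp.exists_sector_right (by omega) rfl hpos
    obtain ⟨c, hc, hγc, htc, hcY⟩ := hS.exists_chord hp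
    refine ⟨c, hc, htc, ?_⟩
    -- A loop has equal values at its ends, so it makes a full turn and takes every other value of
    -- the circle. The arc following the vertex lies in the boundary of the same face and would
    -- repeat one of these values.
    by_contra! hloop
    obtain ⟨ψ₀, ψ₁, χ, hχ⟩ := hp.exists_chordParam hc htc (norm_pt _)
    have e0 := hloop _ hχ.left_mem hχ.norm_left
    have e1 := hloop _ hχ.right_mem hχ.norm_right
    have q0 := hχ.quo_eq _ (left_mem_Icc.2 hχ.lt.le)
    have q1 := hχ.quo_eq _ (right_mem_Icc.2 hχ.lt.le)
    rw [e0, hp.quo_pt] at q0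
    rw [e1, hp.quo_pt] at q1
    have hψ : ψ₁ = ψ₀ + 2 * Real.pi := by
      by_contra hne
      have := hχ.lt
      have := lt_of_le_of_ne hχ.le hne
      exact hχ.lt.ne (pt_injOn (by rw [abs_lt]; constructor <;> linarith) (q0.symm.trans q1))
    have hcont : ∀ᶠ θ in 𝓝[>] t, φ θ < φ t + 2 * Real.pi :=
      nhdsWithin_le_nhds (hp.continuous_lift.continuousAt.eventually
        (gt_mem_nhds (by linarith [Real.pi_pos])))
    obtain ⟨θ, ⟨⟨h2, h3⟩, h4⟩, h5⟩ := (((hS.side_right.and hpos).and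
      (hp.eventually_lt_right hpos)).and hcont).exists
    obtain ⟨n, hn⟩ := pt_eq_iff.1 q0
    have hs : φ θ - n * (2 * Real.pi) ∈ Ioo ψ₀ ψ₁ := ⟨by linarith, by linarith⟩
    have hc' := hχ.mem_chord hs
    have h6 := hp.injOn_boundary hS.face (hp.regPt_of_mem_discNet (hc.subset hc'))
      (hp.regPt_pt h3) (hcY hc') h2 (by
        rw [hχ.quo_eq _ ⟨hs.1.le, hs.2.le⟩, hp.quo_pt, pt_eq_iff]
        exact ⟨-n, by push_cast; ring⟩)
    have h7 := (hc.subset hc').1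
    rw [h6, norm_pt] at h7
    exact lt_irrefl _ h7
  rcases hp.eventually_right t with h | h
  · exact key hp h1 h
  · obtain ⟨c, hc, htc, hv⟩ := key hp.swap (by rw [wr_swap, eval_neg, h1, neg_zero])
      (by simpa only [rho_swap A B, neg_pos] using h)
    exact ⟨c, hc.swap, htc, hv⟩

end CirclePair

end CircleNet

/-! ### Matching of the vertices of an arc by chords. -/

namespace CircleNet

open Set Filter Topology

variable {A B : ℂ[X]} {φ : ℝ → ℝ}

/-- Two points of the circle are joined by a chord in the disc. -/
def Joined (A B : ℂ[X]) (t t' : ℝ) : Prop :=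
  ∃ c, IsDiscChord A B c ∧ pt t ∈ closure c ∧ pt t' ∈ closure c

lemma Joined.symm {t t' : ℝ} (h : Joined A B t t') : Joined A B t' t := by
  obtain ⟨c, hc, h1, h2⟩ := h; exact ⟨c, hc, h2, h1⟩

lemma Joined.swap {t t' : ℝ} (h : Joined A B t t') : Joined B A t t' := by
  obtain ⟨c, hc, h1, h2⟩ := h; exact ⟨c, hc.swap, h1, h2⟩

/-- The vertices in the arc from `pt a` to `pt b` are simple, and the involution `τ` exchanges the
ends of the chords with both ends in the arc and fixes the other vertices. -/
structure IsMatching (A B : ℂ[X]) (W : Finset ℝ) (τ : ℝ → ℝ) (a b : ℝ) : Prop where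
  lt : a < b
  lt_add : b < a + 2 * Real.pi
  mem_iff : ∀ t ∈ Ioo a b, t ∈ W ↔ (wr A B).eval (pt t) = 0
  simple : ∀ t ∈ W, t ∈ Ioo a b → (wr A B).rootMultiplicity (pt t) = 1
  mem : ∀ t ∈ W, t ∈ Ioo a b → τ t ∈ W
  mem_Ioo : ∀ t ∈ W, t ∈ Ioo a b → τ t ∈ Ioo a b
  invol : ∀ t ∈ W, t ∈ Ioo a b → τ (τ t) = t
  joined_iff : ∀ t ∈ W, t ∈ Ioo a b → ∀ t' ∈ W, t' ∈ Ioo a b → t ≠ t' →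
    (Joined A B t t' ↔ τ t = t')

/-- The chord between `pt t` and `pt t'` separates the arcs between these points. -/
lemma CirclePair.mem_arc_of_joined (hp : CirclePair A B φ) {t t' u : ℝ} (h : Joined A B t t')
    (h1 : t < u) (h2 : u < t') {d : Set ℂ} (hd : IsDiscChord A B d)
    (hu : pt u ∈ closure d) {v : ℂ} (hv : v ∈ closure d) (hv1 : ‖v‖ = 1) :
    v ∈ pt '' Icc t t' := by
  obtain ⟨c, hc, ht, ht'⟩ := h
  obtain ⟨θ, rfl⟩ := exists_pt_eq hv1
  set u' := toIcoMod Real.two_pi_pos t θ with hu'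
  have hm := toIcoMod_mem_Ico Real.two_pi_pos t θ
  have he : pt u' = pt θ := pt_eq_iff.2 ⟨-toIcoDiv Real.two_pi_pos t θ, by
    rw [hu', toIcoMod, zsmul_eq_mul]; push_cast; ring⟩
  rw [← he]
  refine ⟨u', ⟨hm.1, ?_⟩, rfl⟩
  by_contra! hlt
  exact hp.chord_noncrossing hc hd ht ht' hu (he ▸ hv) h1 h2 hlt hm.2

namespace IsMatching

variable {W : Finset ℝ} {τ : ℝ → ℝ} {a b : ℝ}

lemma swap (h : IsMatching A B W τ a b) : IsMatching B A W τ a b where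
  lt := h.lt
  lt_add := h.lt_add
  mem_iff t ht := by rw [wr_swap, eval_neg, neg_eq_zero]; exact h.mem_iff t ht
  simple t ht hti := (rootMultiplicity_wr_swap _ _ _).trans (h.simple t ht hti)
  mem := h.mem
  mem_Ioo := h.mem_Ioo
  invol := h.invol
  joined_iff t ht hti t' ht' hti' hne :=
    ⟨fun hj => (h.joined_iff t ht hti t' ht' hti' hne).1 hj.swap,
      fun e => ((h.joined_iff t ht hti t' ht' hti' hne).2 e).swap⟩

lemma restrict (h : IsMatching A B W τ a b) {x y : ℝ} (hx : a ≤ x) (hxy : x < y) (hy : y ≤ b)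
    (hm : ∀ t ∈ W, t ∈ Ioo x y → τ t ∈ Ioo x y) : IsMatching A B W τ x y :=
  have hs : Ioo x y ⊆ Ioo a b := Ioo_subset_Ioo hx hy
  { lt := hxy
    lt_add := by linarith [h.lt_add]
    mem_iff := fun t ht => h.mem_iff t (hs ht)
    simple := fun t ht hti => h.simple t ht (hs hti)
    mem := fun t ht hti => h.mem t ht (hs hti)
    mem_Ioo := hm
    invol := fun t ht hti => h.invol t ht (hs hti)
    joined_iff := fun t ht hti t' ht' hti' => h.joined_iff t ht (hs hti) t' ht' (hs hti') }

lemma pt_eq (h : IsMatching A B W τ a b) {x y : ℝ} (hx : x ∈ Icc a b) (hy : y ∈ Icc a b)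
    (hxy : pt x = pt y) : x = y := by
  refine pt_injOn ?_ hxy
  rw [abs_lt]
  constructor <;> linarith [h.lt_add, hx.1, hx.2, hy.1, hy.2]

lemma joined (h : IsMatching A B W τ a b) {t : ℝ} (ht : t ∈ W) (hti : t ∈ Ioo a b)
    (hne : τ t ≠ t) : Joined A B t (τ t) :=
  (h.joined_iff t ht hti _ (h.mem t ht hti) (h.mem_Ioo t ht hti) hne.symm).2 rfl

lemma apply_ne (h : IsMatching A B W τ a b) {t u : ℝ} (ht : t ∈ W) (hti : t ∈ Ioo a b)
    (hne : τ u ≠ t) : τ t ≠ u := fun h' =>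
  hne (by rw [← h', h.invol t ht hti])

/-- The vertices under a chord are joined to vertices under the chord only. -/
lemma under (h : IsMatching A B W τ a b) (hp : CirclePair A B φ) {t u : ℝ} (ht : t ∈ W)
    (hti : t ∈ Ioo a b) (hu : u ∈ W) (h1 : t < u) (h2 : u < τ t) :
    τ u ≠ u ∧ τ u ∈ Ioo t (τ t) := by
  have hti' := h.mem_Ioo t ht hti
  have ht' := h.mem t ht hti
  have hui : u ∈ Ioo a b := ⟨hti.1.trans h1, h2.trans hti'.2⟩
  have hj := h.joined ht hti (h1.trans h2).ne'
  have ho : τ u ≠ t := h.apply_ne hu hui h2.ne'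
  have ho' : τ u ≠ τ t := h.apply_ne hu hui (by rw [h.invol t ht hti]; exact h1.ne)
  obtain ⟨d, hd, hud, hd', v, hv, hv1, hvu⟩ := hp.exists_chord_of_simple (h.simple u hu hui)
  obtain ⟨θ, hθ, rfl⟩ := hp.mem_arc_of_joined hj h1 h2 hd hud hv hv1
  have hθi : θ ∈ Ioo a b := ⟨hti.1.trans_le hθ.1, hθ.2.trans_lt hti'.2⟩
  have hτ : τ u = θ := (h.joined_iff u hu hui θ ((h.mem_iff θ hθi).2 (hd.isVertex hp hv)) hθi
    (fun h0 => hvu (by rw [h0]))).1 ⟨d, hd, hud, hv⟩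
  refine ⟨fun h0 => hvu (by rw [← hτ, h0]), ?_, ?_⟩
  · rw [hτ] at ho ⊢; exact lt_of_le_of_ne hθ.1 ho.symm
  · rw [hτ] at ho' ⊢; exact lt_of_le_of_ne hθ.2 ho'

end IsMatching

/-- The points of an open arc and of the chords with both ends in the arc. -/
def arcRegion (A B : ℂ[X]) (a b : ℝ) : Set ℂ :=
  pt '' Ioo a b ∪ {z | ∃ c, IsDiscChord A B c ∧ z ∈ c ∧
    ∀ v ∈ closure c, ‖v‖ = 1 → v ∈ pt '' Ioo a b}

lemma arcRegion_mono {a b a' b' : ℝ} (h : a ≤ a') (h' : b' ≤ b) :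
    arcRegion A B a' b' ⊆ arcRegion A B a b := by
  have := image_mono (f := pt) (Ioo_subset_Ioo h h')
  rintro z (hz | ⟨c, hc, hz, hv⟩)
  · exact Or.inl (this hz)
  · exact Or.inr ⟨c, hc, hz, fun v h1 h2 => this (hv v h1 h2)⟩

lemma pt_notMem_arc {a b x : ℝ} (h : x ∉ Ioo a b) (h1 : b - 2 * Real.pi ≤ x)
    (h2 : x ≤ a + 2 * Real.pi) : pt x ∉ pt '' Ioo a b := by
  rintro ⟨θ, hθ, he⟩
  have : θ = x := pt_injOn (by rw [abs_lt]; constructor <;> linarith [hθ.1, hθ.2]) he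
  exact h (this ▸ hθ)

lemma disjoint_arc_discNet {S : Set ℝ} {T : Set ℂ} (hT : T ⊆ discNet A B) :
    Disjoint (pt '' S) T := by
  rw [Set.disjoint_left]
  rintro _ ⟨θ, -, rfl⟩ h
  have := (hT h).1
  rw [norm_pt] at this
  exact lt_irrefl _ this

/-- The chord has an end outside the arc, so it is none of the chords of the region, and distinct
chords are disjoint. The inequalities on `x` ensure that `pt x` is not on the arc modulo a full
turn. -/
lemma disjoint_chord_arcRegion {a b : ℝ} {c : Set ℂ} (hc : IsDiscChord A B c) {x : ℝ}
    (hx : pt x ∈ closure c) (h : x ∉ Ioo a b) (h1 : b - 2 * Real.pi ≤ x)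
    (h2 : x ≤ a + 2 * Real.pi) : Disjoint c (arcRegion A B a b) := by
  rw [Set.disjoint_left]
  rintro z hz (hz' | ⟨c', hc', hz', hv⟩)
  · exact Set.disjoint_left.1 (disjoint_arc_discNet hc.subset) hz' hz
  · have := hc.eq_of_inter hc' ⟨z, hz, hz'⟩
    subst this
    exact pt_notMem_arc h h1 h2 (hv _ hx (norm_pt _))

/-- The sum of the values of a function at the points of a finite set in an open interval. -/
def arcSum (W : Finset ℝ) (f : ℝ → ℤ) (a b : ℝ) : ℤ := ∑ t ∈ W with a < t ∧ t < b, f t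

lemma arcSum_split {W : Finset ℝ} {f : ℝ → ℤ} {a b x : ℝ} (hx : x ∈ Ioo a b) (hxW : x ∈ W) :
    arcSum W f a b = arcSum W f a x + f x + arcSum W f x b := by
  simp only [arcSum, Finset.sum_filter]
  have : f x = ∑ t ∈ W, if t = x then f t else 0 := by
    rw [Finset.sum_ite_eq' W x f, if_pos hxW]
  rw [this, ← Finset.sum_add_distrib, ← Finset.sum_add_distrib]
  refine Finset.sum_congr rfl fun t _ => ?_
  have h1 := hx.1
  have h2 := hx.2
  rcases lt_trichotomy t x with h | rfl | h
  · simp [h, h.trans h2, h.ne, h.not_gt]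
  · simp [h1, h2]
  · simp [h, h1.trans h, h.ne', h.not_gt]

lemma arcSum_eq_zero {W : Finset ℝ} {f : ℝ → ℤ} {a b : ℝ} (h : ∀ t ∈ W, t ∈ Ioo a b → f t = 0) :
    arcSum W f a b = 0 :=
  Finset.sum_eq_zero fun t ht => h t (Finset.mem_filter.1 ht).1 (Finset.mem_filter.1 ht).2

lemma arcSum_neg {W : Finset ℝ} {f : ℝ → ℤ} {a b : ℝ} :
    arcSum W (fun t => -f t) a b = -arcSum W f a b := by
  simp [arcSum]

/-- The function whose sum is the turning of the quotient at the later ends of the chords. -/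
def later (τ : ℝ → ℝ) (s : ℝ → ℤ) (t : ℝ) : ℤ := if τ t < t then s t else 0

end CircleNet

/-! ### The boundary of a face over an arc whose vertices are all matched. -/

namespace CircleNet

open Set Filter Topology

variable {A B : ℂ[X]} {φ : ℝ → ℝ}

/-- `ε` is the sign of the derivative of the argument of the quotient before `t`. -/
def IsLeftSign (A B : ℂ[X]) (ε : ℤ) (t : ℝ) : Prop :=
  (ε = 1 ∨ ε = -1) ∧ ∀ᶠ θ in 𝓝[<] t, 0 < (ε : ℝ) * rho A B θ

lemma IsLeftSign.swap {ε : ℤ} {t : ℝ} (h : IsLeftSign A B ε t) : IsLeftSign B A (-ε) t := by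
  refine ⟨by rcases h.1 with h | h <;> omega, ?_⟩
  filter_upwards [h.2] with θ hθ
  rw [rho_swap A B]; push_cast; linarith

lemma IsLeftSign.eq_neg_one {ε : ℤ} {t : ℝ} (h : IsLeftSign A B ε t)
    (h' : ∀ᶠ θ in 𝓝[<] t, rho A B θ < 0) : ε = -1 := by
  rcases h.1 with rfl | rfl
  · obtain ⟨θ, h1, h2⟩ := (h.2.and h').exists
    norm_num at h1
    exact absurd h1 h2.not_gt
  · rfl

namespace CirclePair

lemma right_neg_of_simple (hp : CirclePair A B φ) {t : ℝ}
    (h1 : (wr A B).rootMultiplicity (pt t) = 1) (h : ∀ᶠ θ in 𝓝[<] t, 0 < rho A B θ) :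
    ∀ᶠ θ in 𝓝[>] t, rho A B θ < 0 := by
  have := hp.eventually_right_of_left (Or.inl rfl) (by simpa using h)
  rw [h1] at this
  filter_upwards [this] with θ hθ
  linarith

/-- Without vertices the orientation cannot change, so the arc consists of regular points and stays
in the boundary of one face. -/
lemma arc_closure_face (hp : CirclePair A B φ) {Y : Set ℂ} (hY : IsFace A B Y) {a b : ℝ}
    (hab : a < b) (h : ∀ θ ∈ Ioo a b, (wr A B).eval (pt θ) ≠ 0)
    (h' : ∀ᶠ θ in 𝓝[>] a, 0 < rho A B θ ∧ pt θ ∈ closure Y) :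
    ∀ θ ∈ Ioo a b, 0 < rho A B θ ∧ pt θ ∈ closure Y := by
  have hpos := hp.rho_pos_of_right hab h (h'.mono fun _ h => h.1)
  have hsub := subset_closure_face hY (T := pt '' Ioo a b)
    (isPreconnected_Ioo.image _ continuous_pt.continuousOn)
    (by rintro _ ⟨θ, hθ, rfl⟩; exact hp.regPt_pt (hpos θ hθ)) (by
      obtain ⟨θ, h1, h2⟩ := (h'.and (Ioo_mem_nhdsGT hab)).exists
      exact ⟨_, ⟨θ, h2, rfl⟩, h1.2⟩)
  exact fun θ hθ => ⟨hpos θ hθ, hsub ⟨θ, hθ, rfl⟩⟩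

lemma track_of_no_vertex (hp : CirclePair A B φ) {Y : Set ℂ} (hY : IsFace A B Y) {W : Finset ℝ}
    {f : ℝ → ℤ} {a b : ℝ} (hab : a < b) (hba : b < a + 2 * Real.pi)
    (hW : ∀ t ∈ Ioo a b, t ∈ W ↔ (wr A B).eval (pt t) = 0)
    (he : (W.filter fun t => a < t ∧ t < b) = ∅)
    (h' : ∀ᶠ θ in 𝓝[>] a, 0 < rho A B θ ∧ pt θ ∈ closure Y) :
    Track A B Y (arcRegion A B a b) (φ a) (φ b - arcSum W f a b * (2 * Real.pi)) ∧
      ∀ᶠ θ in 𝓝[<] b, 0 < rho A B θ ∧ pt θ ∈ closure Y := by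
  have hW' : ∀ t ∈ W, t ∉ Ioo a b := fun t ht hti =>
    Finset.eq_empty_iff_forall_notMem.1 he t (Finset.mem_filter.2 ⟨ht, hti⟩)
  have h1 := hp.arc_closure_face hY hab (fun θ hθ h0 => hW' θ ((hW θ hθ).2 h0) hθ) h'
  rw [arcSum_eq_zero fun t ht hti => absurd hti (hW' t ht), Int.cast_zero, zero_mul, sub_zero]
  refine ⟨(hp.track_arc hab (by linarith) (fun θ hθ => (h1 θ hθ).1)
    (fun θ hθ => (h1 θ hθ).2)).mono subset_union_left, ?_⟩
  filter_upwards [Ioo_mem_nhdsLT hab] with θ hθ using h1 θ hθ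

/-- The part of the boundary of a face over an arc all of whose vertices are joined to each other
has the length which one expects from the turning number. -/
theorem track_of_matching {W : Finset ℝ} {τ : ℝ → ℝ} (N : ℕ) :
    ∀ {A B : ℂ[X]} {φ : ℝ → ℝ} (_ : CirclePair A B φ) {a b : ℝ} (_ : IsMatching A B W τ a b)
    (_ : ∀ t ∈ W, t ∈ Ioo a b → τ t ≠ t) {s : ℝ → ℤ}
    (_ : ∀ t ∈ W, t ∈ Ioo a b → τ t < t → IsLeftSign A B (s t) t) {Y : Set ℂ} (_ : IsFace A B Y)
    (_ : ∀ᶠ θ in 𝓝[>] a, 0 < rho A B θ ∧ pt θ ∈ closure Y)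
    (_ : (W.filter fun t => a < t ∧ t < b).card ≤ N),
    Track A B Y (arcRegion A B a b) (φ a) (φ b - arcSum W (later τ s) a b * (2 * Real.pi)) ∧
      ∀ᶠ θ in 𝓝[<] b, 0 < rho A B θ ∧ pt θ ∈ closure Y := by
  induction N with
  | zero =>
    intro A B φ hp a b hM _ s _ Y hY ha hN
    exact hp.track_of_no_vertex hY hM.lt hM.lt_add hM.mem_iff
      (Finset.card_eq_zero.1 (Nat.le_zero.1 hN)) ha
  | succ N ih =>
    intro A B φ hp a b hM hτ s hs Y hY ha hN
    rcases (W.filter fun t => a < t ∧ t < b).eq_empty_or_nonempty with he | hne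
    · exact hp.track_of_no_vertex hY hM.lt hM.lt_add hM.mem_iff he ha
    -- the first vertex
    set t₁ := (W.filter fun t => a < t ∧ t < b).min' hne with ht₁
    have hmin : ∀ t ∈ W, t ∈ Ioo a b → t₁ ≤ t := fun t ht hti =>
      Finset.min'_le _ _ (Finset.mem_filter.2 ⟨ht, hti⟩)
    obtain ⟨h1W, h1i⟩ := Finset.mem_filter.1 (Finset.min'_mem _ hne)
    change t₁ ∈ W at h1W
    change t₁ ∈ Ioo a b at h1i
    clear_value t₁
    have hn1 := hτ t₁ h1W h1i
    set t₂ := τ t₁ with ht₂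
    have h2W : t₂ ∈ W := hM.mem t₁ h1W h1i
    have h2i : t₂ ∈ Ioo a b := hM.mem_Ioo t₁ h1W h1i
    have h21 : τ t₂ = t₁ := hM.invol t₁ h1W h1i
    have h12 : t₁ < t₂ := lt_of_le_of_ne (hmin t₂ h2W h2i) hn1.symm
    have hab := hM.lt_add
    -- the arc before the first vertex
    have ha1 := hp.arc_closure_face hY h1i.1 (fun θ hθ h0 =>
      (hmin θ ((hM.mem_iff θ ⟨hθ.1, hθ.2.trans h1i.2⟩).2 h0) ⟨hθ.1, hθ.2.trans h1i.2⟩).not_gt hθ.2)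
      ha
    have tr1 := hp.track_arc h1i.1 (by linarith [h1i.2]) (fun θ hθ => (ha1 θ hθ).1)
      (fun θ hθ => (ha1 θ hθ).2)
    have hleft1 : ∀ᶠ θ in 𝓝[<] t₁, 0 < rho A B θ := by
      filter_upwards [Ioo_mem_nhdsLT h1i.1] with θ hθ using (ha1 θ hθ).1
    -- the chord
    obtain ⟨c, Y₁, hc, hc1, hY₁, hcY, hYl, huniq, hends⟩ :=
      hp.exists_chord_of_simple_left (hM.simple t₁ h1W h1i) hleft1
    have hYY : Y₁ = Y := by
      obtain ⟨θ, h1, h2⟩ := (hYl.and (Ioo_mem_nhdsLT h1i.1)).exists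
      exact (hp.regPt_pt (ha1 θ h2).1).face_eq hY₁ hY h1 (ha1 θ h2).2
    subst hYY
    have hc2 : pt t₂ ∈ closure c := by
      obtain ⟨c', hc', h1, h2⟩ := hM.joined h1W h1i hn1
      rwa [← huniq c' hc' h1]
    have huniq2 : ∀ c', IsDiscChord A B c' → pt t₂ ∈ closure c' → c' = c := by
      obtain ⟨c'', -, -, h3, -⟩ := hp.exists_chord_of_simple (hM.simple t₂ h2W h2i)
      exact fun c' hc' h => (h3 c' hc' h).trans (h3 c hc hc2).symm
    obtain ⟨ψ₀, ψ₁, χ, hχ⟩ := hp.exists_chordParam hc hc1 (norm_pt _)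
    obtain ⟨hχ0, hχ1⟩ := hends _ _ _ hχ
    have hp12 : pt t₂ ≠ pt t₁ := fun h =>
      h12.ne' (hM.pt_eq ⟨h2i.1.le, h2i.2.le⟩ ⟨h1i.1.le, h1i.2.le⟩ h)
    have hχ2 : χ ψ₁ = pt t₂ :=
      ((hχ.eq_end hc hc2 (norm_pt _)).resolve_left fun h => hp12 (h.trans hχ0)).symm
    have q0 := hχ.quo_eq _ (left_mem_Icc.2 hχ.lt.le)
    have q1 := hχ.quo_eq _ (right_mem_Icc.2 hχ.lt.le)
    rw [hχ0, hp.quo_pt] at q0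
    rw [hχ2, hp.quo_pt] at q1
    obtain ⟨n₀, hn₀⟩ := pt_eq_iff.1 q0
    obtain ⟨n₁, hn₁⟩ := pt_eq_iff.1 q1
    -- the arc under the chord
    have hM1 : IsMatching A B W τ t₁ t₂ := hM.restrict h1i.1.le h12 h2i.2.le fun t ht hti =>
      (hM.under hp h1W h1i ht hti.1 hti.2).2
    have hright1 := hp.right_neg_of_simple (hM.simple t₁ h1W h1i) hleft1
    obtain ⟨Y', γ', ε', hS', -⟩ := hp.swap.exists_sector_right le_rfl
      (by rw [rootMultiplicity_wr_swap, hM.simple t₁ h1W h1i])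
      (by simpa only [rho_swap A B, neg_pos] using hright1)
    obtain ⟨c', hc', -, htc', hcY'⟩ := hS'.exists_chord hp.swap
    have hcc : c' = c := huniq c' hc'.swap htc'
    subst hcc
    have hcard : ∀ x y, a ≤ x → y ≤ b → t₁ ≤ x →
        (W.filter fun t => x < t ∧ t < y).card ≤ N := fun x y hx hy h1x => by
      refine Nat.le_of_lt_succ ((Finset.card_lt_card ?_).trans_le hN)
      refine Finset.ssubset_iff_subset_ne.2 ⟨fun t ht => ?_, fun h => ?_⟩
      · obtain ⟨h1, h2, h3⟩ := Finset.mem_filter.1 ht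
        exact Finset.mem_filter.2 ⟨h1, hx.trans_lt h2, h3.trans_le hy⟩
      · have : t₁ ∈ W.filter fun t => x < t ∧ t < y := by
          rw [h]; exact Finset.mem_filter.2 ⟨h1W, h1i⟩
        exact absurd (Finset.mem_filter.1 this).2.1 h1x.not_gt
    have hi1 : Ioo t₁ t₂ ⊆ Ioo a b := Ioo_subset_Ioo h1i.1.le h2i.2.le
    have hi2 : Ioo t₂ b ⊆ Ioo a b := Ioo_subset_Ioo h2i.1.le le_rfl
    -- Under the chord the orientation is reversed, so the induction hypothesis is applied to the
    -- reciprocal quotient with all signs negated.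
    obtain ⟨tr2, hl2⟩ := ih hp.swap hM1.swap (fun t ht hti => hτ t ht (hi1 hti))
      (s := fun t => -s t) (fun t ht hti hlt => (hs t ht (hi1 hti) hlt).swap) hS'.face
      (by
        filter_upwards [hS'.side_right, hright1] with θ h1 h2
        exact ⟨by rw [rho_swap A B]; linarith, h1⟩) (hcard _ _ h1i.1.le h2i.2.le le_rfl)
    have hlater : later τ (fun t => -s t) = fun t => -later τ s t := by
      funext t; simp only [later]; split_ifs <;> simp
    rw [hlater, arcSum_neg] at tr2
    set R := arcSum W (later τ s) t₁ t₂ with hR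
    have hc'd : Disjoint c' (arcRegion B A t₁ t₂) :=
      disjoint_chord_arcRegion hc' hc1 (fun h => h.1.false) (by linarith [h1i.1, h2i.2])
        (by linarith [Real.pi_pos])
    have tr3 := (hχ.swap.track hp.swap hc' hcY').shift (-(n₁ + -R))
    have e3 : -ψ₁ + ((-(n₁ + -R) : ℤ) : ℝ) * (2 * Real.pi) =
        -φ t₂ - ((-R : ℤ) : ℝ) * (2 * Real.pi) := by
      push_cast; linear_combination hn₁
    rw [e3] at tr3
    have hle := (tr2.trans tr3 hc'd.symm).sub_le hp.swap hS'.face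
    have hlt := (tr2.trans tr3 hc'd.symm).lt
    -- The integers `n₀` and `n₁` compare the branches of the argument on the chord and on the arc
    -- at the two ends. The track under the chord followed by the chord backwards starts and ends at
    -- `pt t₁`, so its length is an integral number of turns; it is positive and at most one turn.
    have hturn : R - n₁ + n₀ = 1 := by
      have e4 : -ψ₀ + ((-(n₁ + -R) : ℤ) : ℝ) * (2 * Real.pi) =
        -φ t₁ + ((R - n₁ + n₀ : ℤ) : ℝ) * (2 * Real.pi) := by push_cast; linear_combination hn₀
      rw [e4] at hle hlt
      have hpi := Real.two_pi_pos
      have l1 : ((R - n₁ + n₀ : ℤ) : ℝ) ≤ (1 : ℤ) := by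
        rw [Int.cast_one]
        refine le_of_mul_le_mul_right ?_ hpi
        linarith
      have l2 : ((0 : ℤ) : ℝ) < ((R - n₁ + n₀ : ℤ) : ℝ) := by
        rw [Int.cast_zero]
        refine lt_of_mul_lt_mul_right ?_ hpi.le
        linarith
      have l3 := Int.cast_le.1 l1
      have l4 := Int.cast_lt.1 l2
      omega
    -- the arc after the chord
    have hleft2 : ∀ᶠ θ in 𝓝[<] t₂, 0 < rho B A θ := hl2.mono fun θ h => h.1
    have hright2 : ∀ᶠ θ in 𝓝[>] t₂, 0 < rho A B θ := by
      have := hp.swap.right_neg_of_simple ((rootMultiplicity_wr_swap _ _ _).trans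
        (hM.simple t₂ h2W h2i)) hleft2
      simpa only [rho_swap A B, neg_lt_zero] using this
    have hs2 : s t₂ = -1 := (hs t₂ h2W h2i (by rw [h21]; exact h12)).eq_neg_one
      (by simpa only [rho_swap A B, neg_pos] using hleft2)
    obtain ⟨Y₂, γ₂, ε₂, hS₂, -⟩ := hp.exists_sector_right le_rfl
      (by rw [hM.simple t₂ h2W h2i]) hright2
    obtain ⟨c₂, hc₂, -, htc₂, hcY₂⟩ := hS₂.exists_chord hp
    have hcc₂ : c₂ = c' := huniq2 c₂ hc₂ htc₂
    subst hcc₂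
    have hYY₂ : Y₂ = Y₁ := by
      obtain ⟨x, hx⟩ := hc.nonempty
      exact (hp.regPt_of_mem_discNet (hc.subset hx)).face_eq hS₂.face hY₁ (hcY₂ hx) (hcY hx)
    subst hYY₂
    -- A vertex after `t₂` joined to one before `t₂` would have its partner under the first chord,
    -- against `IsMatching.under`; `t₁` and `t₂` are joined to each other.
    have hM2 : IsMatching A B W τ t₂ b := hM.restrict h2i.1.le h2i.2 le_rfl fun t ht hti => by
      have hti' := hi2 hti
      have h3 := hM.mem t ht hti'
      have h4 := hM.mem_Ioo t ht hti'
      have h5 := hM.invol t ht hti'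
      have h6 : τ t ≠ t₁ := fun h => hti.1.ne (by rw [← h5, h])
      have h7 : τ t ≠ t₂ := fun h => (h12.trans hti.1).ne (by rw [← h5, h, h21])
      refine ⟨?_, h4.2⟩
      by_contra! hle
      have h8 := (hM.under hp h1W h1i h3 (lt_of_le_of_ne (hmin _ h3 h4) h6.symm)
        (lt_of_le_of_ne hle h7)).2
      rw [h5] at h8
      exact lt_asymm h8.2 hti.1
    obtain ⟨tr5, hl5⟩ := ih hp hM2 (fun t ht hti => hτ t ht (hi2 hti)) (s := s)
      (fun t ht hti hlt => hs t ht (hi2 hti) hlt) hY₁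
      (by filter_upwards [hS₂.side_right, hright2] with θ h1 h2 using ⟨h2, h1⟩)
      (hcard _ _ h2i.1.le le_rfl h12.le)
    refine ⟨?_, hl5⟩
    have tr4 := (hχ.track hp hc hcY).shift n₀
    have tr6 := tr5.shift (n₀ - n₁)
    rw [← hn₀] at tr4
    have e5 : φ t₂ + ((n₀ - n₁ : ℤ) : ℝ) * (2 * Real.pi) = ψ₁ + n₀ * (2 * Real.pi) := by
      push_cast; linear_combination hn₁
    rw [e5] at tr6
    have d1 : Disjoint (pt '' Ioo a t₁) c₂ := disjoint_arc_discNet hc.subset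
    have d2 : Disjoint c₂ (arcRegion A B t₂ b) :=
      disjoint_chord_arcRegion hc hc2 (fun h => h.1.false) (by linarith [h2i.1])
        (by linarith [Real.pi_pos])
    have d3 : Disjoint (pt '' Ioo a t₁) (arcRegion A B t₂ b) := by
      rw [Set.disjoint_left]
      rintro _ ⟨θ, hθ, rfl⟩ (h | ⟨c₃, hc₃, hz, -⟩)
      · exact pt_notMem_arc (fun h => lt_asymm h.1 (hθ.2.trans h12)) (by linarith [hθ.1])
          (by linarith [hθ.2, Real.pi_pos]) h
      · exact Set.disjoint_left.1 (disjoint_arc_discNet hc₃.subset) ⟨θ, hθ, rfl⟩ hz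
    have tr7 := (tr1.trans tr4 d1).trans tr6 (Set.disjoint_union_left.2 ⟨d3, d2⟩)
    -- The change of branch along the chord is `n₀ - n₁ = 1 - R`: the term `R` comes from the chords
    -- under it, and the `1` from its later end, where the sign is `-1`.
    have e6 : φ b - arcSum W (later τ s) t₂ b * (2 * Real.pi) +
        ((n₀ - n₁ : ℤ) : ℝ) * (2 * Real.pi) =
        φ b - arcSum W (later τ s) a b * (2 * Real.pi) := by
      have l1 : later τ s t₁ = 0 := if_neg h12.not_gt
      have l2 : later τ s t₂ = -1 := by rw [later, if_pos (by rw [h21]; exact h12), hs2]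
      have l3 : arcSum W (later τ s) a t₁ = 0 := arcSum_eq_zero fun t ht hti =>
        absurd hti.2 (hmin t ht ⟨hti.1, hti.2.trans h1i.2⟩).not_gt
      rw [arcSum_split h2i h2W, arcSum_split ⟨h1i.1, h12⟩ h1W, l1, l2, l3, ← hR]
      have : n₀ - n₁ = 1 - R := by omega
      rw [this]
      push_cast
      ring
    rw [e6] at tr7
    refine tr7.mono (union_subset (union_subset ?_ ?_) (arcRegion_mono h2i.1.le le_rfl))
    · exact (image_mono (Ioo_subset_Ioo le_rfl h1i.2.le)).trans subset_union_left
    · intro z hz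
      refine Or.inr ⟨_, hc, hz, fun v hv hv1 => ?_⟩
      rcases hc.eq_or_eq hp hc1 (norm_pt _) hc2 (norm_pt _) hp12.symm hv hv1 with rfl | rfl
      · exact ⟨_, h1i, rfl⟩
      · exact ⟨_, h2i, rfl⟩

end CirclePair

end CircleNet

/-! ### Bounds for the increment on an arc with simple vertices. -/

namespace CircleNet

open Set Filter Topology

variable {A B : ℂ[X]} {φ : ℝ → ℝ}

lemma disjoint_sector_arcRegion {t σ ε : ℝ} {Y : Set ℂ} {γ : ℝ → ℂ} (hp : CirclePair A B φ)
    (h : IsSector A B φ t σ Y γ ε) {a b : ℝ} (ht : t ∉ Ioo a b) (h1 : b - 2 * Real.pi ≤ t)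
    (h2 : t ≤ a + 2 * Real.pi) : Disjoint (γ '' Ioo 0 ε) (arcRegion A B a b) := by
  obtain ⟨c, hc, hγc, htc, -⟩ := h.exists_chord hp
  exact (disjoint_chord_arcRegion hc htc ht h1 h2).mono_left hγc

/-- The indicator function of the fixed points. -/
def fixed (τ : ℝ → ℝ) (t : ℝ) : ℤ := if τ t = t then 1 else 0

namespace CirclePair

lemma exists_face_right (hp : CirclePair A B φ) {a : ℝ} (h : ∀ᶠ θ in 𝓝[>] a, 0 < rho A B θ) :
    ∃ Y, IsFace A B Y ∧ ∀ᶠ θ in 𝓝[>] a, 0 < rho A B θ ∧ pt θ ∈ closure Y := by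
  obtain ⟨b, hb, hab⟩ := exists_gt_of_eventually h
  obtain ⟨θ₀, h0⟩ := nonempty_Ioo.2 hb
  obtain ⟨Y, hY, hθ⟩ := (hp.regPt_pt (hab θ₀ h0)).exists_face
  refine ⟨Y, hY, ?_⟩
  have hsub := subset_closure_face hY (T := pt '' Ioo a b)
    (isPreconnected_Ioo.image _ continuous_pt.continuousOn)
    (by rintro _ ⟨θ, hθ, rfl⟩; exact hp.regPt_pt (hab θ hθ)) ⟨_, ⟨θ₀, h0, rfl⟩, hθ⟩
  filter_upwards [Ioo_mem_nhdsGT hb] with θ hθ using ⟨hab θ hθ, hsub ⟨θ, hθ, rfl⟩⟩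

/-- The corrected increment is the length of a track, hence positive. At the end which is a vertex
the boundary of the same face continues for a while along a chord, so the length stays strictly
below one full turn. -/
theorem turning_of_matching {W : Finset ℝ} {τ : ℝ → ℝ} (hp : CirclePair A B φ) {a b : ℝ}
    (hM : IsMatching A B W τ a b) (hτ : ∀ t ∈ W, t ∈ Ioo a b → τ t ≠ t) {s : ℝ → ℤ}
    (hs : ∀ t ∈ W, t ∈ Ioo a b → τ t < t → IsLeftSign A B (s t) t)
    (hab : (wr A B).eval (pt a) = 0 ∨ (wr A B).eval (pt b) = 0)
    (ha : ∀ᶠ θ in 𝓝[>] a, 0 < rho A B θ) :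
    0 < φ b - φ a - arcSum W (later τ s) a b * (2 * Real.pi) ∧
      φ b - φ a - arcSum W (later τ s) a b * (2 * Real.pi) < 2 * Real.pi ∧
      ∀ᶠ θ in 𝓝[<] b, 0 < rho A B θ := by
  obtain ⟨Y, hY, haY⟩ := hp.exists_face_right ha
  obtain ⟨tr, hl⟩ := hp.track_of_matching _ hM hτ hs hY haY le_rfl
  set R := arcSum W (later τ s) a b
  have hlt := tr.lt
  have hba := hM.lt_add
  have hlt' := hM.lt
  refine ⟨by linarith, ?_, hl.mono fun θ h => h.1⟩
  rcases hab with h0 | h0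
  · have hm := (rootMultiplicity_pos hp.wr_ne_zero).2 h0
    obtain ⟨Y', γ, ε, hS, -⟩ := hp.exists_sector_right (by omega) rfl ha
    have hYY : Y' = Y := by
      obtain ⟨θ, h1, h2, h3⟩ := (hS.side_right.and haY).exists
      exact (hp.regPt_pt h2).face_eq hS.face hY h1 h3
    subst hYY
    have := ((hS.track_right hp).trans tr (disjoint_sector_arcRegion hp hS
      (fun h => h.1.false) (by linarith) (by linarith [Real.pi_pos]))).sub_le hp hY
    linarith [hS.pos]
  · have hm := (rootMultiplicity_pos hp.wr_ne_zero).2 h0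
    obtain ⟨Y', γ, ε, hS, -⟩ := hp.exists_sector_left (by omega) rfl (hl.mono fun θ h => h.1)
    have hYY : Y' = Y := by
      obtain ⟨θ, h1, h2, h3⟩ := (hS.side_left.and hl).exists
      exact (hp.regPt_pt h2).face_eq hS.face hY h1 h3
    subst hYY
    have tr' := (hS.track_left hp).shift (-R)
    rw [show φ b + ((-R : ℤ) : ℝ) * (2 * Real.pi) = φ b - R * (2 * Real.pi) by push_cast; ring]
      at tr'
    have := (tr.trans tr' (disjoint_sector_arcRegion hp hS
      (fun h => h.2.false) (by linarith [Real.pi_pos]) (by linarith)).symm).sub_le hp hY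
    push_cast at this
    linarith [hS.pos]

/-- With `M` unmatched vertices there are `M + 1` matched pieces, alternately orientation preserving
and reversing: `M / 2 + 1` of the former and `(M + 1) / 2` of the latter, with integer division.
Each contributes less than one turn, with its sign. Every piece has a vertex as an end, which
`turning_of_matching` requires. -/
theorem turning_bounds {W : Finset ℝ} {τ : ℝ → ℝ} (N : ℕ) :
    ∀ {A B : ℂ[X]} {φ : ℝ → ℝ} (_ : CirclePair A B φ) {a b : ℝ}
    (_ : IsMatching A B W τ a b) {s : ℝ → ℤ}
    (_ : ∀ t ∈ W, t ∈ Ioo a b → τ t < t → IsLeftSign A B (s t) t)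
    (_ : (wr A B).eval (pt a) = 0 ∨ (wr A B).eval (pt b) = 0)
    (_ : ∀ᶠ θ in 𝓝[>] a, 0 < rho A B θ)
    (_ : (W.filter fun t => a < t ∧ t < b).card ≤ N),
    -(((arcSum W (fixed τ) a b + 1) / 2 : ℤ) * (2 * Real.pi)) <
        φ b - φ a - arcSum W (later τ s) a b * (2 * Real.pi) ∧
      φ b - φ a - arcSum W (later τ s) a b * (2 * Real.pi) <
        ((arcSum W (fixed τ) a b / 2 + 1 : ℤ) * (2 * Real.pi)) := by
  induction N with
  | zero =>
    intro A B φ hp a b hM s hs hab ha hN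
    have he := Finset.card_eq_zero.1 (Nat.le_zero.1 hN)
    have hW : ∀ t ∈ W, t ∉ Ioo a b := fun t ht hti =>
      Finset.eq_empty_iff_forall_notMem.1 he t (Finset.mem_filter.2 ⟨ht, hti⟩)
    obtain ⟨h1, h2, -⟩ := hp.turning_of_matching hM (fun t ht hti => absurd hti (hW t ht)) hs hab ha
    rw [arcSum_eq_zero (f := fixed τ) fun t ht hti => absurd hti (hW t ht)]
    norm_num
    constructor <;> linarith
  | succ N ih =>
    intro A B φ hp a b hM s hs hab ha hN
    rcases (W.filter fun t => (a < t ∧ t < b) ∧ τ t = t).eq_empty_or_nonempty with he | hne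
    · have hW : ∀ t ∈ W, t ∈ Ioo a b → τ t ≠ t := fun t ht hti h =>
        Finset.eq_empty_iff_forall_notMem.1 he t (Finset.mem_filter.2 ⟨ht, hti, h⟩)
      obtain ⟨h1, h2, -⟩ := hp.turning_of_matching hM hW hs hab ha
      rw [arcSum_eq_zero (f := fixed τ) fun t ht hti => if_neg (hW t ht hti)]
      norm_num
      constructor <;> linarith
    set u := (W.filter fun t => (a < t ∧ t < b) ∧ τ t = t).min' hne with hu
    have hmin : ∀ t ∈ W, t ∈ Ioo a b → τ t = t → u ≤ t := fun t ht hti h =>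
      Finset.min'_le _ _ (Finset.mem_filter.2 ⟨ht, hti, h⟩)
    obtain ⟨huW, hui, hτu⟩ := Finset.mem_filter.1 (Finset.min'_mem _ hne)
    change u ∈ W at huW
    change u ∈ Ioo a b at hui
    change τ u = u at hτu
    clear_value u
    have hi1 : Ioo a u ⊆ Ioo a b := Ioo_subset_Ioo le_rfl hui.2.le
    have hi2 : Ioo u b ⊆ Ioo a b := Ioo_subset_Ioo hui.1.le le_rfl
    have hne' : ∀ t ∈ W, t ∈ Ioo a b → t ≠ u → τ t ≠ u := fun t ht hti h =>
      hM.apply_ne ht hti (by rw [hτu]; exact h.symm)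
    -- A chord passing over the unmatched vertex `u` would, by `IsMatching.under`, force `u` to be
    -- matched; so `u` cuts the matching in two.
    have hM1 : IsMatching A B W τ a u := hM.restrict le_rfl hui.1 hui.2.le fun t ht hti => by
      refine ⟨(hM.mem_Ioo t ht (hi1 hti)).1, ?_⟩
      by_contra! hle
      exact (hM.under hp ht (hi1 hti) huW hti.2
        (lt_of_le_of_ne hle (hne' t ht (hi1 hti) hti.2.ne).symm)).1 hτu
    have hM2 : IsMatching A B W τ u b := hM.restrict hui.1.le hui.2 le_rfl fun t ht hti => by
      have hti' := hi2 hti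
      refine ⟨?_, (hM.mem_Ioo t ht hti').2⟩
      by_contra! hle
      exact (hM.under hp (hM.mem t ht hti') (hM.mem_Ioo t ht hti') huW
        (lt_of_le_of_ne hle (hne' t ht hti' hti.1.ne'))
        (by rw [hM.invol t ht hti']; exact hti.1)).1 hτu
    have hu0 : (wr A B).eval (pt u) = 0 := (hM.mem_iff u hui).1 huW
    obtain ⟨h1, h2, h3⟩ := hp.turning_of_matching hM1
      (fun t ht hti h => (hmin t ht (hi1 hti) h).not_gt hti.2)
      (fun t ht hti => hs t ht (hi1 hti)) (Or.inr hu0) ha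
    have h4 := hp.right_neg_of_simple (hM.simple u huW hui) h3
    have hcard : (W.filter fun t => u < t ∧ t < b).card ≤ N := by
      refine Nat.le_of_lt_succ ((Finset.card_lt_card ?_).trans_le hN)
      refine Finset.ssubset_iff_subset_ne.2 ⟨fun t ht => ?_, fun h => ?_⟩
      · obtain ⟨h1, h2, h3⟩ := Finset.mem_filter.1 ht
        exact Finset.mem_filter.2 ⟨h1, hui.1.trans h2, h3⟩
      · have : u ∈ W.filter fun t => u < t ∧ t < b := by
          rw [h]; exact Finset.mem_filter.2 ⟨huW, hui⟩
        exact (Finset.mem_filter.1 this).2.1.false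
    obtain ⟨h5, h6⟩ := ih hp.swap hM2.swap (s := fun t => -s t)
      (fun t ht hti hlt => (hs t ht (hi2 hti) hlt).swap)
      (Or.inl (by rw [wr_swap, eval_neg, hu0, neg_zero]))
      (by simpa only [rho_swap A B, neg_pos] using h4) hcard
    have hlater : later τ (fun t => -s t) = fun t => -later τ s t := by
      funext t; simp only [later]; split_ifs <;> simp
    rw [hlater, arcSum_neg] at h5 h6
    have hM0 : arcSum W (fixed τ) a u = 0 := arcSum_eq_zero fun t ht hti =>
      if_neg fun h => (hmin t ht (hi1 hti) h).not_gt hti.2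
    rw [arcSum_split hui huW, arcSum_split hui huW, hM0,
      show fixed τ u = 1 from if_pos hτu, show later τ s u = 0 from if_neg (by rw [hτu]; simp)]
    set m := arcSum W (fixed τ) u b
    -- After `u` the reciprocal quotient is used, so the numbers of positive and negative pieces
    -- exchange their roles.
    have e1 : (0 + 1 + m + 1) / 2 = m / 2 + 1 := by omega
    have e2 : (0 + 1 + m) / 2 + 1 = (m + 1) / 2 + 1 := by omega
    rw [e1, e2]
    push_cast at h5 h6 ⊢
    constructor <;> linarith

end CirclePair

end CircleNet

/-! ### Arcs with a double vertex, and the sign before a vertex. -/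

namespace CircleNet

open Set Filter Topology

variable {A B : ℂ[X]} {φ : ℝ → ℝ}

/-- An arc with one double vertex `pt η`, all of whose chords leave the arc, and with simple vertices
otherwise. -/
structure IsDoubleArc (A B : ℂ[X]) (φ : ℝ → ℝ) (W : Finset ℝ) (α η β : ℝ) : Prop where
  pair : CirclePair A B φ
  mem : η ∈ Ioo α β
  lt_add : β < α + 2 * Real.pi
  mem_iff : ∀ t ∈ Ioo α β, t ∈ W ↔ (wr A B).eval (pt t) = 0
  simple : ∀ t ∈ W, t ∈ Ioo α β → t ≠ η → (wr A B).rootMultiplicity (pt t) = 1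
  double : (wr A B).rootMultiplicity (pt η) = 2
  outside : ∀ t ∈ W, t ∈ Ioo α β → t ≠ η → ¬ Joined A B η t

open Classical in
/-- The vertex of the arc to which a vertex is joined by a chord, if there is one. -/
def partner (A B : ℂ[X]) (W : Finset ℝ) (α β t : ℝ) : ℝ :=
  if h : ∃ t' ∈ W, t' ∈ Ioo α β ∧ t' ≠ t ∧ Joined A B t t' then h.choose else t

lemma partner_spec {W : Finset ℝ} {α β t : ℝ} (h : partner A B W α β t ≠ t) :
    partner A B W α β t ∈ W ∧ partner A B W α β t ∈ Ioo α β ∧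
      Joined A B t (partner A B W α β t) := by
  unfold partner at h ⊢
  split_ifs with h'
  · exact ⟨h'.choose_spec.1, h'.choose_spec.2.1, h'.choose_spec.2.2.2⟩
  · rw [dif_neg h'] at h; exact absurd rfl h

lemma partner_ne {W : Finset ℝ} {α β t t' : ℝ} (ht' : t' ∈ W) (hi : t' ∈ Ioo α β) (hne : t' ≠ t)
    (hj : Joined A B t t') : partner A B W α β t ≠ t := by
  have h : ∃ t' ∈ W, t' ∈ Ioo α β ∧ t' ≠ t ∧ Joined A B t t' := ⟨t', ht', hi, hne, hj⟩
  unfold partner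
  rw [dif_pos h]
  exact h.choose_spec.2.2.1

namespace IsDoubleArc

variable {W : Finset ℝ} {α η β : ℝ}

lemma joined_unique (h : IsDoubleArc A B φ W α η β) {t t' t'' : ℝ} (ht : t ∈ W) (hti : t ∈ Ioo α β)
    (hη : t ≠ η) (ht' : t' ∈ Ioo α β) (ht'' : t'' ∈ Ioo α β) (hne : t' ≠ t) (hne' : t'' ≠ t)
    (hj : Joined A B t t') (hj' : Joined A B t t'') : t' = t'' := by
  obtain ⟨c, hc, h1, h2⟩ := hj
  obtain ⟨c', hc', h1', h2'⟩ := hj'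
  obtain ⟨c₀, -, -, hu, -⟩ := h.pair.exists_chord_of_simple (h.simple t ht hti hη)
  have e : c' = c := (hu _ hc' h1').trans (hu _ hc h1).symm
  subst e
  have hinj : ∀ x ∈ Ioo α β, ∀ y ∈ Ioo α β, pt x = pt y → x = y := fun x hx y hy hxy =>
    pt_injOn (by rw [abs_lt]; constructor <;> linarith [hx.1, hx.2, hy.1, hy.2, h.lt_add]) hxy
  rcases hc.eq_or_eq h.pair h1 (norm_pt _) h2 (norm_pt _) (fun e => hne (hinj _ ht' _ hti e.symm))
    h2' (norm_pt _) with e | e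
  · exact absurd (hinj _ ht'' _ hti e) hne'
  · exact (hinj _ ht'' _ ht' e).symm

lemma partner_eq (h : IsDoubleArc A B φ W α η β) {t t' : ℝ} (ht : t ∈ W) (hti : t ∈ Ioo α β)
    (hη : t ≠ η) (ht' : t' ∈ W) (hti' : t' ∈ Ioo α β) (hne : t' ≠ t) (hj : Joined A B t t') :
    partner A B W α β t = t' := by
  have h1 := partner_ne ht' hti' hne hj
  obtain ⟨h2, h3, h4⟩ := partner_spec h1
  exact h.joined_unique ht hti hη h3 hti' h1 hne h4 hj

lemma partner_double (h : IsDoubleArc A B φ W α η β) : partner A B W α β η = η := by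
  by_contra h1
  obtain ⟨h2, h3, h4⟩ := partner_spec h1
  exact h.outside _ h2 h3 h1 h4

lemma eval_double (h : IsDoubleArc A B φ W α η β) : (wr A B).eval (pt η) = 0 :=
  (rootMultiplicity_pos h.pair.wr_ne_zero).1 (by rw [h.double]; norm_num)

/-- No chord with both ends in the arc separates the double vertex from the rest of the circle. -/
lemma not_joined_across (h : IsDoubleArc A B φ W α η β) {t t' : ℝ} (ht : t ∈ Ioo α β)
    (ht' : t' ∈ Ioo α β) (h1 : t < η) (h2 : η < t') : ¬ Joined A B t t' := by
  intro hj
  -- The double vertex has a chord which is not a loop. A chord passing over it would confine the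
  -- other end to the arc, which `outside` forbids.
  obtain ⟨d, hd, hηd, v, hv, hv1, hvη⟩ := h.pair.exists_chord_of_isVertex h.eval_double
  obtain ⟨θ, hθ, rfl⟩ := h.pair.mem_arc_of_joined hj h1 h2 hd hηd hv hv1
  have hθi : θ ∈ Ioo α β := ⟨ht.1.trans_le hθ.1, hθ.2.trans_lt ht'.2⟩
  exact h.outside θ ((h.mem_iff θ hθi).2 (hd.isVertex h.pair hv)) hθi
    (fun h0 => hvη (by rw [h0])) ⟨d, hd, hηd, hv⟩

lemma partner_mem (h : IsDoubleArc A B φ W α η β) {t : ℝ} (ht : t ∈ W) (hti : t ∈ Ioo α β) :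
    partner A B W α β t ∈ W ∧ partner A B W α β t ∈ Ioo α β ∧
      (t < η → partner A B W α β t < η) ∧ (η < t → η < partner A B W α β t) := by
  by_cases h1 : partner A B W α β t = t
  · rw [h1]; exact ⟨ht, hti, id, id⟩
  obtain ⟨h2, h3, h4⟩ := partner_spec h1
  have hne : t ≠ η → partner A B W α β t ≠ η := fun hη h0 =>
    h.outside t ht hti hη (h0 ▸ h4).symm
  refine ⟨h2, h3, fun hlt => ?_, fun hlt => ?_⟩
  · by_contra! hle
    exact h.not_joined_across hti h3 hlt (lt_of_le_of_ne hle (hne hlt.ne).symm) h4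
  · by_contra! hle
    exact h.not_joined_across h3 hti (lt_of_le_of_ne hle (hne hlt.ne')) hlt h4.symm

lemma partner_partner (h : IsDoubleArc A B φ W α η β) {t : ℝ} (ht : t ∈ W) (hti : t ∈ Ioo α β) :
    partner A B W α β (partner A B W α β t) = t := by
  by_cases h1 : partner A B W α β t = t
  · rw [h1, h1]
  have hη : t ≠ η := fun h0 => h1 (by rw [h0, h.partner_double])
  obtain ⟨h2, h3, h4⟩ := partner_spec h1
  refine h.partner_eq h2 h3 (fun h0 => ?_) ht hti (Ne.symm h1) h4.symm
  exact h.outside t ht hti hη (h0 ▸ h4).symm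

lemma isMatching (h : IsDoubleArc A B φ W α η β) {a b : ℝ} (hab : a < b) (ha : α ≤ a) (hb : b ≤ β)
    (hη : η ∉ Ioo a b) (hm : ∀ t ∈ W, t ∈ Ioo a b → partner A B W α β t ∈ Ioo a b) :
    IsMatching A B W (partner A B W α β) a b :=
  have hs : Ioo a b ⊆ Ioo α β := Ioo_subset_Ioo ha hb
  have hne : ∀ t ∈ Ioo a b, t ≠ η := fun t ht h0 => hη (h0 ▸ ht)
  { lt := hab
    lt_add := by linarith [h.lt_add]
    mem_iff := fun t ht => h.mem_iff t (hs ht)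
    simple := fun t ht hti => h.simple t ht (hs hti) (hne t hti)
    mem := fun t ht hti => (h.partner_mem ht (hs hti)).1
    mem_Ioo := hm
    invol := fun t ht hti => h.partner_partner ht (hs hti)
    joined_iff := fun t ht hti t' ht' hti' htt' =>
      ⟨fun hj => h.partner_eq ht (hs hti) (hne t hti) ht' (hs hti') htt'.symm hj,
        fun e => e ▸ (partner_spec (by rw [e]; exact htt'.symm)).2.2⟩ }

lemma isMatching_left (h : IsDoubleArc A B φ W α η β) :
    IsMatching A B W (partner A B W α β) α η :=
  h.isMatching h.mem.1 le_rfl h.mem.2.le (fun h => h.2.false) fun _ ht hti =>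
    have := h.partner_mem ht ⟨hti.1, hti.2.trans h.mem.2⟩
    ⟨this.2.1.1, this.2.2.1 hti.2⟩

lemma isMatching_right (h : IsDoubleArc A B φ W α η β) :
    IsMatching A B W (partner A B W α β) η β :=
  h.isMatching h.mem.2 h.mem.1.le le_rfl (fun h => h.1.false) fun _ ht hti =>
    have := h.partner_mem ht ⟨h.mem.1.trans hti.1, hti.2⟩
    ⟨this.2.2.2 hti.1, this.2.1.2⟩

end IsDoubleArc

/-- The number of points of a finite set before `t` and after `α`, counted with multiplicity. -/
def countBefore (W : Finset ℝ) (m : ℝ → ℕ) (α t : ℝ) : ℕ := ∑ u ∈ W with α < u ∧ u < t, m u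

/-- The orientation is positive after `α` and is multiplied by `(-1)` to the multiplicity at each
vertex. The induction removes the last vertex before `t`. -/
lemma CirclePair.isLeftSign_count (hp : CirclePair A B φ) {W : Finset ℝ} {α β : ℝ}
    (hW : ∀ t ∈ Ioo α β, t ∈ W ↔ (wr A B).eval (pt t) = 0)
    (hα : ∀ᶠ θ in 𝓝[>] α, 0 < rho A B θ) (N : ℕ) : ∀ t, α < t → t ≤ β →
    (W.filter fun u => α < u ∧ u < t).card ≤ N →
    IsLeftSign A B ((-1) ^ countBefore W (fun u => (wr A B).rootMultiplicity (pt u)) α t) t := by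
  have hempty : ∀ t, α < t → t ≤ β → (W.filter fun u => α < u ∧ u < t) = ∅ →
      IsLeftSign A B
        ((-1) ^ countBefore W (fun u => (wr A B).rootMultiplicity (pt u)) α t) t := by
    intro t h1 h2 he
    rw [countBefore, he, Finset.sum_empty, pow_zero]
    have := hp.rho_pos_of_right h1 (fun θ hθ h0 =>
      Finset.eq_empty_iff_forall_notMem.1 he θ (Finset.mem_filter.2
        ⟨(hW θ ⟨hθ.1, hθ.2.trans_le h2⟩).2 h0, hθ⟩)) hα
    refine ⟨Or.inl rfl, ?_⟩
    filter_upwards [Ioo_mem_nhdsLT h1] with θ hθ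
    simpa using this θ hθ
  induction N with
  | zero => exact fun t h1 h2 hN => hempty t h1 h2 (Finset.card_eq_zero.1 (Nat.le_zero.1 hN))
  | succ N ih =>
    intro t h1 h2 hN
    rcases (W.filter fun u => α < u ∧ u < t).eq_empty_or_nonempty with he | hne
    · exact hempty t h1 h2 he
    set u := (W.filter fun u => α < u ∧ u < t).max' hne with hu
    have hmax : ∀ v ∈ W, α < v → v < t → v ≤ u := fun v hv h3 h4 =>
      Finset.le_max' _ _ (Finset.mem_filter.2 ⟨hv, h3, h4⟩)
    obtain ⟨huW, hu1, hu2⟩ := Finset.mem_filter.1 (Finset.max'_mem _ hne)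
    change u ∈ W at huW
    change α < u at hu1
    change u < t at hu2
    clear_value u
    have hins : (W.filter fun v => α < v ∧ v < t) = insert u (W.filter fun v => α < v ∧ v < u) := by
      ext v
      simp only [Finset.mem_filter, Finset.mem_insert]
      constructor
      · rintro ⟨h3, h4, h5⟩
        rcases (hmax v h3 h4 h5).eq_or_lt with h6 | h6
        · exact Or.inl h6
        · exact Or.inr ⟨h3, h4, h6⟩
      · rintro (rfl | ⟨h3, h4, h5⟩)
        · exact ⟨huW, hu1, hu2⟩
        · exact ⟨h3, h4, h5.trans hu2⟩
    have hnot : u ∉ W.filter fun v => α < v ∧ v < u := fun h =>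
      (Finset.mem_filter.1 h).2.2.false
    rw [hins, Finset.card_insert_of_notMem hnot] at hN
    have hS := ih u hu1 (hu2.le.trans h2) (by omega)
    have hε : ∀ k : ℕ, ((-1 : ℝ) ^ k = 1 ∨ (-1 : ℝ) ^ k = -1) := fun k => neg_one_pow_eq_or ℝ k
    have hS2 := hS.2
    push_cast at hS2
    have hr := hp.eventually_right_of_left (hε _) hS2
    rw [← pow_add] at hr
    have hcount : countBefore W (fun u => (wr A B).rootMultiplicity (pt u)) α t =
        countBefore W (fun u => (wr A B).rootMultiplicity (pt u)) α u +
          (wr A B).rootMultiplicity (pt u) := by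
      rw [countBefore, hins, Finset.sum_insert hnot, countBefore, add_comm]
    rw [← hcount] at hr
    refine ⟨neg_one_pow_eq_or ℤ _, ?_⟩
    push_cast
    have hno : ∀ θ ∈ Ioo u t, (wr A B).eval (pt θ) ≠ 0 := fun θ hθ h0 =>
      (hmax θ ((hW θ ⟨hu1.trans hθ.1, hθ.2.trans_le h2⟩).2 h0) (hu1.trans hθ.1) hθ.2).not_gt hθ.1
    have hpn := hp.rho_pos_or_neg hno
    obtain ⟨θ₀, h3, h4⟩ := (hr.and (Ioo_mem_nhdsGT hu2)).exists
    filter_upwards [Ioo_mem_nhdsLT hu2] with θ hθ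
    rcases hε (countBefore W (fun u => (wr A B).rootMultiplicity (pt u)) α t) with e | e <;>
      rw [e] at h3 ⊢ <;> rcases hpn with h5 | h5 <;> have h6 := h5 θ₀ h4 <;> have h7 := h5 θ hθ <;>
      linarith

end CircleNet

/-! ### Counting labels and adding the bounds for the two halves. -/

namespace CircleNet

open Set Filter Topology

variable {A B : ℂ[X]} {φ : ℝ → ℝ} {W : Finset ℝ} {α η β : ℝ}

lemma arcSum_congr {f g : ℝ → ℤ} {a b : ℝ} (h : ∀ t ∈ W, t ∈ Ioo a b → f t = g t) :
    arcSum W f a b = arcSum W g a b :=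
  Finset.sum_congr rfl fun t ht => h t (Finset.mem_filter.1 ht).1 (Finset.mem_filter.1 ht).2

lemma arcSum_add {f g : ℝ → ℤ} {a b : ℝ} :
    arcSum W (fun t => f t + g t) a b = arcSum W f a b + arcSum W g a b :=
  Finset.sum_add_distrib

lemma arcSum_one {a b : ℝ} :
    arcSum W (fun _ => 1) a b = ({t | t ∈ Ioo a b ∧ t ∈ W}.ncard : ℤ) := by
  have : {t | t ∈ Ioo a b ∧ t ∈ W} = ((W.filter fun t => a < t ∧ t < b : Finset ℝ) : Set ℝ) := by
    ext t; simp [and_comm]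
  rw [this, Set.ncard_coe_finset, arcSum]
  simp

open Classical in
lemma arcSum_ite {a b : ℝ} {P : ℝ → Prop} :
    arcSum W (fun t => if P t then 1 else 0) a b = ({t | t ∈ Ioo a b ∧ t ∈ W ∧ P t}.ncard : ℤ) := by
  have : {t | t ∈ Ioo a b ∧ t ∈ W ∧ P t} =
      (((W.filter fun t => a < t ∧ t < b).filter P : Finset ℝ) : Set ℝ) := by
    ext t; simp; tauto
  rw [this, Set.ncard_coe_finset, arcSum, Finset.sum_ite]
  simp

/-- Half of the vertices which are matched are later ends of chords. -/
lemma IsMatching.count {τ : ℝ → ℝ} {a b : ℝ} (h : IsMatching A B W τ a b) :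
    arcSum W (fun _ => 1) a b = arcSum W (fixed τ) a b + 2 * arcSum W (later τ fun _ => 1) a b := by
  -- The involution exchanges the earlier and the later ends of the chords.
  have e : arcSum W (fun t => if t < τ t then 1 else 0) a b =
      arcSum W (later τ fun _ => 1) a b := by
    unfold arcSum
    have hm : ∀ t ∈ W.filter (fun t => a < t ∧ t < b), τ t ∈ W.filter (fun t => a < t ∧ t < b) :=
      fun t ht => by
        obtain ⟨h1, h2⟩ := Finset.mem_filter.1 ht
        exact Finset.mem_filter.2 ⟨h.mem t h1 h2, h.mem_Ioo t h1 h2⟩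
    have hi : ∀ t ∈ W.filter (fun t => a < t ∧ t < b), τ (τ t) = t := fun t ht => by
      obtain ⟨h1, h2⟩ := Finset.mem_filter.1 ht
      exact h.invol t h1 h2
    refine Finset.sum_nbij' τ τ hm hm hi hi fun t ht => ?_
    rw [later, hi t ht]
  rw [two_mul, ← add_assoc]
  nth_rewrite 1 [← e]
  rw [← arcSum_add, ← arcSum_add]
  refine arcSum_congr fun t _ _ => ?_
  rcases lt_trichotomy (τ t) t with h | h | h
  · simp [fixed, later, h, h.ne, h.not_gt]
  · simp [fixed, later, h]
  · simp [fixed, later, h, h.ne', h.not_gt]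

lemma IsDoubleArc.partner_lt_iff (h : IsDoubleArc A B φ W α η β) {t : ℝ} (ht : t ∈ W)
    (hti : t ∈ Ioo α β) :
    (∃ t' ∈ Ioo α t, Joined A B t t') ↔ partner A B W α β t < t := by
  constructor
  · rintro ⟨t', ht', hj⟩
    have hti' : t' ∈ Ioo α β := ⟨ht'.1, ht'.2.trans hti.2⟩
    have htW : t' ∈ W := (h.mem_iff t' hti').2 (by
      obtain ⟨c, hc, -, h2⟩ := hj; exact hc.isVertex h.pair h2)
    by_cases hη : t = η
    · subst hη
      exact absurd hj (h.outside t' htW hti' ht'.2.ne)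
    · rw [h.partner_eq ht hti hη htW hti' ht'.2.ne hj]
      exact ht'.2
  · intro hlt
    obtain ⟨-, h2, h3⟩ := partner_spec hlt.ne
    exact ⟨_, ⟨h2.1, hlt⟩, h3⟩

/-- The bounds for the increment of the argument of the quotient on an arc with one double
vertex. -/
theorem IsDoubleArc.increment_mem (h : IsDoubleArc A B φ W α η β)
    (hα : ∀ᶠ θ in 𝓝[>] α, 0 < rho A B θ) {n O E : ℕ} {c : ℝ → ℕ}
    (hc : c = countBefore W (fun u => (wr A B).rootMultiplicity (pt u)) α) (hn : n = c β)
    (hO : O = {t | t ∈ Ioo α β ∧ t ∈ W ∧ (∃ t' ∈ Ioo α t, Joined A B t t') ∧ Even (c t)}.ncard)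
    (hE : E = {t | t ∈ Ioo α β ∧ t ∈ W ∧ (∃ t' ∈ Ioo α t, Joined A B t t') ∧ ¬Even (c t)}.ncard)
    {k : ℕ} (hk : k = {t | t ∈ Ioo α η ∧ t ∈ W}.ncard) :
    (Odd k → φ β - φ α ∈ Ioo (((((n + 1) % 2 : ℕ) : ℝ) - n + 4 * O - 1) * Real.pi)
      (((((n + 1) % 2 : ℕ) : ℝ) + n - 4 * E - 1) * Real.pi)) ∧
    (Even k → φ β - φ α ∈ Ioo (((((n + 1) % 2 : ℕ) : ℝ) - n + 4 * O + 1) * Real.pi)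
      (((((n + 1) % 2 : ℕ) : ℝ) + n - 4 * E + 1) * Real.pi)) := by
  classical
  have hp := h.pair
  set τ := partner A B W α β with hτ
  set s : ℝ → ℤ := fun t => (-1) ^ c t with hs
  have hηW : η ∈ W := (h.mem_iff η h.mem).2 h.eval_double
  have hi1 : Ioo α η ⊆ Ioo α β := Ioo_subset_Ioo le_rfl h.mem.2.le
  have hi2 : Ioo η β ⊆ Ioo α β := Ioo_subset_Ioo h.mem.1.le le_rfl
  have hM1 := h.isMatching_left
  have hM2 := h.isMatching_right
  have hsign : ∀ t, α < t → t ≤ β → IsLeftSign A B (s t) t := fun t h1 h2 => by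
    rw [hs, hc]; exact hp.isLeftSign_count h.mem_iff hα _ t h1 h2 le_rfl
  -- counting
  have hηlater : ∀ s, later τ s η = 0 := fun s => if_neg (by rw [hτ, h.partner_double]; simp)
  have hO' : (O : ℤ) = arcSum W (fun t => if τ t < t ∧ Even (c t) then 1 else 0) α β := by
    rw [hO, ← arcSum_ite]
    exact arcSum_congr fun t ht hti => by simp only [h.partner_lt_iff ht hti, hτ]
  have hE' : (E : ℤ) = arcSum W (fun t => if τ t < t ∧ ¬Even (c t) then 1 else 0) α β := by
    rw [hE, ← arcSum_ite]
    exact arcSum_congr fun t ht hti => by simp only [h.partner_lt_iff ht hti, hτ]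
  have hOE : (O : ℤ) + E = arcSum W (later τ fun _ => 1) α β := by
    rw [hO', hE', ← arcSum_add]
    refine arcSum_congr fun t _ _ => ?_
    by_cases h1 : τ t < t <;> by_cases h2 : Even (c t) <;> simp [later, h1, h2]
  -- The label of `t` is `c t + 1`, so an odd label means an even `c t`, hence the sign `+1`: the
  -- signed sum over later ends is `O - E`.
  have hOE' : (O : ℤ) = E + arcSum W (later τ s) α β := by
    rw [hO', hE', ← arcSum_add]
    refine arcSum_congr fun t _ _ => ?_
    by_cases h1 : τ t < t <;> by_cases h2 : Even (c t)
    · simp [later, hs, h1, h2, h2.neg_one_pow]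
    · simp [later, hs, h1, h2, (Nat.not_even_iff_odd.1 h2).neg_one_pow]
    · simp [later, h1]
    · simp [later, h1]
  rw [arcSum_split h.mem hηW, hηlater] at hOE hOE'
  have hm1 : arcSum W (fun t => ((wr A B).rootMultiplicity (pt t) : ℤ)) α η =
      arcSum W (fun _ => 1) α η := arcSum_congr fun t ht hti => by
    rw [h.simple t ht (hi1 hti) hti.2.ne, Nat.cast_one]
  have hm2 : arcSum W (fun t => ((wr A B).rootMultiplicity (pt t) : ℤ)) η β =
      arcSum W (fun _ => 1) η β := arcSum_congr fun t ht hti => by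
    rw [h.simple t ht (hi2 hti) hti.1.ne', Nat.cast_one]
  have hn' : (n : ℤ) = arcSum W (fun _ => 1) α η + 2 + arcSum W (fun _ => 1) η β := by
    rw [← hm1, ← hm2]
    have e : (n : ℤ) = arcSum W (fun t => ((wr A B).rootMultiplicity (pt t) : ℤ)) α β := by
      rw [hn, hc, countBefore, arcSum]; push_cast; rfl
    rw [e, arcSum_split h.mem hηW, h.double, Nat.cast_ofNat]
  have hck : c η = k := by
    have e : (c η : ℤ) = arcSum W (fun t => ((wr A B).rootMultiplicity (pt t) : ℤ)) α η := by
      rw [hc, countBefore, arcSum]; push_cast; rfl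
    rw [hm1, arcSum_one, ← hk] at e
    exact_mod_cast e
  have hk' : (k : ℤ) = arcSum W (fun _ => 1) α η := by rw [arcSum_one, hk]
  rw [← hk', hM2.count] at hn'
  rw [hM1.count] at hk'
  -- the two parts of the arc
  obtain ⟨b1, b2⟩ := hp.turning_bounds _ hM1
    (fun t ht hti _ => hsign t hti.1 (hti.2.trans h.mem.2).le) (Or.inr h.eval_double) hα le_rfl
  -- The even multiplicity of the double vertex leaves the sign `(-1) ^ k` unchanged, so the parity
  -- of `k` is the orientation with which the second half starts.
  have hη := hp.eventually_right_of_left (t := η) (ε := (-1) ^ k) (neg_one_pow_eq_or ℝ _) (by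
    have := (hsign η h.mem.1 h.mem.2.le).2
    rw [hs] at this
    simpa [hck] using this)
  rw [h.double, neg_one_sq, mul_one] at hη
  obtain ⟨e, he⟩ : ∃ e : ℕ, e = (n + 1) % 2 := ⟨_, rfl⟩
  rw [← he]
  set M₁ := arcSum W (fixed τ) α η
  set M₂ := arcSum W (fixed τ) η β
  set K₁ := arcSum W (later τ fun _ => 1) α η
  set K₂ := arcSum W (later τ fun _ => 1) η β
  set R₁ := arcSum W (later τ s) α η with hR₁
  set R₂ := arcSum W (later τ s) η β with hR₂
  have hpi := Real.pi_pos
  constructor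
  · intro hkodd
    rw [hkodd.neg_one_pow] at hη
    obtain ⟨b3, b4⟩ := hp.swap.turning_bounds _ hM2.swap (s := fun t => -s t)
      (fun t ht hti _ => (hsign t (h.mem.1.trans hti.1) hti.2.le).swap)
      (Or.inl (by rw [wr_swap, eval_neg, h.eval_double, neg_zero]))
      (by simpa [rho_swap A B] using hη) le_rfl
    have hlater : later τ (fun t => -s t) = fun t => -later τ s t := by
      funext t; simp only [later]; split_ifs <;> simp
    rw [hlater, arcSum_neg, ← hR₂] at b3 b4
    obtain ⟨j, hj⟩ := hkodd
    -- The bounds of the halves add up to those claimed: `M₁` has the parity of `k`, and `M₁ + M₂`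
    -- that of `n`, which `e` records; this resolves the integer divisions by two.
    have i1 : (e : ℤ) - n + 4 * O - 1 = 2 * (R₁ + R₂ - (M₁ + 1) / 2 - (M₂ / 2 + 1)) := by omega
    have i2 : (e : ℤ) + n - 4 * E - 1 = 2 * (R₁ + R₂ + (M₁ / 2 + 1) + (M₂ + 1) / 2) := by omega
    have j1 := congrArg (Int.cast : ℤ → ℝ) i1
    have j2 := congrArg (Int.cast : ℤ → ℝ) i2
    push_cast at j1 j2 b1 b2 b3 b4
    rw [j1, j2]
    constructor <;> linarith
  · intro hkeven
    rw [hkeven.neg_one_pow] at hη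
    obtain ⟨b3, b4⟩ := hp.turning_bounds _ hM2 (s := s)
      (fun t ht hti _ => hsign t (h.mem.1.trans hti.1) hti.2.le)
      (Or.inl h.eval_double) (by simpa using hη) le_rfl
    obtain ⟨j, hj⟩ := hkeven
    have i1 : (e : ℤ) - n + 4 * O + 1 = 2 * (R₁ + R₂ - (M₁ + 1) / 2 - (M₂ + 1) / 2) := by omega
    have i2 : (e : ℤ) + n - 4 * E + 1 = 2 * (R₁ + R₂ + (M₁ / 2 + 1) + (M₂ / 2 + 1)) := by omega
    have j1 := congrArg (Int.cast : ℤ → ℝ) i1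
    have j2 := congrArg (Int.cast : ℤ → ℝ) i2
    push_cast at j1 j2 b1 b2 b3 b4
    rw [j1, j2]
    constructor <;> linarith

end CircleNet

/-! ### The lift of the argument, and the reduction to lowest terms. -/

namespace CircleNet

open Set Filter Topology

lemma hasDerivAt_pt (θ : ℝ) : HasDerivAt pt (pt θ * Complex.I) θ := by
  have := ((hasDerivAt_id θ).ofReal_comp.mul_const Complex.I).cexp
  simp only [id, Complex.ofReal_one, one_mul] at this
  exact this

/-- The argument of a quotient of polynomials of equal absolute values on the unit circle. -/
theorem exists_lift {P Q : ℂ[X]} (hP : ∀ θ, P.eval (pt θ) ≠ 0) (hQ : ∀ θ, Q.eval (pt θ) ≠ 0)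
    (hPQ : ∀ θ, ‖P.eval (pt θ)‖ = ‖Q.eval (pt θ)‖) :
    ∃ φ : ℝ → ℝ, (∀ θ, HasDerivAt φ (rho P Q θ) θ) ∧
      ∀ θ, P.eval (pt θ) = Q.eval (pt θ) * pt (φ θ) := by
  set F : ℝ → ℂ := fun θ => P.eval (pt θ) / Q.eval (pt θ) with hF
  set h : ℝ → ℂ := fun θ => pt θ * (wr P Q).eval (pt θ) / (P.eval (pt θ) * Q.eval (pt θ)) with hh
  have hF1 : ∀ θ, ‖F θ‖ = 1 := fun θ => by
    rw [hF]; beta_reduce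
    rw [norm_div, hPQ, div_self (norm_ne_zero_iff.2 (hQ θ))]
  have hF' : ∀ θ, HasDerivAt F (F θ * (h θ * Complex.I)) θ := fun θ => by
    have h1 : HasDerivAt (fun θ => P.eval (pt θ)) _ θ :=
      (P.hasDerivAt (pt θ)).comp θ (hasDerivAt_pt θ)
    have h2 : HasDerivAt (fun θ => Q.eval (pt θ)) _ θ :=
      (Q.hasDerivAt (pt θ)).comp θ (hasDerivAt_pt θ)
    refine (h1.div h2 (hQ θ)).congr_deriv ?_
    have := hP θ
    have := hQ θ
    simp only [hF, hh, wr, eval_sub, eval_mul]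
    field_simp
  -- The squared modulus of `F` is constant, and its derivative is a multiple of the imaginary part
  -- of `h`.
  have hreal : ∀ θ, h θ = rho P Q θ := fun θ => by
    have h1 := (hF' θ).norm_sq
    have h2 : (fun θ => ‖F θ‖ ^ 2) = fun _ => (1 : ℝ) := by funext θ; rw [hF1, one_pow]
    have h3 : HasDerivAt (fun θ => ‖F θ‖ ^ 2) 0 θ := by rw [h2]; exact hasDerivAt_const _ _
    have h4 := h1.unique h3
    rw [Complex.inner, show ∀ x y : ℂ, x * y * (starRingEnd ℂ) x = (starRingEnd ℂ) x * x * y from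
      fun x y => by ring, ← Complex.normSq_eq_conj_mul_self,
      Complex.normSq_eq_norm_sq, hF1] at h4
    have h5 : (h θ).im = 0 := by simpa using h4
    exact Complex.ext rfl (by rw [h5]; rfl)
  have hrc : Continuous (rho P Q) := by
    have hpc := continuous_pt
    have : Continuous h := by
      refine Continuous.div ?_ ?_ fun θ => mul_ne_zero (hP θ) (hQ θ)
      · exact hpc.mul ((wr P Q).continuous.comp hpc)
      · exact (P.continuous.comp hpc).mul (Q.continuous.comp hpc)
    exact Complex.continuous_re.comp this
  obtain ⟨a, ha⟩ := exists_pt_eq (hF1 0)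
  set φ : ℝ → ℝ := fun θ => a + ∫ x in (0 : ℝ)..θ, rho P Q x with hφ
  have hφ' : ∀ θ, HasDerivAt φ (rho P Q θ) θ := fun θ =>
    (hrc.integral_hasStrictDerivAt 0 θ).hasDerivAt.const_add a
  refine ⟨φ, hφ', fun θ => ?_⟩
  -- The integral of `rho` is the argument up to its value at `0`: the product of `F` with `exp (-i
  -- φ)` has derivative zero and equals `1` at `0`.
  set G : ℝ → ℂ := fun θ => F θ * pt (-φ θ) with hG
  have hG' : ∀ θ, HasDerivAt G 0 θ := fun θ => by
    have h1 : HasDerivAt (pt ∘ (-φ)) _ θ :=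
      HasDerivAt.scomp θ (hasDerivAt_pt (-φ θ)) (hφ' θ).neg
    refine ((hF' θ).mul h1).congr_deriv ?_
    rw [hreal, Complex.real_smul, show (pt ∘ (-φ)) θ = pt (-φ θ) from rfl]
    push_cast
    ring
  have hG1 : G θ = G 0 := by
    have := is_const_of_deriv_eq_zero (f := G) (fun θ => (hG' θ).differentiableAt)
      (fun θ => (hG' θ).deriv)
    exact this θ 0
  have hG0 : G 0 = 1 := by
    simp only [hG, hφ, intervalIntegral.integral_same, add_zero]
    rw [← ha, ← pt_add, add_neg_cancel]
    simp [pt]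
  have : F θ = pt (φ θ) := by
    rw [hG0] at hG1
    have e := congrArg (· * pt (φ θ)) hG1
    simp only [hG, mul_assoc, one_mul] at e
    rwa [← pt_add, neg_add_cancel, show pt 0 = 1 by simp [pt], mul_one] at e
  rw [← this, hF]
  field_simp [hQ θ]

section Reduce

variable {d : ℕ} {p q : ℂ[X]}

lemma IsPencil.den_ne_zero (h : IsPencil d p q) : q ≠ 0 := by
  have := h.linearIndependent.ne_zero 1
  simpa using this

lemma IsPencil.wr_ne_zero (h : IsPencil d p q) : wr p q ≠ 0 := fun h0 => by
  have := h.norm_root 0 (by rw [h0]; simp)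
  simp at this

/-- The numerator and the denominator in lowest terms. -/
lemma exists_reduced (p : ℂ[X]) {q : ℂ[X]} (hq : q ≠ 0) :
    ∃ g : ℂ[X], p = g * (ratio p q).num ∧ q = g * (ratio p q).denom := by
  obtain ⟨g, hg⟩ := RatFunc.denom_div_dvd p q
  refine ⟨g, ?_, by rw [mul_comm]; exact hg⟩
  have h1 := RatFunc.num_div_denom (ratio p q)
  have hd := RatFunc.denom_ne_zero (ratio p q)
  have h2 := (RatFunc.num_mul_eq_mul_denom_iff (x := ratio p q) (p := p) hq).2 rfl
  have hg' : q = (ratio p q).denom * g := hg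
  refine mul_right_cancel₀ hd ?_
  rw [← h2]
  nth_rewrite 2 [hg']
  ring

/-- A common factor enters the Wronskian only by its square. So the zeros of the reduced Wronskian
are zeros of the original one, and a common zero costs multiplicity at least `2`. -/
lemma wr_mul (g P Q : ℂ[X]) : wr (g * P) (g * Q) = g ^ 2 * wr P Q := by
  simp only [wr, derivative_mul]; ring

theorem IsPencil.exists_circlePair (h : IsPencil d p q) :
    ∃ φ, CirclePair (ratio p q).num (ratio p q).denom φ := by
  obtain ⟨g, hp, hq⟩ := exists_reduced p h.den_ne_zero
  have hc := RatFunc.isCoprime_num_denom (ratio p q)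
  set P := (ratio p q).num
  set Q := (ratio p q).denom
  have hg : g ≠ 0 := fun h0 => h.den_ne_zero (by rw [hq, h0, zero_mul])
  -- Off the zeros of `g` the factor cancels; at the zeros the equality follows by continuity along
  -- the circle.
  have hnorm : ∀ θ, ‖P.eval (pt θ)‖ = ‖Q.eval (pt θ)‖ := fun θ => by
    have c1 : Tendsto (fun θ => ‖P.eval (pt θ)‖) (𝓝[≠] θ) (𝓝 ‖P.eval (pt θ)‖) :=
      ((P.continuous.comp continuous_pt).norm.tendsto θ).mono_left nhdsWithin_le_nhds
    have c2 : Tendsto (fun θ => ‖Q.eval (pt θ)‖) (𝓝[≠] θ) (𝓝 ‖Q.eval (pt θ)‖) :=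
      ((Q.continuous.comp continuous_pt).norm.tendsto θ).mono_left nhdsWithin_le_nhds
    refine tendsto_nhds_unique (c1.congr' ?_) c2
    filter_upwards [eventually_eval_pt_ne hg θ] with x hx
    have := h.norm_eq (pt x) (norm_pt x)
    rw [hp, hq, eval_mul, eval_mul, norm_mul, norm_mul] at this
    exact mul_left_cancel₀ (norm_ne_zero_iff.2 hx) this
  have hP : ∀ θ, P.eval (pt θ) ≠ 0 := fun θ h0 => by
    have := hnorm θ
    rw [h0, norm_zero, eq_comm, norm_eq_zero] at this
    exact not_both_zero hc h0 this
  have hQ : ∀ θ, Q.eval (pt θ) ≠ 0 := fun θ h0 => hP θ (by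
    have := hnorm θ
    rwa [h0, norm_zero, norm_eq_zero] at this)
  obtain ⟨φ, h1, h2⟩ := exists_lift hP hQ hnorm
  refine ⟨φ, hc, fun z hz => ?_, fun z hz h0 => ?_, h1, h2⟩
  · obtain ⟨θ, rfl⟩ := exists_pt_eq hz
    exact hnorm θ
  · have := h.norm_root z (by
      rw [hp, hq, wr_mul, IsRoot.def, eval_mul, h0, mul_zero])
    exact hz.ne this

end Reduce

end CircleNet

/-! ### Chords in the Riemann sphere and chords in the disc. -/

namespace CircleNet

open Set Filter Topology

variable {d : ℕ} {p q : ℂ[X]} {φ : ℝ → ℝ}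

lemma ratMap_coe (f : RatFunc ℂ) (z : ℂ) : ratMap f z = if f.denom.eval z = 0 then OnePoint.infty
    else ((f.num.eval z / f.denom.eval z : ℂ) : OnePoint ℂ) := rfl

lemma coe_mem_net {z : ℂ} : (z : OnePoint ℂ) ∈ net p q ↔
    ‖(ratio p q).num.eval z‖ = ‖(ratio p q).denom.eval z‖ := by
  have hc := RatFunc.isCoprime_num_denom (ratio p q)
  rw [net, mem_preimage, ratMap_coe]
  split_ifs with h
  · refine ⟨fun h' => ?_, fun h' => ?_⟩
    · obtain ⟨w, -, hw⟩ := h'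
      exact absurd hw (OnePoint.coe_ne_infty w)
    · rw [h, norm_zero, norm_eq_zero] at h'
      exact (not_both_zero hc h' h).elim
  · rw [← norm_quo_eq_iff h]
    constructor
    · rintro ⟨w, hw, hw'⟩
      rw [quo, ← OnePoint.coe_injective hw']
      simpa using hw
    · exact fun h' => ⟨_, mem_sphere_zero_iff_norm.2 h', rfl⟩

lemma coe_mem_vertices {z : ℂ} : (z : OnePoint ℂ) ∈ vertices p q ↔ (wr p q).IsRoot z := by
  constructor
  · rintro ⟨w, hw, hw'⟩
    rw [← OnePoint.coe_injective hw']
    exact hw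
  · exact fun h => ⟨z, h, rfl⟩

lemma coe_mem_closure {S : Set ℂ} {z : ℂ} :
    (z : OnePoint ℂ) ∈ closure ((fun z : ℂ => (z : OnePoint ℂ)) '' S) ↔ z ∈ closure S := by
  rw [OnePoint.isOpenEmbedding_coe.isInducing.closure_eq_preimage_closure_image S]
  rfl

/-- A connected set of which a clopen subset has a point is contained in this subset. -/
lemma _root_.IsPreconnected.subset_of_clopen {X : Type*} [TopologicalSpace X] {C u T : Set X}
    (hC : IsPreconnected C) (hu : IsOpen u) (hT : C ∩ u ⊆ T) (hcl : C ∩ closure T ⊆ u)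
    (hne : (C ∩ u).Nonempty) : C ⊆ u := by
  have h := isPreconnected_iff_subset_of_disjoint.1 hC u (closure T)ᶜ hu
    isClosed_closure.isOpen_compl (fun x hx => ?_) ?_
  · refine h.resolve_right fun h' => ?_
    obtain ⟨x, hx, hxu⟩ := hne
    exact h' hx (subset_closure (hT ⟨hx, hxu⟩))
  · by_cases hxT : x ∈ closure T
    · exact Or.inl (hcl ⟨hx, hxT⟩)
    · exact Or.inr hxT
  · rw [eq_empty_iff_forall_notMem]
    rintro x ⟨hx, hxu, hxT⟩
    exact hxT (subset_closure (hT ⟨hx, hxu⟩))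

/-- A common factor of the two polynomials gives multiple zeros of the Wronskian. -/
lemma two_le_mult {g P Q : ℂ[X]} {z : ℂ} (hg : g.eval z = 0) (h : wr (g * P) (g * Q) ≠ 0) :
    2 + (wr P Q).rootMultiplicity z ≤ (wr (g * P) (g * Q)).rootMultiplicity z := by
  rw [wr_mul] at h ⊢
  have hg0 : g ≠ 0 := fun h0 => h (by rw [h0]; ring)
  rw [rootMultiplicity_mul h, pow_two, rootMultiplicity_mul (mul_ne_zero hg0 hg0)]
  have := (rootMultiplicity_pos hg0).2 hg
  omega

lemma mult_eq {g P Q : ℂ[X]} {z : ℂ} (hg : g.eval z ≠ 0) (h : wr (g * P) (g * Q) ≠ 0) :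
    (wr (g * P) (g * Q)).rootMultiplicity z = (wr P Q).rootMultiplicity z := by
  rw [wr_mul] at h ⊢
  have hg0 : g ≠ 0 := fun h0 => h (by rw [h0]; ring)
  rw [rootMultiplicity_mul h, pow_two, rootMultiplicity_mul (mul_ne_zero hg0 hg0),
    rootMultiplicity_eq_zero hg]
  omega

lemma isRoot_wr_of_isRoot {g P Q : ℂ[X]} {z : ℂ} (h : (wr P Q).eval z = 0) :
    (wr (g * P) (g * Q)).IsRoot z := by
  rw [wr_mul, IsRoot.def, eval_mul, h, mul_zero]

namespace IsPencil

variable (h : IsPencil d p q) (hp : CirclePair (ratio p q).num (ratio p q).denom φ)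
include h

lemma isRoot_wr_of_isRoot {z : ℂ} (hz : (wr (ratio p q).num (ratio p q).denom).eval z = 0) :
    (wr p q).IsRoot z := by
  obtain ⟨g, h1, h2⟩ := exists_reduced p h.den_ne_zero
  have := CircleNet.isRoot_wr_of_isRoot (g := g) hz
  rwa [← h1, ← h2] at this

lemma image_discNet_subset :
    (fun z : ℂ => (z : OnePoint ℂ)) '' discNet (ratio p q).num (ratio p q).denom ⊆
      net p q \ vertices p q := by
  rintro _ ⟨z, hz, rfl⟩
  exact ⟨coe_mem_net.2 hz.2, fun h' => hz.1.ne (h.norm_root z (coe_mem_vertices.1 h'))⟩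

include hp

/-- The part of the net in the open disc accumulates on the circle only at critical points of the
quotient, which are removed as vertices. So it is open and closed in the net without vertices, and a
connected subset cannot leave it. -/
lemma subset_ball {C : Set (OnePoint ℂ)} (hC : IsPreconnected C) (hCn : C ⊆ net p q \ vertices p q)
    (hne : (C ∩ (fun z : ℂ => (z : OnePoint ℂ)) '' Metric.ball 0 1).Nonempty) :
    C ⊆ (fun z : ℂ => (z : OnePoint ℂ)) '' Metric.ball 0 1 := by
  refine hC.subset_of_clopen (OnePoint.isOpenEmbedding_coe.isOpenMap _ Metric.isOpen_ball)
    (T := (fun z : ℂ => (z : OnePoint ℂ)) '' discNet (ratio p q).num (ratio p q).denom) ?_ ?_ hne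
  · rintro _ ⟨hx, z, hz, rfl⟩
    exact ⟨z, ⟨by simpa using hz, coe_mem_net.1 (hCn hx).1⟩, rfl⟩
  · rintro x ⟨hxC, hx⟩
    have hK : IsClosed ((fun z : ℂ => (z : OnePoint ℂ)) '' Metric.closedBall 0 1) :=
      ((isCompact_closedBall (0 : ℂ) 1).image OnePoint.continuous_coe).isClosed
    have hsub : (fun z : ℂ => (z : OnePoint ℂ)) '' discNet (ratio p q).num (ratio p q).denom ⊆
        (fun z : ℂ => (z : OnePoint ℂ)) '' Metric.closedBall 0 1 :=
      image_mono fun z hz => by simpa using hz.1.le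
    obtain ⟨z, hz, rfl⟩ := closure_minimal hsub hK hx
    rcases lt_or_eq_of_le (by simpa using hz : ‖z‖ ≤ 1) with hlt | heq
    · exact ⟨z, by simpa using hlt, rfl⟩
    · obtain ⟨θ, rfl⟩ := exists_pt_eq heq
      have h1 := coe_mem_closure.1 hx
      have h2 := (hCn hxC).2
      have h3 := hp.eventually_notMem_discNet (t := θ) fun h0 =>
        h2 (coe_mem_vertices.2 (h.isRoot_wr_of_isRoot h0))
      obtain ⟨w, hw, hw'⟩ := mem_closure_iff_nhds.1 h1 _ h3
      exact absurd hw' hw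

lemma component_eq {z : ℂ} (hz : z ∈ discNet (ratio p q).num (ratio p q).denom) :
    connectedComponentIn (net p q \ vertices p q) (z : OnePoint ℂ) =
      (fun z : ℂ => (z : OnePoint ℂ)) ''
        connectedComponentIn (discNet (ratio p q).num (ratio p q).denom) z := by
  set D := discNet (ratio p q).num (ratio p q).denom
  have hzN : (z : OnePoint ℂ) ∈ net p q \ vertices p q := h.image_discNet_subset ⟨z, hz, rfl⟩
  have hCN := connectedComponentIn_subset (net p q \ vertices p q) (z : OnePoint ℂ)
  refine Subset.antisymm ?_ ?_
  · have hsub := h.subset_ball hp isPreconnected_connectedComponentIn hCN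
      ⟨_, mem_connectedComponentIn hzN, z, by simpa using hz.1, rfl⟩
    set C := connectedComponentIn (net p q \ vertices p q) (z : OnePoint ℂ)
    have him : (fun z : ℂ => (z : OnePoint ℂ)) '' ((fun z : ℂ => (z : OnePoint ℂ)) ⁻¹' C) = C :=
      image_preimage_eq_of_subset (hsub.trans (image_subset_range _ _))
    have hpre : IsPreconnected ((fun z : ℂ => (z : OnePoint ℂ)) ⁻¹' C) := by
      rw [← OnePoint.isOpenEmbedding_coe.isInducing.isPreconnected_image]
      change IsPreconnected ((fun z : ℂ => (z : OnePoint ℂ)) '' _)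
      rw [him]
      exact isPreconnected_connectedComponentIn
    rw [← him]
    refine image_mono (hpre.subset_connectedComponentIn ?_ fun w hw => ?_)
    · exact mem_connectedComponentIn hzN
    · obtain ⟨w', hw', e⟩ := hsub hw
      have : w' = w := OnePoint.coe_injective e
      subst this
      exact ⟨by simpa using hw', coe_mem_net.1 (hCN hw).1⟩
  · refine IsPreconnected.subset_connectedComponentIn
      (isPreconnected_connectedComponentIn.image _ OnePoint.continuous_coe.continuousOn)
      ⟨z, mem_connectedComponentIn hz, rfl⟩ ?_
    exact (image_mono (connectedComponentIn_subset _ _)).trans h.image_discNet_subset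

lemma isChord_iff {C : Set (OnePoint ℂ)} : IsChord p q C ↔
    ∃ c, IsDiscChord (ratio p q).num (ratio p q).denom c ∧
      C = (fun z : ℂ => (z : OnePoint ℂ)) '' c := by
  constructor
  · rintro ⟨⟨x, hx, rfl⟩, hsub⟩
    obtain ⟨z, hz, rfl⟩ := hsub (mem_connectedComponentIn hx)
    have hzD : z ∈ discNet (ratio p q).num (ratio p q).denom :=
      ⟨by simpa using hz, coe_mem_net.1 hx.1⟩
    exact ⟨_, ⟨z, hzD, rfl⟩, h.component_eq hp hzD⟩
  · rintro ⟨c, hc, rfl⟩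
    refine ⟨?_, image_mono fun z hz => by simpa using (hc.subset hz).1⟩
    obtain ⟨z, hz, rfl⟩ := hc
    exact ⟨z, h.image_discNet_subset ⟨z, hz, rfl⟩, (h.component_eq hp hz).symm⟩

end IsPencil

end CircleNet

/-! ### The degree of a vertex at which the quotient has no critical point. -/

namespace CircleNet

open Set Filter Topology

variable {d : ℕ} {p q : ℂ[X]} {φ : ℝ → ℝ}

/-- The chart has `k = 1` here, so the net near the point is just the circle. -/
lemma CirclePair.eventually_norm_eq_one {A B : ℂ[X]} (hp : CirclePair A B φ) {t : ℝ}
    (h : (wr A B).eval (pt t) ≠ 0) :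
    ∀ᶠ z in 𝓝 (pt t), ‖A.eval z‖ = ‖B.eval z‖ → ‖z‖ = 1 := by
  obtain ⟨e, a, ha, hes, he0, hez, -⟩ := hp.exists_chart t (k := 1)
    (by rw [Polynomial.rootMultiplicity_eq_zero h])
  filter_upwards [e.open_source.mem_nhds hes] with z hz hd
  obtain ⟨h1, h2, -, h4⟩ := hez z hz
  have h5 := (norm_quo_eq_iff h1).2 hd
  rw [h2, norm_mul, norm_pt, one_mul, Complex.norm_exp, Real.exp_eq_one_iff] at h5
  have h6 : a * (e z).im = 0 := by simpa using h5
  rw [h4]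
  rcases ha with rfl | rfl <;> linarith

lemma eventually_exists_pt (t : ℝ) {δ : ℝ} (hδ : 0 < δ) :
    ∀ᶠ z in 𝓝 (pt t), ‖z‖ = 1 → ∃ θ ∈ Ioo (t - δ) (t + δ), pt θ = z := by
  have h1 : ContinuousAt (fun z : ℂ => t + (z / pt t).arg) (pt t) := by
    refine continuousAt_const.add ((Complex.continuousAt_arg ?_).comp (by fun_prop))
    rw [div_self (pt_ne_zero t)]
    exact Complex.one_mem_slitPlane
  have h2 : t + (pt t / pt t).arg = t := by rw [div_self (pt_ne_zero t)]; simp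
  have h3 := h1.eventually (Ioo_mem_nhds (a := t - δ) (b := t + δ) (by beta_reduce; linarith)
    (by beta_reduce; linarith))
  filter_upwards [h3] with z hz hz1
  refine ⟨_, hz, ?_⟩
  have h4 := Complex.norm_mul_exp_arg_mul_I (z / pt t)
  rw [norm_div, hz1, norm_pt, div_one, Complex.ofReal_one, one_mul] at h4
  rw [pt_add, show pt (z / pt t).arg = z / pt t from h4, mul_div_cancel₀ _ (pt_ne_zero t)]

/-- A common zero of the two polynomials, at which the quotient has no critical point, has at most
two edges. -/
theorem IsPencil.vertexDegree_le (h : IsPencil d p q)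
    (hp : CirclePair (ratio p q).num (ratio p q).denom φ) {η : ℝ} (hη : (wr p q).IsRoot (pt η))
    (hw : (wr (ratio p q).num (ratio p q).denom).eval (pt η) ≠ 0) :
    vertexDegree p q (pt η : OnePoint ℂ) ≤ 4 := by
  obtain ⟨δ, hδ, hroot⟩ : ∃ δ > 0, ∀ θ, |θ - η| < δ → θ ≠ η → ¬(wr p q).IsRoot (pt θ) := by
    obtain ⟨δ, hδ, h1⟩ := Metric.mem_nhdsWithin_iff.1 (eventually_eval_pt_ne h.wr_ne_zero η)
    exact ⟨δ, hδ, fun θ h2 h3 => h1 ⟨by rwa [Metric.mem_ball, Real.dist_eq], h3⟩⟩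
  set N := net p q \ vertices p q with hN
  have hmem : ∀ θ, |θ - η| < δ → θ ≠ η → (pt θ : OnePoint ℂ) ∈ N := fun θ h1 h2 =>
    ⟨coe_mem_net.2 (hp.norm_eq _ (norm_pt θ)), fun h3 => hroot θ h1 h2 (coe_mem_vertices.1 h3)⟩
  have harc : ∀ x y, (∀ θ ∈ Ioo x y, |θ - η| < δ ∧ θ ≠ η) → ∀ θ ∈ Ioo x y, ∀ θ' ∈ Ioo x y,
      connectedComponentIn N (pt θ : OnePoint ℂ) = connectedComponentIn N (pt θ' : OnePoint ℂ) := by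
    intro x y hxy θ hθ θ' hθ'
    refine connectedComponentIn_eq (IsPreconnected.subset_connectedComponentIn
      (isPreconnected_Ioo.image (fun θ => (pt θ : OnePoint ℂ))
        (OnePoint.continuous_coe.comp continuous_pt).continuousOn) ⟨θ, hθ, rfl⟩ ?_ ⟨θ', hθ', rfl⟩)
    rintro _ ⟨θ₀, h0, rfl⟩
    exact hmem θ₀ (hxy θ₀ h0).1 (hxy θ₀ h0).2
  have hl : ∀ θ ∈ Ioo (η - δ) η, |θ - η| < δ ∧ θ ≠ η := fun θ hθ =>
    ⟨by rw [abs_lt]; constructor <;> linarith [hθ.1, hθ.2], hθ.2.ne⟩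
  have hr : ∀ θ ∈ Ioo η (η + δ), |θ - η| < δ ∧ θ ≠ η := fun θ hθ =>
    ⟨by rw [abs_lt]; constructor <;> linarith [hθ.1, hθ.2], hθ.1.ne'⟩
  set E := {e | IsEdge p q e ∧ (pt η : OnePoint ℂ) ∈ closure e} with hE
  -- Any edge ending at `pt η` contains points of the circle near it, on one of the two sides, and
  -- each side belongs to a single edge. The second term of the degree counts loops again, whence
  -- the bound `2 + 2`.
  have hsub : E ⊆ {connectedComponentIn N (pt (η - δ / 2) : OnePoint ℂ),
      connectedComponentIn N (pt (η + δ / 2) : OnePoint ℂ)} := by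
    rintro _ ⟨⟨x, hx, rfl⟩, hcl⟩
    have hev := (hp.eventually_norm_eq_one hw).and (eventually_exists_pt η hδ)
    obtain ⟨_, ⟨z, hz, rfl⟩, hzc⟩ := mem_closure_iff_nhds.1 hcl _
      (OnePoint.isOpenEmbedding_coe.isOpenMap.image_mem_nhds hev)
    have hzN := connectedComponentIn_subset _ _ hzc
    obtain ⟨θ, hθ, rfl⟩ := hz.2 (hz.1 (coe_mem_net.1 hzN.1))
    rw [connectedComponentIn_eq hzc]
    rcases lt_trichotomy θ η with hlt | rfl | hlt
    · exact Or.inl (harc _ _ hl θ ⟨hθ.1, hlt⟩ (η - δ / 2) ⟨by linarith, by linarith⟩)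
    · exact absurd (coe_mem_vertices.2 hη) hzN.2
    · exact Or.inr (harc _ _ hr θ ⟨hlt, hθ.2⟩ (η + δ / 2) ⟨by linarith, by linarith⟩)
  have hfin : E.Finite := (Set.toFinite _).subset hsub
  have h1 : E.ncard ≤ 2 := (ncard_le_ncard hsub (Set.toFinite _)).trans
    ((ncard_insert_le _ _).trans (by rw [ncard_singleton]))
  have h2 : {e | IsEdge p q e ∧ closure e = insert (pt η : OnePoint ℂ) e}.ncard ≤ E.ncard :=
    ncard_le_ncard (fun e he => ⟨he.1, he.2 ▸ mem_insert _ _⟩) hfin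
  change E.ncard + _ ≤ 4
  omega

end CircleNet

/-! ### Argument lifts, counts of vertices and chords to earlier vertices. -/

namespace CircleNet

open Set Filter Topology

variable {d : ℕ} {p q : ℂ[X]} {φ : ℝ → ℝ}

lemma ratMap_pt (hp : CirclePair (ratio p q).num (ratio p q).denom φ) (θ : ℝ) :
    ratMap (ratio p q) (pt θ : OnePoint ℂ) = (pt (φ θ) : OnePoint ℂ) := by
  rw [ratMap_coe, if_neg (hp.den_pt_ne θ)]
  exact congrArg _ (hp.quo_pt θ)

/-- Two lifts of the argument differ by a constant. -/
lemma IsArgLift.sub_eq (hp : CirclePair (ratio p q).num (ratio p q).denom φ) {S : Set ℝ}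
    (hS : IsPreconnected S) {ψ : ℝ → ℝ} (hψ : IsArgLift (ratio p q) S ψ) {x y : ℝ} (hx : x ∈ S)
    (hy : y ∈ S) : ψ x - φ x = ψ y - φ y := by
  have key := log_sub_eq (G := fun θ => (ψ θ : ℂ) * Complex.I) (H := fun θ => (φ θ : ℂ) * Complex.I)
    hS ((Complex.continuous_ofReal.comp_continuousOn hψ.1).mul continuousOn_const)
    ((Complex.continuous_ofReal.comp hp.continuous_lift).continuousOn.mul continuousOn_const)
    (fun θ hθ => OnePoint.coe_injective ((hψ.2 θ hθ).symm.trans (ratMap_pt hp θ))) hx hy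
  rw [← sub_mul, ← sub_mul, mul_left_inj' Complex.I_ne_zero] at key
  exact_mod_cast key

lemma CirclePair.isArgLift (hp : CirclePair (ratio p q).num (ratio p q).denom φ) (S : Set ℝ) :
    IsArgLift (ratio p q) S φ :=
  ⟨hp.continuous_lift.continuousOn, fun θ _ => ratMap_pt hp θ⟩

lemma CirclePair.isArgIncrement_iff (hp : CirclePair (ratio p q).num (ratio p q).denom φ)
    {α β L : ℝ} (h : α ≤ β) : IsArgIncrement (ratio p q) α β L ↔ L = φ β - φ α := by
  constructor
  · rintro ⟨ψ, hψ, rfl⟩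
    have := hψ.sub_eq hp isPreconnected_Icc (left_mem_Icc.2 h) (right_mem_Icc.2 h)
    linarith
  · exact fun hL => ⟨φ, hp.isArgLift _, hL⟩

/-- Otherwise `φ` would decrease strictly just after `α`, although it differs by a constant from a
strictly increasing lift. -/
lemma CirclePair.rho_pos_of_orientationPreserving
    (hp : CirclePair (ratio p q).num (ratio p q).denom φ) {α β : ℝ} (h : α < β)
    (ho : OrientationPreservingOn (ratio p q) α β) :
    ∀ᶠ θ in 𝓝[>] α, 0 < rho (ratio p q).num (ratio p q).denom θ := by
  refine (hp.eventually_right α).resolve_right fun hn => ?_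
  obtain ⟨ψ, hψ, hmono⟩ := ho
  obtain ⟨b, hb, hneg⟩ := exists_gt_of_eventually hn
  have hc : α < min b β := lt_min hb h
  have hanti := hp.swap.strictMonoOn_of_rho_pos (a := α) (b := min b β) fun θ hθ => by
    rw [rho_swap (ratio p q).num]
    linarith [hneg θ ⟨hθ.1, hθ.2.trans_le (min_le_left _ _)⟩]
  obtain ⟨x, hx⟩ := nonempty_Ioo.2 hc
  obtain ⟨y, hy⟩ := nonempty_Ioo.2 hx.2
  have hxs : x ∈ Ioo α β := ⟨hx.1, hx.2.trans_le (min_le_right _ _)⟩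
  have hys : y ∈ Ioo α β := ⟨hx.1.trans hy.1, hy.2.trans_le (min_le_right _ _)⟩
  have e1 := hmono hxs hys hy.1
  have e2 := hanti ⟨hx.1.le, hx.2.le⟩ ⟨(hx.1.trans hy.1).le, hy.2.le⟩ hy.1
  have e3 := hψ.sub_eq hp isPreconnected_Ioo hxs hys
  beta_reduce at e2
  linarith

lemma finite_arcVertices (h : IsPencil d p q) {α β : ℝ} (hβα : β < α + 2 * Real.pi) :
    (arcVertices p q α β).Finite := by
  refine Finite.of_finite_image (f := pt) (((wr p q).rootSet_finite ℂ).subset ?_) ?_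
  · rintro _ ⟨θ, hθ, rfl⟩
    rw [mem_rootSet]
    exact ⟨h.wr_ne_zero, by simpa using hθ.2⟩
  · intro x hx y hy hxy
    exact pt_injOn (by
      rw [abs_lt]; constructor <;> linarith [hx.1.1, hx.1.2, hy.1.1, hy.1.2]) hxy

lemma arcCount_eq {W : Finset ℝ} {α β : ℝ} (hW : ∀ θ, θ ∈ W ↔ θ ∈ arcVertices p q α β) {m : ℝ → ℕ}
    (hm : ∀ θ ∈ W, mult p q θ = m θ) {t : ℝ} (ht : t ≤ β) :
    arcCount p q α t = countBefore W m α t := by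
  have h1 : arcVertices p q α t = ((W.filter fun u => α < u ∧ u < t : Finset ℝ) : Set ℝ) := by
    ext u
    simp only [Finset.coe_filter, hW]
    exact ⟨fun hu => ⟨⟨⟨hu.1.1, hu.1.2.trans_le ht⟩, hu.2⟩, hu.1⟩, fun hu => ⟨hu.2, hu.1.2⟩⟩
  rw [arcCount, h1, finsum_mem_coe_finset, countBefore]
  exact Finset.sum_congr rfl fun u hu => hm u (Finset.mem_filter.1 hu).1

lemma countBefore_add_le {W : Finset ℝ} {m : ℝ → ℕ} {α t t' : ℝ} (ht : t ∈ W) (hα : α < t)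
    (htt' : t < t') : countBefore W m α t + m t ≤ countBefore W m α t' := by
  have hnot : t ∉ W.filter fun u => α < u ∧ u < t := fun h => (Finset.mem_filter.1 h).2.2.false
  rw [countBefore, add_comm, ← Finset.sum_insert hnot]
  refine Finset.sum_le_sum_of_subset fun u hu => ?_
  rcases Finset.mem_insert.1 hu with rfl | hu
  · exact Finset.mem_filter.2 ⟨ht, hα, htt'⟩
  · obtain ⟨h1, h2, h3⟩ := Finset.mem_filter.1 hu
    exact Finset.mem_filter.2 ⟨h1, h2, h3.trans htt'⟩

/-- The number of chords from a vertex to earlier vertices, at a vertex with at most one chord to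
another vertex of the arc. -/
lemma IsPencil.lowerChords_eq (h : IsPencil d p q)
    (hp : CirclePair (ratio p q).num (ratio p q).denom φ) {α t : ℝ}
    (hu : ∀ c c', IsDiscChord (ratio p q).num (ratio p q).denom c →
      IsDiscChord (ratio p q).num (ratio p q).denom c' → pt t ∈ closure c → pt t ∈ closure c' →
      (∃ t' ∈ Ioo α t, pt t' ∈ closure c) → (∃ t' ∈ Ioo α t, pt t' ∈ closure c') → c = c') (j : ℕ) :
    (1 ≤ j ∧ j ≤ lowerChords p q α t) ↔
      j = 1 ∧ ∃ t' ∈ Ioo α t, Joined (ratio p q).num (ratio p q).denom t t' := by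
  set S := {c | IsChord p q c ∧ (pt t : OnePoint ℂ) ∈ closure c ∧
    ∃ t' ∈ arcVertices p q α t, (pt t' : OnePoint ℂ) ∈ closure c} with hS
  have hmem : ∀ C, C ∈ S ↔ ∃ c, IsDiscChord (ratio p q).num (ratio p q).denom c ∧
      C = (fun z : ℂ => (z : OnePoint ℂ)) '' c ∧ pt t ∈ closure c ∧
      ∃ t' ∈ Ioo α t, pt t' ∈ closure c := by
    intro C
    constructor
    · rintro ⟨h1, h2, t', ht', h3⟩
      obtain ⟨c, hc, rfl⟩ := (h.isChord_iff hp).1 h1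
      exact ⟨c, hc, rfl, coe_mem_closure.1 h2, t', ht'.1, coe_mem_closure.1 h3⟩
    · rintro ⟨c, hc, rfl, h2, t', ht', h3⟩
      exact ⟨(h.isChord_iff hp).2 ⟨c, hc, rfl⟩, coe_mem_closure.2 h2, t',
        ⟨ht', h.isRoot_wr_of_isRoot (hc.isVertex hp h3)⟩, coe_mem_closure.2 h3⟩
  have hsub : S.Subsingleton := by
    intro C hC C' hC'
    obtain ⟨c, hc, rfl, h1, h2⟩ := (hmem C).1 hC
    obtain ⟨c', hc', rfl, h1', h2'⟩ := (hmem C').1 hC'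
    rw [hu c c' hc hc' h1 h1' h2 h2']
  have hJ : (∃ t' ∈ Ioo α t, Joined (ratio p q).num (ratio p q).denom t t') ↔ S.Nonempty := by
    constructor
    · rintro ⟨t', ht', c, hc, h1, h2⟩
      exact ⟨_, (hmem _).2 ⟨c, hc, rfl, h1, t', ht', h2⟩⟩
    · rintro ⟨C, hC⟩
      obtain ⟨c, hc, -, h1, t', ht', h2⟩ := (hmem C).1 hC
      exact ⟨t', ht', c, hc, h1, h2⟩
  rw [hJ]
  change 1 ≤ j ∧ j ≤ S.ncard ↔ _
  rcases hsub.eq_empty_or_singleton with he | ⟨C, he⟩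
  · rw [he, ncard_empty]; simp; omega
  · rw [he, ncard_singleton]; simp; omega

end CircleNet

/-! ### The vertices of the arc are not common zeros of the two polynomials. -/

namespace CircleNet

open Set Filter Topology

variable {d : ℕ} {p q : ℂ[X]} {φ : ℝ → ℝ}

/-- The vertices of an arc with one double vertex of degree `6` and simple vertices otherwise are not
common zeros of the two polynomials. -/
lemma IsPencil.exists_factor (h : IsPencil d p q)
    (hp : CirclePair (ratio p q).num (ratio p q).denom φ) {α η β : ℝ}
    (hdouble : mult p q η = 2) (hsimple : ∀ θ ∈ arcVertices p q α β, θ ≠ η → mult p q θ = 1)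
    (hdegree : vertexDegree p q (pt η : OnePoint ℂ) = 6) :
    ∀ θ ∈ arcVertices p q α β, ¬(p.IsRoot (pt θ) ∧ q.IsRoot (pt θ)) ∧
      (wr (ratio p q).num (ratio p q).denom).eval (pt θ) = 0 ∧
      mult p q θ = (wr (ratio p q).num (ratio p q).denom).rootMultiplicity (pt θ) := by
  obtain ⟨g, h1, h2⟩ := exists_reduced p h.den_ne_zero
  have hw := h.wr_ne_zero
  have hc := RatFunc.isCoprime_num_denom (ratio p q)
  intro θ hθ
  set P := (ratio p q).num
  set Q := (ratio p q).denom
  have hw' := hw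
  rw [h1, h2] at hw'
  -- A zero of the common factor has multiplicity at least `2`, so it is not a simple vertex. At `η`
  -- it would use up the whole multiplicity, so the quotient would have no critical point there and
  -- the degree would be at most `4`, not `6`.
  have hg : g.eval (pt θ) ≠ 0 := by
    intro hg
    have hle := two_le_mult hg hw'
    rw [← h1, ← h2] at hle
    change _ ≤ mult p q θ at hle
    by_cases hθη : θ = η
    · subst hθη
      have h3 : (wr P Q).eval (pt θ) ≠ 0 := fun h0 => by
        have := (rootMultiplicity_pos hp.wr_ne_zero).2 h0
        omega
      have := h.vertexDegree_le hp hθ.2 h3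
      omega
    · have := hsimple θ hθ hθη
      omega
  have hm : mult p q θ = (wr P Q).rootMultiplicity (pt θ) := by
    have := mult_eq hg hw'
    rwa [← h1, ← h2] at this
  refine ⟨fun ⟨r1, r2⟩ => ?_, ?_, hm⟩
  · rw [h1, IsRoot.def, eval_mul] at r1
    rw [h2, IsRoot.def, eval_mul] at r2
    exact not_both_zero hc ((mul_eq_zero.1 r1).resolve_left hg)
      ((mul_eq_zero.1 r2).resolve_left hg)
  · refine (rootMultiplicity_pos hp.wr_ne_zero).1 ?_
    rw [← hm]
    exact (rootMultiplicity_pos hw).2 hθ.2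

end CircleNet

end

/-! ### The theorem for a pencil. -/

open Set Filter Topology CircleNet

theorem theorem5p2 (d : ℕ) (p q : ℂ[X]) (hpq : CircleNet.IsPencil d p q)
    (α β : ℝ) (hαβ : α < β) (hβα : β < α + 2 * Real.pi)
    (η : ℝ) (hη : η ∈ Set.Ioo α β)
    (hdouble : CircleNet.mult p q η = 2)
    (hsimple : ∀ θ ∈ CircleNet.arcVertices p q α β, θ ≠ η → CircleNet.mult p q θ = 1)
    (hdegree : CircleNet.vertexDegree p q (CircleNet.pt η : OnePoint ℂ) = 6)
    (houtside : ∀ c, CircleNet.IsChord p q c → (CircleNet.pt η : OnePoint ℂ) ∈ closure c →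
      ∀ θ ∈ CircleNet.arcVertices p q α β, θ ≠ η →
        (CircleNet.pt θ : OnePoint ℂ) ∉ closure c)
    (θ₁ : ℝ) (hfirst : IsLeast (CircleNet.arcVertices p q α β) θ₁)
    (horient : CircleNet.OrientationPreservingOn (CircleNet.ratio p q) α θ₁)
    (n O E : ℕ) (hn : n = CircleNet.arcCount p q α β)
    (hO : O = CircleNet.oddCount p q α β) (hE : E = CircleNet.evenCount p q α β) :
    (∃ L : ℝ, CircleNet.IsArgIncrement (CircleNet.ratio p q) α β L) ∧
    ∀ L : ℝ, CircleNet.IsArgIncrement (CircleNet.ratio p q) α β L →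
      (Odd (CircleNet.arcVertices p q α η).ncard →
        L ∈ Set.Ioo
          (((((n + 1) % 2 : ℕ) : ℝ) - n + 4 * O - 1) * Real.pi)
          (((((n + 1) % 2 : ℕ) : ℝ) + n - 4 * E - 1) * Real.pi)) ∧
      (Even (CircleNet.arcVertices p q α η).ncard →
        L ∈ Set.Ioo
          (((((n + 1) % 2 : ℕ) : ℝ) - n + 4 * O + 1) * Real.pi)
          (((((n + 1) % 2 : ℕ) : ℝ) + n - 4 * E + 1) * Real.pi)) := by
  obtain ⟨φ, hp⟩ := hpq.exists_circlePair
  refine ⟨⟨_, (hp.isArgIncrement_iff hαβ.le).2 rfl⟩, fun L hL => ?_⟩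
  rw [hp.isArgIncrement_iff hαβ.le] at hL
  subst hL
  have hfac := hpq.exists_factor hp hdouble hsimple hdegree
  have hfin := finite_arcVertices hpq hβα
  set W := hfin.toFinset with hWdef
  have hW : ∀ θ, θ ∈ W ↔ θ ∈ arcVertices p q α β := fun θ => hfin.mem_toFinset
  have hηv : η ∈ arcVertices p q α β :=
    ⟨hη, (rootMultiplicity_pos hpq.wr_ne_zero).1 (by
      change 0 < mult p q η; rw [hdouble]; norm_num)⟩
  have harc : IsDoubleArc (ratio p q).num (ratio p q).denom φ W α η β :=
    { pair := hp
      mem := hη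
      lt_add := hβα
      mem_iff := fun t ht => (hW t).trans ⟨fun h => (hfac t h).2.1, fun h =>
        ⟨ht, hpq.isRoot_wr_of_isRoot h⟩⟩
      simple := fun t ht _ hne => by
        rw [← (hfac t ((hW t).1 ht)).2.2]; exact hsimple t ((hW t).1 ht) hne
      double := by rw [← (hfac η hηv).2.2, hdouble]
      outside := fun t ht _ hne ⟨c, hc, h1, h2⟩ =>
        houtside _ ((hpq.isChord_iff hp).2 ⟨c, hc, rfl⟩) (coe_mem_closure.2 h1) t ((hW t).1 ht) hne
          (coe_mem_closure.2 h2) }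
  have hα := hp.rho_pos_of_orientationPreserving hfirst.1.1.1 horient
  set c : ℝ → ℕ := countBefore W
    (fun u => (wr (ratio p q).num (ratio p q).denom).rootMultiplicity (pt u)) α with hc
  have hcount : ∀ t ≤ β, arcCount p q α t = c t := fun t ht =>
    arcCount_eq hW (fun θ hθ => (hfac θ ((hW θ).1 hθ)).2.2) ht
  -- the second row
  set S : Set ℝ := {t | t ∈ Ioo α β ∧ t ∈ W ∧
    ∃ t' ∈ Ioo α t, Joined (ratio p q).num (ratio p q).denom t t'} with hS
  have hlower : ∀ t ∈ arcVertices p q α β, ∀ j, (1 ≤ j ∧ j ≤ lowerChords p q α t) ↔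
      j = 1 ∧ ∃ t' ∈ Ioo α t, Joined (ratio p q).num (ratio p q).denom t t' := by
    intro t ht j
    refine hpq.lowerChords_eq hp (fun c c' hc hc' h1 h1' h2 h2' => ?_) j
    by_cases hne : t = η
    · subst hne
      obtain ⟨t', ht', h3⟩ := h2
      have ht'i : t' ∈ Ioo α β := ⟨ht'.1, ht'.2.trans ht.1.2⟩
      exact absurd ⟨c, hc, h1, h3⟩ (harc.outside t' ((harc.mem_iff t' ht'i).2
        (hc.isVertex hp h3)) ht'i ht'.2.ne)
    · obtain ⟨c₀, -, -, hu, -⟩ :=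
        hp.exists_chord_of_simple (harc.simple t ((hW t).2 ht) ht.1 hne)
      exact (hu c hc h1).trans (hu c' hc' h1').symm
  -- Each vertex has at most one chord to earlier vertices of the arc and none is a common zero, so
  -- a vertex `t` contributes at most its first label `c t + 1`.
  have hrow : secondRow p q α β = (fun t => c t + 1) '' S := by
    ext i
    constructor
    · rintro ⟨t, ht, ⟨j, hj1, hj2, rfl⟩ | ⟨r1, r2, -⟩⟩
      · obtain ⟨rfl, hJ⟩ := (hlower t ht j).1 ⟨hj1, hj2⟩
        exact ⟨t, ⟨ht.1, (hW t).2 ht, hJ⟩, by rw [hcount t ht.1.2.le]⟩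
      · exact absurd ⟨r1, r2⟩ (hfac t ht).1
    · rintro ⟨t, ⟨hti, htW, hJ⟩, rfl⟩
      have ht := (hW t).1 htW
      obtain ⟨h1, h2⟩ := (hlower t ht 1).2 ⟨rfl, hJ⟩
      exact ⟨t, ht, Or.inl ⟨1, h1, h2, by rw [hcount t hti.2.le]⟩⟩
  -- Vertices have positive multiplicity, so the count strictly increases from one vertex to the
  -- next and entries of the second row can be counted by their vertices.
  have hinj : InjOn (fun t => c t + 1) S := by
    have hlt : ∀ t ∈ S, ∀ t' ∈ S, t < t' → c t < c t' := fun t ht t' ht' h => by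
      have h1 := countBefore_add_le
        (m := fun u => (wr (ratio p q).num (ratio p q).denom).rootMultiplicity (pt u))
        ht.2.1 ht.1.1 h
      have h2 := (rootMultiplicity_pos hp.wr_ne_zero).2 ((harc.mem_iff t ht.1).1 ht.2.1)
      exact lt_of_lt_of_le (Nat.lt_add_of_pos_right h2) h1
    intro t ht t' ht' heq
    rcases lt_trichotomy t t' with h | h | h
    · have := hlt t ht t' ht' h
      simp only at heq
      omega
    · exact h
    · have := hlt t' ht' t ht h
      simp only at heq
      omega
  have hcard : ∀ (P : ℕ → Prop) (R : ℕ → Prop), (∀ i, P (i + 1) ↔ R i) →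
      {i | i ∈ secondRow p q α β ∧ P i}.ncard = {t | t ∈ Ioo α β ∧ t ∈ W ∧
        (∃ t' ∈ Ioo α t, Joined (ratio p q).num (ratio p q).denom t t') ∧ R (c t)}.ncard := by
    intro P R hPR
    have : {i | i ∈ secondRow p q α β ∧ P i} = (fun t => c t + 1) '' {t | t ∈ Ioo α β ∧ t ∈ W ∧
        (∃ t' ∈ Ioo α t, Joined (ratio p q).num (ratio p q).denom t t') ∧ R (c t)} := by
      ext i
      rw [hrow]
      constructor
      · rintro ⟨⟨t, ht, rfl⟩, hPi⟩
        exact ⟨t, ⟨ht.1, ht.2.1, ht.2.2, (hPR _).1 hPi⟩, rfl⟩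
      · rintro ⟨t, ⟨h1, h2, h3, h4⟩, rfl⟩
        exact ⟨⟨t, ⟨h1, h2, h3⟩, rfl⟩, (hPR _).2 h4⟩
    rw [this]
    refine InjOn.ncard_image (hinj.mono ?_)
    exact fun t ht => ⟨ht.1, ht.2.1, ht.2.2.1⟩
  have hk : (arcVertices p q α η).ncard = {t | t ∈ Ioo α η ∧ t ∈ W}.ncard := by
    congr 1
    ext t
    exact ⟨fun ht => ⟨ht.1, (hW t).2 ⟨⟨ht.1.1, ht.1.2.trans hη.2⟩, ht.2⟩⟩,
      fun ht => ⟨ht.1, ((hW t).1 ht.2).2⟩⟩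
  exact harc.increment_mem hα hc (hn.trans (hcount β le_rfl))
    (hO.trans (hcard _ _ fun i => by rw [Nat.odd_add_one, Nat.not_odd_iff_even]))
    (hE.trans (hcard _ _ fun i => Nat.even_add_one)) hk
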